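/- Let $h_n(x)=(-1)^n c_n e^{x^2/2}\frac{d^n}{dx^n}(e^{-x^2})$ with $1/c_n=(n!)^{1/2}2^{n/2}\pi^{1/4}$, $n\ge 0$, be the Hermite functions, so that $(-\partial_x^2+x^2)h_n=\lambda_n^2h_n$ with $\lambda_n=\sqrt{2n+1}$. For $s\in\mathbb R$ let $\mathcal H^{s}$ be the space of tempered distributions $u=\sum_n c_nh_n$ on $\mathbb R$ (where $c_n=\langle u,h_n\rangle$) with $\|u\|_{\mathcal H^s}^2=\sum_n\lambda_n^{2s}|c_n|^2<\infty$. Fix $\sigma>0$. Let $(g_n)_{n\ge0}$ be independent standard complex Gaussian variables (density $\frac1\pi e^{-|z|^2}$ on $\mathbb C$), and let $\mu$, $\tilde\mu_N$, $\mu^N$ be the laws on $\mathcal H^{-\sigma}$ of $$\sum_{n\ge0}\tfrac{\sqrt2}{\lambda_n}g_nh_n,\qquad \sum_{n\le N}\tfrac{\sqrt2}{\lambda_n}g_nh_n,\qquad \sum_{n>N}\tfrac{\sqrt2}{\lambda_n}g_nh_n .$$ Let $\chi\in C_0^\infty(-1,1)$ be real valued with $\chi=1$ on $[-\frac12,\frac12]$,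 and for $u=\sum_nc_nh_n$ put $$\Pi_Nu=\sum_{n\le N}c_nh_n,\qquad S_Nu=\sum_{n\ge0}\chi\Big(\frac{2n+1}{2N+1}\Big)c_nh_n .$$ For a tempered distribution $u$ let $\|u\|_{L^p}=\infty$ if $u$ is not represented by an $L^p(\mathbb R)$ function. (i) Defocusing case. Let $k\ge3$ be an integer, and let $$d\rho=\exp\Big(-\frac{\|u\|_{L^{k+1}}^{k+1}}{k+1}\Big)d\mu,\qquad d\rho_N=\exp\Big(-\frac{\|S_Nu\|_{L^{k+1}}^{k+1}}{k+1}\Big)d\mu ,$$ with $\exp(-\infty)=0$. Then $u\mapsto\|u\|_{L^{k+1}}$ is $\mu$-measurable and $\mu$-almost surely finite, and $\rho$ is a nontrivial measure: $0<\rho(\mathcal H^{-\sigma})<\infty$. (ii) Cubic focusing case. Let $\zeta:\mathbb R\to[0,\infty)$ be continuous with compact support, let $\alpha_N=\sum_{n=0}^N 2/\lambda_n^2$ (the $\mu$-expectation of $\|\Pi_Nu\|_{L^2}^2$), and $$G_N(u)=\zeta\big(\|\Pi_Nu\|_{L^2}^2-\alpha_N\big)\exp\Big(\frac14\|S_Nu\|_{L^4}^4\Big).$$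 Let $d\tilde\rho_N=G_N\,d\tilde\mu_N$ and $\rho_N=\mu^N\otimes\tilde\rho_N$, that is, the image of the product measure under $(v,w)\mapsto v+w$. Then $G_N$ converges in $\mu$-measure, as $N\to\infty$, to some $G$ with $G\in L^p(d\mu)$ for every $p\in[1,\infty)$. Put $d\rho=G\,d\mu$. In both cases $\rho_N$ converges weakly to $\rho$ as $N\to\infty$, and $\rho_N(A)\to\rho(A)$ for every Borel set $A\subset\mathcal H^{-\sigma}$. -/

import Mathlib

open MeasureTheory ProbabilityTheory Filter Topology
open scoped SchwartzMap ENNReal BoundedContinuousFunction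

noncomputable section

namespace HarmonicGibbs

/-! ### Hermite functions -/

/-- The `n`-th Hermite function
`h_n(x) = (-1)^n c_n e^{x²/2} (d/dx)^n (e^{-x²})`, `1 / c_n = (n!)^{1/2} 2^{n/2} π^{1/4}`;
it is the `L²`-normalized eigenfunction of `H = -∂_x² + x²` for the eigenvalue `2n+1`. -/
def hermiteFun (n : ℕ) (x : ℝ) : ℝ :=
  (-1) ^ n * (Real.sqrt n.factorial * (2 : ℝ) ^ ((n : ℝ) / 2) * Real.pi ^ ((1 : ℝ) / 4))⁻¹ *
    Real.exp (x ^ 2 / 2) * iteratedDeriv n (fun y : ℝ => Real.exp (-y ^ 2)) x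

/-- A complex polynomial times the Gaussian `e^{-x²/2}`. -/
def polyGauss (P : Polynomial ℂ) (x : ℝ) : ℂ :=
  P.eval (x : ℂ) * ((Real.exp (-x ^ 2 / 2) : ℝ) : ℂ)

theorem hasDerivAt_polyGauss (P : Polynomial ℂ) (x : ℝ) :
    HasDerivAt (polyGauss P) (polyGauss (P.derivative - Polynomial.X * P) x) x := by
  have h1 : HasDerivAt (fun y : ℝ => P.eval (y : ℂ)) (P.derivative.eval (x : ℂ)) x :=
    (P.hasDerivAt (x : ℂ)).comp_ofReal
  have h2 : HasDerivAt (fun y : ℝ => Real.exp (-y ^ 2 / 2))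
      (Real.exp (-x ^ 2 / 2) * (-x)) x := by
    have h3 : HasDerivAt (fun y : ℝ => -y ^ 2 / 2) (-x) x := by
      have := ((hasDerivAt_pow 2 x).neg).div_const 2
      refine this.congr_deriv ?_
      norm_num
      ring
    exact h3.exp
  have h4 := h1.mul h2.ofReal_comp
  refine h4.congr_deriv ?_
  simp only [polyGauss, Polynomial.eval_sub, Polynomial.eval_mul, Polynomial.eval_X]
  push_cast
  ring

theorem iteratedDeriv_polyGauss (n : ℕ) :
    ∀ P : Polynomial ℂ, ∃ Q : Polynomial ℂ, iteratedDeriv n (polyGauss P) = polyGauss Q := by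
  induction n with
  | zero => exact fun P => ⟨P, iteratedDeriv_zero⟩
  | succ n ih =>
    intro P
    obtain ⟨Q, hQ⟩ := ih (P.derivative - Polynomial.X * P)
    refine ⟨Q, ?_⟩
    rw [iteratedDeriv_succ']
    have : deriv (polyGauss P) = polyGauss (P.derivative - Polynomial.X * P) :=
      funext fun x => (hasDerivAt_polyGauss P x).deriv
    rw [this, hQ]

theorem contDiff_polyGauss (P : Polynomial ℂ) : ContDiff ℝ ((⊤ : ℕ∞) : WithTop ℕ∞) (polyGauss P) := by
  refine contDiff_of_differentiable_iteratedDeriv fun m _ => ?_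
  obtain ⟨Q, hQ⟩ := iteratedDeriv_polyGauss m P
  rw [hQ]
  exact fun x => (hasDerivAt_polyGauss Q x).differentiableAt

theorem abs_pow_mul_gauss_le (m : ℕ) (x : ℝ) :
    |x| ^ m * Real.exp (-x ^ 2 / 2) ≤ 1 + 2 ^ m * m.factorial := by
  have h0 : (x ^ 2 / 2) ^ m / m.factorial ≤ Real.exp (x ^ 2 / 2) :=
    Real.pow_div_factorial_le_exp _ (by positivity) m
  have hf : (0 : ℝ) < m.factorial := by positivity
  have h1 : (x ^ 2) ^ m ≤ 2 ^ m * m.factorial * Real.exp (x ^ 2 / 2) := by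
    rw [div_le_iff₀ hf, div_pow, div_le_iff₀ (by positivity)] at h0
    linarith
  have h2 : |x| ^ m ≤ 1 + (x ^ 2) ^ m := by
    have : (x ^ 2) ^ m = (|x| ^ m) ^ 2 := by
      rw [← sq_abs, ← pow_mul, ← pow_mul, mul_comm]
    rw [this]
    nlinarith [sq_nonneg (|x| ^ m - 1), sq_nonneg (|x| ^ m)]
  have h3 : (1 : ℝ) ≤ Real.exp (x ^ 2 / 2) := Real.one_le_exp (by positivity)
  have h4 : Real.exp (-x ^ 2 / 2) = (Real.exp (x ^ 2 / 2))⁻¹ := by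
    rw [← Real.exp_neg]
    congr 1
    ring
  rw [h4, ← div_eq_mul_inv, div_le_iff₀ (by positivity)]
  nlinarith

theorem polyGauss_bound (k : ℕ) (P : Polynomial ℂ) :
    ∃ C : ℝ, ∀ x : ℝ, |x| ^ k * ‖polyGauss P x‖ ≤ C := by
  induction P using Polynomial.induction_on' with
  | add P Q hP hQ =>
    obtain ⟨C, hC⟩ := hP
    obtain ⟨D, hD⟩ := hQ
    refine ⟨C + D, fun x => ?_⟩
    have h : polyGauss (P + Q) x = polyGauss P x + polyGauss Q x := by
      simp only [polyGauss, Polynomial.eval_add, add_mul]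
    rw [h]
    calc |x| ^ k * ‖polyGauss P x + polyGauss Q x‖
        ≤ |x| ^ k * (‖polyGauss P x‖ + ‖polyGauss Q x‖) := by
          gcongr
          exact norm_add_le _ _
      _ ≤ C + D := by
          rw [mul_add]
          exact add_le_add (hC x) (hD x)
  | monomial n a =>
    refine ⟨‖a‖ * (1 + 2 ^ (k + n) * (k + n).factorial), fun x => ?_⟩
    have h : |x| ^ k * ‖polyGauss (Polynomial.monomial n a) x‖
        = ‖a‖ * (|x| ^ (k + n) * Real.exp (-x ^ 2 / 2)) := by
      simp only [polyGauss, Polynomial.eval_monomial, norm_mul, norm_pow, Complex.norm_real,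
        Real.norm_eq_abs, abs_of_pos (Real.exp_pos _), pow_add]
      ring
    rw [h]
    exact mul_le_mul_of_nonneg_left (abs_pow_mul_gauss_le _ _) (norm_nonneg a)

theorem iteratedDeriv_gauss (n : ℕ) :
    ∃ Q : Polynomial ℝ, iteratedDeriv n (fun y : ℝ => Real.exp (-y ^ 2)) =
      fun x => Q.eval x * Real.exp (-x ^ 2) := by
  induction n with
  | zero => exact ⟨1, by simp [iteratedDeriv_zero]⟩
  | succ n ih =>
    obtain ⟨Q, hQ⟩ := ih
    refine ⟨Q.derivative - 2 * Polynomial.X * Q, ?_⟩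
    rw [iteratedDeriv_succ, hQ]
    funext x
    have h3 : HasDerivAt (fun y : ℝ => -y ^ 2) (-(2 * x)) x := by
      have := (hasDerivAt_pow 2 x).neg
      refine this.congr_deriv ?_
      norm_num
    refine ((Q.hasDerivAt x).fun_mul h3.exp).deriv.trans ?_
    simp
    ring

theorem hermiteFun_eq_polyGauss (n : ℕ) :
    ∃ P : Polynomial ℂ, (fun x : ℝ => (hermiteFun n x : ℂ)) = polyGauss P := by
  obtain ⟨Q, hQ⟩ := iteratedDeriv_gauss n
  set c : ℝ := (-1) ^ n *
    (Real.sqrt n.factorial * (2 : ℝ) ^ ((n : ℝ) / 2) * Real.pi ^ ((1 : ℝ) / 4))⁻¹ with hc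
  refine ⟨Polynomial.C (c : ℂ) * Q.map Complex.ofRealHom, ?_⟩
  funext x
  have he : Real.exp (x ^ 2 / 2) * Real.exp (-x ^ 2) = Real.exp (-x ^ 2 / 2) := by
    rw [← Real.exp_add]
    congr 1
    ring
  have h1 : hermiteFun n x = c * Q.eval x * Real.exp (-x ^ 2 / 2) := by
    rw [← he, hermiteFun, hQ, ← hc]
    ring
  have h2 : (Q.map Complex.ofRealHom).eval (x : ℂ) = ((Q.eval x : ℝ) : ℂ) := by
    have := Polynomial.eval_map_apply (p := Q) Complex.ofRealHom x
    simpa using this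
  rw [h1, polyGauss, Polynomial.eval_mul, Polynomial.eval_C, h2]
  push_cast
  ring

/-- The Hermite function `h_n` as an element of the Schwartz space. -/
def hermiteS (n : ℕ) : 𝓢(ℝ, ℂ) where
  toFun x := (hermiteFun n x : ℂ)
  smooth' := by
    obtain ⟨P, hP⟩ := hermiteFun_eq_polyGauss n
    rw [hP]
    exact contDiff_polyGauss P
  decay' := by
    obtain ⟨P, hP⟩ := hermiteFun_eq_polyGauss n
    intro k m
    rw [hP]
    obtain ⟨Q, hQ⟩ := iteratedDeriv_polyGauss m P
    obtain ⟨C, hC⟩ := polyGauss_bound k Q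
    refine ⟨C, fun x => ?_⟩
    rw [norm_iteratedFDeriv_eq_norm_iteratedDeriv, hQ]
    exact hC x

/-! ### The Sobolev spaces of the harmonic oscillator -/

/-- `λ_n = √(2n+1)`. -/
def freq (n : ℕ) : ℝ := Real.sqrt (2 * n + 1)

/-- The coefficient `c_n` of `u = ∑ c_n h_n`. As `h_n` is real valued, it is `⟨u, h_n⟩`. -/
def coeff (n : ℕ) (u : 𝓢'(ℝ, ℂ)) : ℂ := u (hermiteS n)

/-- The weighted coefficients `λ_n^s c_n`, that is, the coefficients of `H^{s/2} u`. -/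
def weightedCoeff (s : ℝ) (u : 𝓢'(ℝ, ℂ)) (n : ℕ) : ℂ := ((freq n ^ s : ℝ) : ℂ) * coeff n u

theorem weightedCoeff_add (s : ℝ) (u v : 𝓢'(ℝ, ℂ)) :
    weightedCoeff s (u + v) = weightedCoeff s u + weightedCoeff s v := by
  funext n
  change ((freq n ^ s : ℝ) : ℂ) * (u (hermiteS n) + v (hermiteS n)) =
    ((freq n ^ s : ℝ) : ℂ) * u (hermiteS n) + ((freq n ^ s : ℝ) : ℂ) * v (hermiteS n)
  ring

theorem weightedCoeff_smul (s : ℝ) (a : ℂ) (u : 𝓢'(ℝ, ℂ)) :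
    weightedCoeff s (a • u) = a • weightedCoeff s u := by
  funext n
  change ((freq n ^ s : ℝ) : ℂ) * (a * u (hermiteS n)) =
    a * (((freq n ^ s : ℝ) : ℂ) * u (hermiteS n))
  ring

theorem weightedCoeff_zero (s : ℝ) : weightedCoeff s 0 = 0 := by
  funext n
  change ((freq n ^ s : ℝ) : ℂ) * 0 = 0
  ring

/-- The tempered distributions `u` with `∑ λ_n^{2s} |c_n|² < ∞`. -/
def sobolevSubmodule (s : ℝ) : Submodule ℂ 𝓢'(ℝ, ℂ) where
  carrier := {u | Memℓp (weightedCoeff s u) 2}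
  add_mem' := by
    intro u v hu hv
    change Memℓp (weightedCoeff s (u + v)) 2
    rw [weightedCoeff_add]
    exact Memℓp.add hu hv
  zero_mem' := by
    change Memℓp (weightedCoeff s 0) 2
    rw [weightedCoeff_zero]
    exact zero_memℓp
  smul_mem' := by
    intro a u hu
    change Memℓp (weightedCoeff s (a • u)) 2
    rw [weightedCoeff_smul]
    exact Memℓp.const_smul hu a

/-- The space `𝓗^s(ℝ)`. It is a type of its own, so that it carries the topology of its norm
and not that of the tempered distributions. -/
def HSob (s : ℝ) : Type := sobolevSubmodule s

instance (s : ℝ) : AddCommGroup (HSob s) := inferInstanceAs (AddCommGroup (sobolevSubmodule s))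

instance (s : ℝ) : Module ℂ (HSob s) := inferInstanceAs (Module ℂ (sobolevSubmodule s))

/-- The tempered distribution underlying an element of `𝓗^s`. -/
def HSob.toDist {s : ℝ} (u : HSob s) : 𝓢'(ℝ, ℂ) := Subtype.val (p := (· ∈ sobolevSubmodule s)) u

/-- The isometry `u ↦ (λ_n^s c_n)_n` into `ℓ²`. -/
def HSob.toEll2 (s : ℝ) : HSob s →ₗ[ℂ] lp (fun _ : ℕ => ℂ) 2 where
  toFun u := ⟨weightedCoeff s u.toDist, u.2⟩
  map_add' u v := Subtype.ext (weightedCoeff_add s u.toDist v.toDist)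
  map_smul' a u := Subtype.ext (weightedCoeff_smul s a u.toDist)

/-- The norm `‖u‖_{𝓗^s} = (∑ λ_n^{2s} |c_n|²)^{1/2}`. -/
instance (s : ℝ) : SeminormedAddCommGroup (HSob s) :=
  SeminormedAddCommGroup.induced (HSob s) (lp (fun _ : ℕ => ℂ) 2) (HSob.toEll2 s)

/-- The Borel `σ`-algebra of `𝓗^s`. -/
instance (s : ℝ) : MeasurableSpace (HSob s) := borel (HSob s)

instance (s : ℝ) : BorelSpace (HSob s) := ⟨rfl⟩

theorem HSob.norm_sq {s : ℝ} (u : HSob s) :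
    ‖u‖ ^ 2 = ∑' n, freq n ^ (2 * s) * ‖coeff n u.toDist‖ ^ 2 := by
  have h : ‖u‖ = ‖HSob.toEll2 s u‖ := rfl
  have h2 := lp.norm_rpow_eq_tsum (p := 2) (by norm_num) (HSob.toEll2 s u)
  have h3 : ((2 : ℝ≥0∞).toReal) = ((2 : ℕ) : ℝ) := by norm_num
  rw [h3] at h2
  simp only [Real.rpow_natCast] at h2
  rw [h, h2]
  refine tsum_congr fun n => ?_
  change ‖((freq n ^ s : ℝ) : ℂ) * coeff n u.toDist‖ ^ 2 = _
  have hf : 0 ≤ freq n := Real.sqrt_nonneg _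
  rw [norm_mul, mul_pow, Complex.norm_real, Real.norm_of_nonneg (Real.rpow_nonneg hf s),
    mul_comm 2 s, Real.rpow_mul hf]
  norm_num

/-- The element `∑ c_n h_n` of `𝓗^s`; the series is summed in the tempered distributions
(and `0` is returned if its sum is not in `𝓗^s`). -/
def ofCoeffs (s : ℝ) (c : ℕ → ℂ) : HSob s :=
  open scoped Classical in
  if h : (∑' n, c n • (hermiteS n : 𝓢'(ℝ, ℂ))) ∈ sobolevSubmodule s then ⟨_, h⟩ else 0

/-! ### Spectral projectors, cut-offs, and `L^p` norms -/

/-- `Π_N u = ∑_{n ≤ N} c_n h_n`. -/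
def PiN {s : ℝ} (N : ℕ) (u : HSob s) (x : ℝ) : ℂ :=
  ∑ n ∈ Finset.range (N + 1), coeff n u.toDist * (hermiteFun n x : ℂ)

/-- `S_N u = ∑_n χ((2n+1)/(2N+1)) c_n h_n`. -/
def SN {s : ℝ} (χ : ℝ → ℝ) (N : ℕ) (u : HSob s) (x : ℝ) : ℂ :=
  ∑' n : ℕ, (χ ((2 * n + 1) / (2 * N + 1)) : ℂ) * coeff n u.toDist * (hermiteFun n x : ℂ)

/-- The norm `‖u‖_{L^p} ∈ [0, ∞]` of a tempered distribution: the `L^p` norm of the function that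
represents `u`, and `∞` if no `L^p` function does. -/
def distLpNorm (p : ℝ≥0∞) (u : 𝓢'(ℝ, ℂ)) : ℝ≥0∞ :=
  ⨅ (f : ℝ → ℂ) (_ : MemLp f p volume ∧ ∀ ψ : 𝓢(ℝ, ℂ), u ψ = ∫ x, f x * ψ x),
    eLpNorm f p volume

/-! ### The Gaussian measure -/

/-- The law `π⁻¹ e^{-|z|²} dL(z)` of a standard complex Gaussian variable. -/
def stdComplexGaussian : Measure ℂ :=
  volume.withDensity fun z => ENNReal.ofReal (Real.pi⁻¹ * Real.exp (-‖z‖ ^ 2))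

section Measures

variable {Ω : Type*} [MeasurableSpace Ω] (P : Measure Ω) (g : ℕ → Ω → ℂ) (σ : ℝ)

/-- The coefficients `(√2 / λ_n) g_n(ω)`. -/
def randCoeff (ω : Ω) (n : ℕ) : ℂ := ((Real.sqrt 2 / freq n : ℝ) : ℂ) * g n ω

/-- `μ`: the law on `𝓗^{-σ}` of `φ(ω) = ∑_n (√2/λ_n) g_n(ω) h_n`. -/
def mu : Measure (HSob (-σ)) := P.map fun ω => ofCoeffs (-σ) (randCoeff g ω)

/-- `μ̃_N`: the law of `φ_N(ω) = ∑_{n ≤ N} (√2/λ_n) g_n(ω) h_n`. -/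
def muLow (N : ℕ) : Measure (HSob (-σ)) :=
  P.map fun ω => ofCoeffs (-σ) fun n => if n ≤ N then randCoeff g ω n else 0

/-- `μ^N`: the law of `∑_{n > N} (√2/λ_n) g_n(ω) h_n`. -/
def muHigh (N : ℕ) : Measure (HSob (-σ)) :=
  P.map fun ω => ofCoeffs (-σ) fun n => if n ≤ N then 0 else randCoeff g ω n

/-! ### Defocusing case -/

/-- `exp(-‖u‖_{L^{k+1}}^{k+1} / (k+1))`, with `exp(-∞) = 0`. -/
def defocWeight (k : ℕ) (u : HSob (-σ)) : ℝ :=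
  open scoped Classical in
  if distLpNorm (k + 1) u.toDist = ∞ then 0
  else Real.exp (-((distLpNorm (k + 1) u.toDist).toReal ^ (k + 1) / (k + 1)))

/-- `dρ = exp(-‖u‖_{L^{k+1}}^{k+1} / (k+1)) dμ`. -/
def rhoDefoc (k : ℕ) : Measure (HSob (-σ)) :=
  (mu P g σ).withDensity fun u => ENNReal.ofReal (defocWeight σ k u)

/-- `dρ_N = exp(-‖S_N u‖_{L^{k+1}}^{k+1} / (k+1)) dμ`. -/
def rhoDefocN (χ : ℝ → ℝ) (k N : ℕ) : Measure (HSob (-σ)) :=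
  (mu P g σ).withDensity fun u =>
    ENNReal.ofReal (Real.exp (-((∫ x, ‖SN χ N u x‖ ^ (k + 1)) / (k + 1))))

/-! ### Cubic focusing case -/

/-- `α_N = 𝔼 ‖φ_N‖_{L²}² = ∑_{n ≤ N} 2 / λ_n²`. -/
def alphaN (N : ℕ) : ℝ := ∑ n ∈ Finset.range (N + 1), 2 / freq n ^ 2

/-- `G_N(u) = ζ(‖Π_N u‖_{L²}² - α_N) exp(¼ ‖S_N u‖_{L⁴}⁴)`. -/
def GN (χ ζ : ℝ → ℝ) (N : ℕ) (u : HSob (-σ)) : ℝ :=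
  ζ ((∫ x, ‖PiN N u x‖ ^ 2) - alphaN N) * Real.exp (1 / 4 * ∫ x, ‖SN χ N u x‖ ^ 4)

/-- `dρ̃_N = G_N dμ̃_N`. -/
def rhoFocLow (χ ζ : ℝ → ℝ) (N : ℕ) : Measure (HSob (-σ)) :=
  (muLow P g σ N).withDensity fun u => ENNReal.ofReal (GN σ χ ζ N u)

/-- `ρ_N = μ^N ⊗ ρ̃_N`, where `(v, w) ∈ E_N^⊥ × E_N` is identified with `v + w`. -/
def rhoFocN (χ ζ : ℝ → ℝ) (N : ℕ) : Measure (HSob (-σ)) :=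
  ((muHigh P g σ N).prod (rhoFocLow P g σ χ ζ N)).map fun p => p.1 + p.2

end Measures

end HarmonicGibbs

end

open HarmonicGibbs

/-!
The Gibbs measures of the one-dimensional nonlinear Schrödinger equation with harmonic potential.

Under `μ` the normalized coefficients `(λ_n/√2) c_n` are independent standard complex Gaussian
variables (`hasLaw_normCoeff`, `iIndepFun_normCoeff`), so at each point `x` a finite sum
`∑ w_n c_n h_n(x)` is a complex Gaussian variable of variance `∑ w_n² (2/λ_n²) h_n(x)²`. Everything
rests on a bound for this variance: if only frequencies `n ≥ M` occur, it is at most a constant times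
`(M + 1)^{-1/8} (1 + x²)^{-5/16}` (`exists_sum_coeffVar_mul_hermiteFun_sq_le`). This follows from
Mehler's formula on the diagonal (`hasSum_mehler`) by a dyadic decomposition of the weights, and no
pointwise asymptotics of Hermite functions are needed. As `(1 + x²)^{-5/16}` is bounded and square
integrable, the Hermite series of `u` converges in `L^q(μ; L^q(ℝ))` for every `q ≥ 4`, along
sharp and smooth truncations alike, and its limit represents `u` (`exists_limit_Lq`).
Representing a distribution by its Hermite series requires the completeness of the Hermite functions
in the Schwartz space (`hasSum_hermiteCoeff_smul_hermiteS`).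

Both limits of measures then follow from one principle (`tendsto_withDensity_of_tendstoInMeasure`):
densities that converge in measure and are bounded in `L²` give measures that converge in total
variation. In the defocusing case the densities lie in `[0, 1]`, and the limit is positive almost
surely because the `L^{k+1}` norm is almost surely finite. In the focusing case, `ρ_N` is `G_N dμ`
by independence of low and high frequencies (`rhoFocN_eq_withDensity`); the renormalized masses
converge in `L²`, being sums of independent centred variables with summable variances; and it remains
to bound `G_N` in every `L^p(μ)` uniformly in `N` (`exists_eLpNorm_GN_le`).

For the last point it suffices that, on the event that the renormalized mass is at most `R`, the
probability that `‖S_N u‖_{L⁴}⁴ ≥ i²` is at most a constant times `e^{-K i²}`, with `K` arbitrarily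
large (`exists_measure_energy_tail_le`). Split the frequencies at `M₁ ∼ i²` and `M₂ ∼ i¹⁶`.
* Off an event of probability `e^{-cM}` the mass of the frequencies below `M` is at most
  `R + O(log M)`: otherwise the frequencies above `M`, whose mass has variance `O(1/M)`, would have
  too little of it (`measure_mass_filter_gt_le`).
* Below `M₁`, the inequality `‖v‖_∞² ≤ 4 √(M₁ + 1) ‖v‖_{L²}²` then bounds the quartic energy by
  `O(√M₁ log² M₁)`, which is smaller than `i²`.
* Between `M₁` and `M₂`, Jensen's inequality for the measure `|v|² dx`, whose mass is
  `A = O(log i)`, bounds `e^{p ‖v‖₄⁴}` by an integral of `|v|⁴ e^{p A |v|²}`. Its expectation is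
  bounded as soon as `p A` times the pointwise variance, which is `O(M₁^{-1/8})`, is small
  (`measure_mass_le_inter_energy_ge_le`).
* Beyond `M₂`, the pointwise variance `O(i^{-2})` is so small that the moment of order `i²` is enough
  (`measure_energy_ge_le`).
-/

noncomputable section

namespace HarmonicGibbs

/-! ### Ladder operators and orthonormality of the Hermite functions -/

/-- The `n`-th derivative of the Gaussian `e^{-x²}`, which is `(-1)^n` times the `n`-th Hermite
polynomial times `e^{-x²}`. -/
def gaussDeriv (n : ℕ) (x : ℝ) : ℝ := iteratedDeriv n (fun y : ℝ => Real.exp (-y ^ 2)) x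

/-- The normalizing constant `c_n` of the Hermite function `h_n`. -/
def hermiteConst (n : ℕ) : ℝ :=
  (Real.sqrt n.factorial * (2 : ℝ) ^ ((n : ℝ) / 2) * Real.pi ^ ((1 : ℝ) / 4))⁻¹

theorem hermiteFun_eq (n : ℕ) (x : ℝ) :
    hermiteFun n x = (-1) ^ n * hermiteConst n * Real.exp (x ^ 2 / 2) * gaussDeriv n x := rfl

theorem hermiteConst_pos (n : ℕ) : 0 < hermiteConst n := by
  unfold hermiteConst
  positivity

theorem hermiteConst_sq (n : ℕ) :
    hermiteConst n ^ 2 = (n.factorial * 2 ^ n * Real.sqrt Real.pi)⁻¹ := by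
  have h2 : ((2 : ℝ) ^ ((n : ℝ) / 2)) ^ 2 = 2 ^ n := by
    rw [← Real.rpow_natCast, ← Real.rpow_mul (by norm_num), ← Real.rpow_natCast 2 n]
    congr 1
    push_cast
    ring
  have h3 : (Real.pi ^ ((1 : ℝ) / 4)) ^ 2 = Real.sqrt Real.pi := by
    rw [← Real.rpow_natCast, ← Real.rpow_mul Real.pi_pos.le, Real.sqrt_eq_rpow]
    congr 1
    norm_num
  rw [hermiteConst, inv_pow, mul_pow, mul_pow, h2, h3, Real.sq_sqrt (by positivity)]

theorem hermiteConst_eq_sqrt_mul_succ (n : ℕ) :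
    hermiteConst n = Real.sqrt (2 * (n + 1)) * hermiteConst (n + 1) := by
  have h : hermiteConst n ^ 2 = (Real.sqrt (2 * (n + 1)) * hermiteConst (n + 1)) ^ 2 := by
    rw [mul_pow, hermiteConst_sq, hermiteConst_sq, Real.sq_sqrt (by positivity),
      Nat.factorial_succ]
    push_cast
    field_simp
    ring
  have h1 := (hermiteConst_pos n).le
  have h2 : 0 ≤ Real.sqrt (2 * (n + 1)) * hermiteConst (n + 1) :=
    mul_nonneg (Real.sqrt_nonneg _) (hermiteConst_pos _).le
  exact (sq_eq_sq₀ h1 h2).1 h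

theorem hasDerivAt_gaussDeriv (n : ℕ) (x : ℝ) :
    HasDerivAt (gaussDeriv n) (gaussDeriv (n + 1) x) x := by
  obtain ⟨Q, hQ⟩ := iteratedDeriv_gauss n
  have hd : DifferentiableAt ℝ (gaussDeriv n) x := by
    have : gaussDeriv n = fun x => Q.eval x * Real.exp (-x ^ 2) := hQ
    rw [this]
    fun_prop
  have := hd.hasDerivAt
  rwa [show deriv (gaussDeriv n) x = gaussDeriv (n + 1) x by
    unfold gaussDeriv; rw [iteratedDeriv_succ]] at this

theorem gaussDeriv_zero (x : ℝ) : gaussDeriv 0 x = Real.exp (-x ^ 2) := by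
  simp [gaussDeriv, iteratedDeriv_zero]

theorem gaussDeriv_one (x : ℝ) : gaussDeriv 1 x = -2 * x * gaussDeriv 0 x := by
  have h3 : HasDerivAt (fun y : ℝ => -y ^ 2) (-(2 * x)) x := by
    have := (hasDerivAt_pow 2 x).neg
    refine this.congr_deriv ?_
    norm_num
  have h1 : HasDerivAt (gaussDeriv 0) (Real.exp (-x ^ 2) * (-(2 * x))) x := by
    have : gaussDeriv 0 = fun x => Real.exp (-x ^ 2) := funext gaussDeriv_zero
    rw [this]
    exact h3.exp
  rw [(hasDerivAt_gaussDeriv 0 x).unique h1, gaussDeriv_zero]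
  ring

theorem gaussDeriv_succ_succ (n : ℕ) : ∀ x : ℝ,
    gaussDeriv (n + 2) x = -2 * x * gaussDeriv (n + 1) x - 2 * (n + 1) * gaussDeriv n x := by
  induction n with
  | zero =>
    intro x
    have h1 : HasDerivAt (gaussDeriv 1) (-2 * gaussDeriv 0 x + -2 * x * gaussDeriv 1 x) x := by
      have : gaussDeriv 1 = fun x => -2 * x * gaussDeriv 0 x := funext gaussDeriv_one
      have h := (((hasDerivAt_id x).const_mul (-2)).mul (hasDerivAt_gaussDeriv 0 x))
      refine (h.congr_of_eventuallyEq (EventuallyEq.of_eq this)).congr_deriv ?_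
      simp
    have h2 := (hasDerivAt_gaussDeriv 1 x).unique h1
    norm_num at h2 ⊢
    rw [h2]
    ring
  | succ n ih =>
    intro x
    have h1 : HasDerivAt (gaussDeriv (n + 2))
        ((-2 * gaussDeriv (n + 1) x + -2 * x * gaussDeriv (n + 2) x) -
          2 * (n + 1) * gaussDeriv (n + 1) x) x := by
      have : gaussDeriv (n + 2) =
          fun x => -2 * x * gaussDeriv (n + 1) x - 2 * (n + 1) * gaussDeriv n x := funext ih
      have h := (((hasDerivAt_id x).const_mul (-2)).mul (hasDerivAt_gaussDeriv (n + 1) x)).sub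
        ((hasDerivAt_gaussDeriv n x).const_mul (2 * ((n : ℝ) + 1)))
      refine (h.congr_of_eventuallyEq (EventuallyEq.of_eq this)).congr_deriv ?_
      simp
    rw [(hasDerivAt_gaussDeriv (n + 2) x).unique h1]
    push_cast
    ring

theorem hasDerivAt_hermiteFun (n : ℕ) (x : ℝ) :
    HasDerivAt (hermiteFun n)
      (x * hermiteFun n x - Real.sqrt (2 * (n + 1)) * hermiteFun (n + 1) x) x := by
  have h1 : HasDerivAt (fun y : ℝ => Real.exp (y ^ 2 / 2)) (Real.exp (x ^ 2 / 2) * x) x := by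
    have h3 : HasDerivAt (fun y : ℝ => y ^ 2 / 2) x x := by
      have := (hasDerivAt_pow 2 x).div_const 2
      refine this.congr_deriv ?_
      norm_num
    exact h3.exp
  have h2 := (h1.const_mul ((-1) ^ n * hermiteConst n)).mul (hasDerivAt_gaussDeriv n x)
  have h3 : hermiteFun n = fun x =>
    (-1) ^ n * hermiteConst n * Real.exp (x ^ 2 / 2) * gaussDeriv n x :=
    funext (hermiteFun_eq n)
  rw [h3]
  refine h2.congr_deriv ?_
  simp only [hermiteFun_eq]
  rw [hermiteConst_eq_sqrt_mul_succ n]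
  ring

/-- The three-term recurrence `x h_n = √(n/2) h_{n-1} + √((n+1)/2) h_{n+1}`. The coefficient
`√(n/2)` vanishes for `n = 0`, so that the truncated subtraction is harmless. -/
theorem two_mul_mul_hermiteFun (n : ℕ) (x : ℝ) :
    2 * x * hermiteFun n x = Real.sqrt (2 * n) * hermiteFun (n - 1) x +
      Real.sqrt (2 * (n + 1)) * hermiteFun (n + 1) x := by
  cases n with
  | zero =>
    simp only [hermiteFun_eq, gaussDeriv_one, zero_add]
    have := hermiteConst_eq_sqrt_mul_succ 0
    push_cast at this ⊢
    rw [this]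
    simp
    ring
  | succ n =>
    simp only [hermiteFun_eq, gaussDeriv_succ_succ n, Nat.add_sub_cancel]
    have h0 := hermiteConst_eq_sqrt_mul_succ n
    have h1 := hermiteConst_eq_sqrt_mul_succ (n + 1)
    have h2 : Real.sqrt (2 * (n + 1)) * Real.sqrt (2 * (n + 1)) = 2 * (n + 1) :=
      Real.mul_self_sqrt (by positivity)
    push_cast at h1 ⊢
    rw [show n + 1 + 1 = n + 2 from rfl] at h1 ⊢
    rw [h0]
    have h3 : (-1 : ℝ) ^ (n + 2) * hermiteConst (n + 2) * Real.exp (x ^ 2 / 2) *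
        (-2 * x * gaussDeriv (n + 1) x - 2 * (n + 1) * gaussDeriv n x) *
        Real.sqrt (2 * (n + 1 + 1)) =
        (-1) ^ n * hermiteConst (n + 1) * Real.exp (x ^ 2 / 2) *
        (-2 * x * gaussDeriv (n + 1) x - 2 * (n + 1) * gaussDeriv n x) := by
      rw [h1]
      ring
    linear_combination -h3 +
      (-(-1 : ℝ) ^ n * hermiteConst (n + 1) * Real.exp (x ^ 2 / 2) * gaussDeriv n x) * h2

/-- Multiplication by `x` on the Schwartz space. -/
def mulXCLM : 𝓢(ℝ, ℂ) →L[ℂ] 𝓢(ℝ, ℂ) := SchwartzMap.smulLeftCLM ℂ (fun x : ℝ => (x : ℂ))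

theorem mulXCLM_apply (f : 𝓢(ℝ, ℂ)) (x : ℝ) : mulXCLM f x = x * f x := by
  have h : (fun x : ℝ => (x : ℂ)).HasTemperateGrowth := Complex.ofRealCLM.hasTemperateGrowth
  rw [mulXCLM, SchwartzMap.smulLeftCLM_apply_apply h, smul_eq_mul]

/-- The annihilation operator `x + ∂_x`. -/
def lowerCLM : 𝓢(ℝ, ℂ) →L[ℂ] 𝓢(ℝ, ℂ) := mulXCLM + SchwartzMap.derivCLM ℂ ℂ

/-- The creation operator `x - ∂_x`. -/
def raiseCLM : 𝓢(ℝ, ℂ) →L[ℂ] 𝓢(ℝ, ℂ) := mulXCLM - SchwartzMap.derivCLM ℂ ℂ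

theorem lowerCLM_apply (f : 𝓢(ℝ, ℂ)) (x : ℝ) : lowerCLM f x = x * f x + deriv f x := by
  rw [← mulXCLM_apply]; rfl

theorem raiseCLM_apply (f : 𝓢(ℝ, ℂ)) (x : ℝ) : raiseCLM f x = x * f x - deriv f x := by
  rw [← mulXCLM_apply]; rfl

theorem hermiteS_apply (n : ℕ) (x : ℝ) : hermiteS n x = (hermiteFun n x : ℂ) := rfl

theorem deriv_hermiteS (n : ℕ) (x : ℝ) : deriv (hermiteS n) x =
    x * hermiteS n x - Real.sqrt (2 * (n + 1)) * hermiteS (n + 1) x := by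
  have h := (hasDerivAt_hermiteFun n x).ofReal_comp.deriv
  simp only [hermiteS_apply]
  rw [show (⇑(hermiteS n) : ℝ → ℂ) = fun y => (hermiteFun n y : ℂ) from rfl, h]
  push_cast
  rfl

theorem raiseCLM_hermiteS (n : ℕ) :
    raiseCLM (hermiteS n) = (Real.sqrt (2 * (n + 1)) : ℂ) • hermiteS (n + 1) := by
  ext x
  rw [raiseCLM_apply, deriv_hermiteS, smul_apply, smul_eq_mul]
  ring

/-- The annihilation operator lowers the index. For `n = 0` the coefficient `√(2n)` is `0`, so that
the junk index `n - 1 = 0` does not matter. -/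
theorem lowerCLM_hermiteS (n : ℕ) :
    lowerCLM (hermiteS n) = (Real.sqrt (2 * n) : ℂ) • hermiteS (n - 1) := by
  ext x
  rw [lowerCLM_apply, deriv_hermiteS, smul_apply, smul_eq_mul]
  have h := congrArg (fun r : ℝ => (r : ℂ)) (two_mul_mul_hermiteFun n x)
  simp only [hermiteS_apply]
  push_cast at h
  linear_combination h

theorem integrable_schwartz_mul (f g : 𝓢(ℝ, ℂ)) : Integrable fun x => f x * g x :=
  (f.memLp 2).integrable_mul (g.memLp 2)

/-- The operators `x - ∂_x` and `x + ∂_x` are transposes of each other. -/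
theorem integral_raiseCLM_mul (f g : 𝓢(ℝ, ℂ)) :
    ∫ x, raiseCLM f x * g x = ∫ x, f x * lowerCLM g x := by
  have h := SchwartzMap.integral_mul_deriv_eq_neg_deriv_mul f g
  have e1 : ∀ x, raiseCLM f x * g x = mulXCLM f x * g x - deriv f x * g x := fun x => by
    rw [raiseCLM_apply, mulXCLM_apply]; ring
  have e2 : ∀ x, f x * lowerCLM g x = mulXCLM f x * g x + f x * deriv g x := fun x => by
    rw [lowerCLM_apply, mulXCLM_apply]; ring
  simp_rw [e1, e2]
  have i1 : Integrable fun x => deriv f x * g x :=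
    integrable_schwartz_mul (SchwartzMap.derivCLM ℂ ℂ f) g
  have i2 : Integrable fun x => f x * deriv g x :=
    integrable_schwartz_mul f (SchwartzMap.derivCLM ℂ ℂ g)
  rw [integral_sub (integrable_schwartz_mul _ _) i1,
    integral_add (integrable_schwartz_mul _ _) i2, h]
  ring

theorem integral_hermiteS_zero_sq : ∫ x, hermiteS 0 x * hermiteS 0 x = 1 := by
  have h : ∀ x : ℝ, hermiteS 0 x * hermiteS 0 x =
      (((Real.sqrt Real.pi)⁻¹ * Real.exp (-1 * x ^ 2) : ℝ) : ℂ) := by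
    intro x
    rw [hermiteS_apply, hermiteFun_eq, gaussDeriv_zero, ← Complex.ofReal_mul]
    congr 1
    have h1 := hermiteConst_sq 0
    simp only [Nat.factorial_zero, Nat.cast_one, pow_zero, one_mul] at h1
    rw [← h1]
    have e : Real.exp (-1 * x ^ 2) = (Real.exp (x ^ 2 / 2) * Real.exp (-x ^ 2)) ^ 2 := by
      rw [← Real.exp_add, ← Real.exp_nat_mul]
      congr 1
      push_cast
      ring
    rw [e]
    ring
  simp_rw [h]
  rw [integral_complex_ofReal, integral_const_mul, integral_gaussian, div_one,
    inv_mul_cancel₀ (by positivity)]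
  simp

/-- Orthonormality of the Hermite functions, from the ladder relations by induction. -/
theorem integral_hermiteS_mul (n : ℕ) : ∀ m : ℕ,
    ∫ x, hermiteS n x * hermiteS m x = if n = m then 1 else 0 := by
  have key : ∀ n m : ℕ, (Real.sqrt (2 * (n + 1)) : ℂ) * ∫ x, hermiteS (n + 1) x * hermiteS m x =
      (Real.sqrt (2 * m) : ℂ) * ∫ x, hermiteS n x * hermiteS (m - 1) x := by
    intro n m
    have h := integral_raiseCLM_mul (hermiteS n) (hermiteS m)
    rw [raiseCLM_hermiteS, lowerCLM_hermiteS] at h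
    simp only [smul_apply, smul_eq_mul] at h
    rw [← integral_const_mul, ← integral_const_mul]
    convert h using 1
    · exact integral_congr_ae (Eventually.of_forall fun x => by ring)
    · exact integral_congr_ae (Eventually.of_forall fun x => by ring)
  have hne : ∀ n : ℕ, (Real.sqrt (2 * (n + 1)) : ℂ) ≠ 0 := fun n => by
    exact_mod_cast (Real.sqrt_pos.2 (by positivity)).ne'
  have hz : ∀ n : ℕ, ∫ x, hermiteS (n + 1) x * hermiteS 0 x = 0 := fun n => by
    have h := key n 0
    simp only [Nat.cast_zero, mul_zero, Real.sqrt_zero, Complex.ofReal_zero, zero_mul] at h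
    exact (mul_eq_zero.1 h).resolve_left (hne n)
  induction n with
  | zero =>
    intro m
    cases m with
    | zero => simpa using integral_hermiteS_zero_sq
    | succ m =>
      simp_rw [mul_comm (hermiteS 0 _)]
      rw [hz, if_neg (by omega)]
  | succ n ih =>
    intro m
    cases m with
    | zero => rw [hz, if_neg (by omega)]
    | succ m =>
      have h := key n (m + 1)
      rw [Nat.add_sub_cancel, ih] at h
      by_cases hnm : n = m
      · subst hnm
        rw [if_pos rfl] at h ⊢
        push_cast at h
        exact mul_left_cancel₀ (hne n) h
      · rw [if_neg hnm, mul_zero] at h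
        rw [if_neg (by omega)]
        exact (mul_eq_zero.1 h).resolve_left (hne n)

theorem continuous_hermiteFun (n : ℕ) : Continuous (hermiteFun n) :=
  continuous_iff_continuousAt.2 fun x => (hasDerivAt_hermiteFun n x).continuousAt

theorem integrable_hermiteFun_mul (n m : ℕ) :
    Integrable fun x => hermiteFun n x * hermiteFun m x := by
  have h := (integrable_schwartz_mul (hermiteS n) (hermiteS m)).re
  refine h.congr (Eventually.of_forall fun x => ?_)
  simp [hermiteS_apply]

theorem integral_hermiteFun_mul (n m : ℕ) :
    ∫ x, hermiteFun n x * hermiteFun m x = if n = m then 1 else 0 := by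
  have h := integral_hermiteS_mul n m
  simp only [hermiteS_apply, ← Complex.ofReal_mul] at h
  rw [integral_complex_ofReal] at h
  split_ifs at h ⊢ with hnm
  · exact_mod_cast h
  · exact_mod_cast h

/-- Parseval's identity for finite Hermite sums. -/
theorem integral_normSq_hermite_sum (s : Finset ℕ) (b : ℕ → ℂ) :
    ∫ x, ‖∑ n ∈ s, b n * (hermiteFun n x : ℂ)‖ ^ 2 = ∑ n ∈ s, ‖b n‖ ^ 2 := by
  have h : ∀ x, ‖∑ n ∈ s, b n * (hermiteFun n x : ℂ)‖ ^ 2 =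
      ∑ n ∈ s, ∑ m ∈ s, (b n * (starRingEnd ℂ) (b m)).re *
        (hermiteFun n x * hermiteFun m x) := by
    intro x
    have e : ((‖∑ n ∈ s, b n * (hermiteFun n x : ℂ)‖ ^ 2 : ℝ) : ℂ) =
        ∑ n ∈ s, ∑ m ∈ s, (b n * (starRingEnd ℂ) (b m)) *
          ((hermiteFun n x * hermiteFun m x : ℝ) : ℂ) := by
      push_cast
      rw [← Complex.mul_conj', map_sum, Finset.sum_mul_sum]
      refine Finset.sum_congr rfl fun n _ => Finset.sum_congr rfl fun m _ => ?_
      rw [map_mul, Complex.conj_ofReal]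
      ring
    have e2 := congrArg Complex.re e
    rw [Complex.ofReal_re, Complex.re_sum] at e2
    rw [e2]
    refine Finset.sum_congr rfl fun n _ => ?_
    rw [Complex.re_sum]
    exact Finset.sum_congr rfl fun m _ => Complex.re_mul_ofReal _ _
  simp_rw [h]
  rw [integral_finsetSum _ fun n _ => integrable_finsetSum _ fun m _ =>
    (integrable_hermiteFun_mul n m).const_mul _]
  refine Finset.sum_congr rfl fun n hn => ?_
  rw [integral_finsetSum _ fun m _ => (integrable_hermiteFun_mul n m).const_mul _]
  simp_rw [integral_const_mul, integral_hermiteFun_mul]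
  simp only [mul_ite, mul_one, mul_zero, Finset.sum_ite_eq, hn, if_true]
  rw [Complex.mul_conj', ← Complex.ofReal_pow, Complex.ofReal_re]

/-! ### Mehler's formula on the diagonal -/

theorem integrable_abs_pow_mul_exp_neg_sq (n : ℕ) :
    Integrable fun t : ℝ => |t| ^ n * Real.exp (-t ^ 2) := by
  have h := (integrable_rpow_mul_exp_neg_mul_sq (b := 1) one_pos (s := (n : ℝ))
    (by have : (0 : ℝ) ≤ n := n.cast_nonneg
        linarith)).norm
  refine h.congr (Eventually.of_forall fun t => ?_)
  simp [Real.rpow_natCast, abs_of_pos (Real.exp_pos _)]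

/-- The integrand `(2it)^n e^{-t² + 2ixt}` of the Fourier representation of `(e^{-x²})^{(n)}`. -/
def mehlerFactor (n : ℕ) (x t : ℝ) : ℂ :=
  (2 * Complex.I * t) ^ n * Complex.exp (-(t : ℂ) ^ 2 + 2 * Complex.I * x * t)

theorem norm_mehlerFactor (n : ℕ) (x t : ℝ) :
    ‖mehlerFactor n x t‖ = 2 ^ n * (|t| ^ n * Real.exp (-t ^ 2)) := by
  have h : (-(t : ℂ) ^ 2 + 2 * Complex.I * x * t).re = -t ^ 2 := by
    rw [show -(t : ℂ) ^ 2 + 2 * Complex.I * x * t =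
      ((-t ^ 2 : ℝ) : ℂ) + ((2 * x * t : ℝ) : ℂ) * Complex.I by push_cast; ring]
    rw [Complex.add_re, Complex.ofReal_re, Complex.re_ofReal_mul, Complex.I_re, mul_zero, add_zero]
  rw [mehlerFactor, norm_mul, Complex.norm_exp, h, norm_pow]
  simp [mul_pow, mul_assoc]

theorem continuous_mehlerFactor (n : ℕ) (x : ℝ) : Continuous (mehlerFactor n x) := by
  unfold mehlerFactor
  fun_prop

theorem integrable_mehlerFactor (n : ℕ) (x : ℝ) : Integrable (mehlerFactor n x) := by
  refine ((integrable_abs_pow_mul_exp_neg_sq n).const_mul (2 ^ n)).mono'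
    (continuous_mehlerFactor n x).aestronglyMeasurable (Eventually.of_forall fun t => ?_)
  rw [norm_mehlerFactor]

theorem hasDerivAt_integral_mehlerFactor (n : ℕ) (x : ℝ) :
    HasDerivAt (fun y => ∫ t, mehlerFactor n y t) (∫ t, mehlerFactor (n + 1) x t) x := by
  refine (hasDerivAt_integral_of_dominated_loc_of_deriv_le (F := fun y t => mehlerFactor n y t)
    (F' := fun y t => mehlerFactor (n + 1) y t)
    (bound := fun t => 2 ^ (n + 1) * (|t| ^ (n + 1) * Real.exp (-t ^ 2))) (s := Set.univ)
    univ_mem ?_ ?_ ?_ ?_ ?_ ?_).2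
  · exact Eventually.of_forall fun y => (continuous_mehlerFactor n y).aestronglyMeasurable
  · exact integrable_mehlerFactor n x
  · exact (continuous_mehlerFactor (n + 1) x).aestronglyMeasurable
  · exact Eventually.of_forall fun t y _ => (norm_mehlerFactor _ _ _).le
  · exact (integrable_abs_pow_mul_exp_neg_sq (n + 1)).const_mul _
  · refine Eventually.of_forall fun t y _ => ?_
    have h1 : HasDerivAt (fun z : ℂ => -(t : ℂ) ^ 2 + 2 * Complex.I * z * t)
        (2 * Complex.I * t) (y : ℂ) := by
      have := (((hasDerivAt_id (y : ℂ)).const_mul (2 * Complex.I)).mul_const (t : ℂ)).const_add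
        (-(t : ℂ) ^ 2)
      refine this.congr_deriv ?_
      ring
    have h2 := (h1.cexp.const_mul ((2 * Complex.I * t) ^ n)).comp_ofReal
    refine h2.congr_deriv ?_
    simp only [mehlerFactor]
    ring

theorem integral_cexp_quadratic_real (b : ℝ) (hb : 0 < b) (c d : ℂ) :
    ∫ x : ℝ, Complex.exp (-b * x ^ 2 + c * x + d) =
      (Real.sqrt (Real.pi / b) : ℂ) * Complex.exp (d + c ^ 2 / (4 * b)) := by
  have h := integral_cexp_quadratic (b := -(b : ℂ)) (by simpa using hb) c d
  rw [h, neg_neg]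
  congr 1
  · rw [Real.sqrt_eq_rpow, Complex.ofReal_cpow (by positivity)]
    push_cast
    rfl
  · congr 1
    rw [mul_neg, div_neg]
    ring

/-- Fourier representation of the derivatives of the Gaussian. -/
theorem gaussDeriv_eq_integral (n : ℕ) : ∀ x : ℝ,
    (gaussDeriv n x : ℂ) = (Real.sqrt Real.pi : ℂ)⁻¹ * ∫ t, mehlerFactor n x t := by
  induction n with
  | zero =>
    intro x
    have h := integral_cexp_quadratic_real 1 one_pos (2 * Complex.I * x) 0
    have hp : (Real.sqrt Real.pi : ℂ) ≠ 0 := by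
      exact_mod_cast (Real.sqrt_pos.2 Real.pi_pos).ne'
    have e : ∀ t : ℝ, mehlerFactor 0 x t =
        Complex.exp (-((1 : ℝ) : ℂ) * t ^ 2 + 2 * Complex.I * x * t + 0) := fun t => by
      simp [mehlerFactor]
    simp_rw [e]
    rw [h, div_one, ← mul_assoc, inv_mul_cancel₀ hp, one_mul, gaussDeriv_zero]
    push_cast
    congr 1
    rw [mul_pow, mul_pow, Complex.I_sq]
    ring
  | succ n ih =>
    intro x
    have h1 := (hasDerivAt_gaussDeriv n x).ofReal_comp
    have h2 := (hasDerivAt_integral_mehlerFactor n x).const_mul (Real.sqrt Real.pi : ℂ)⁻¹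
    have e : (fun y => (gaussDeriv n y : ℂ)) =
        fun y => (Real.sqrt Real.pi : ℂ)⁻¹ * ∫ t, mehlerFactor n y t := funext ih
    rw [e] at h1
    exact h1.unique h2

/-- The majorant that allows the exponential series in Mehler's formula to be integrated term by
term; this is where `r < 1` is used. -/
theorem integrable_exp_prod {r : ℝ} (hr0 : 0 ≤ r) (hr1 : r < 1) :
    Integrable (fun z : ℝ × ℝ => Real.exp (2 * r * (|z.1| * |z.2|)) *
      (Real.exp (-z.1 ^ 2) * Real.exp (-z.2 ^ 2))) (volume.prod volume) := by
  have h := integrable_exp_neg_mul_sq (sub_pos.2 hr1)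
  refine (h.mul_prod h).mono' ?_ (Eventually.of_forall fun z => ?_)
  · exact (by fun_prop : Continuous fun z : ℝ × ℝ => Real.exp (2 * r * (|z.1| * |z.2|)) *
      (Real.exp (-z.1 ^ 2) * Real.exp (-z.2 ^ 2))).aestronglyMeasurable
  · rw [Real.norm_of_nonneg (by positivity), ← Real.exp_add, ← Real.exp_add, ← Real.exp_add]
    refine Real.exp_le_exp.2 ?_
    nlinarith [mul_nonneg hr0 (sq_nonneg (|z.1| - |z.2|)), sq_abs z.1, sq_abs z.2]

/-- The Gaussian double integral behind Mehler's formula. -/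
theorem integral_mehler_prod {r : ℝ} (hr0 : 0 ≤ r) (hr1 : r < 1) (x : ℝ) :
    ∫ z : ℝ × ℝ, Complex.exp (-2 * r * (z.1 * z.2)) *
      (mehlerFactor 0 x z.1 * mehlerFactor 0 x z.2) ∂(volume.prod volume) =
    ((Real.sqrt Real.pi * Real.sqrt (Real.pi / (1 - r ^ 2)) *
      Real.exp (-x ^ 2 - x ^ 2 * ((1 - r) / (1 + r))) : ℝ) : ℂ) := by
  have hr2 : 0 < 1 - r ^ 2 := by nlinarith
  rw [integral_prod]
  · have h1 : ∀ t : ℝ, ∫ s : ℝ, Complex.exp (-2 * r * (t * s)) *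
        (mehlerFactor 0 x t * mehlerFactor 0 x s) = (Real.sqrt Real.pi : ℂ) *
        Complex.exp (-((1 - r ^ 2 : ℝ) : ℂ) * t ^ 2 + (2 * Complex.I * x * (1 - r)) * t +
          (-(x : ℂ) ^ 2)) := by
      intro t
      have e : ∀ s : ℝ, Complex.exp (-2 * r * (t * s)) *
          (mehlerFactor 0 x t * mehlerFactor 0 x s) =
          Complex.exp (-((1 : ℝ) : ℂ) * s ^ 2 + (2 * Complex.I * x - 2 * r * t) * s +
            (-(t : ℂ) ^ 2 + 2 * Complex.I * x * t)) := fun s => by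
        simp only [mehlerFactor, pow_zero, one_mul]
        rw [← Complex.exp_add, ← Complex.exp_add]
        congr 1
        push_cast
        ring
      simp_rw [e]
      rw [integral_cexp_quadratic_real 1 one_pos, div_one]
      congr 2
      push_cast
      linear_combination (x ^ 2 : ℂ) * Complex.I_sq
    simp_rw [h1]
    rw [integral_const_mul, integral_cexp_quadratic_real _ hr2]
    push_cast
    rw [← mul_assoc]
    congr 2
    have h3 : (1 + r : ℂ) ≠ 0 := by exact_mod_cast (by linarith : (1 + r : ℝ) ≠ 0)
    have h4 : (1 - r : ℂ) ≠ 0 := by exact_mod_cast (by linarith : (1 - r : ℝ) ≠ 0)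
    rw [show (1 - (r : ℂ) ^ 2) = (1 - r) * (1 + r) by ring, mul_pow, mul_pow, mul_pow,
      Complex.I_sq]
    field_simp
    ring
  · refine (integrable_exp_prod hr0 hr1).mono' ?_ (Eventually.of_forall fun z => ?_)
    · refine Continuous.aestronglyMeasurable ?_
      have := continuous_mehlerFactor 0 x
      fun_prop
    · rw [norm_mul, norm_mul, norm_mehlerFactor, norm_mehlerFactor, Complex.norm_exp]
      simp only [pow_zero, one_mul]
      gcongr
      have : (-2 * (r : ℂ) * (z.1 * z.2)).re = 2 * r * (-(z.1 * z.2)) := by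
        rw [show -2 * (r : ℂ) * (z.1 * z.2) = ((2 * r * (-(z.1 * z.2)) : ℝ) : ℂ) by
          push_cast; ring, Complex.ofReal_re]
      rw [this, ← abs_mul]
      gcongr
      exact neg_le_abs _

/-- Mehler's formula on the diagonal. Writing both factors of `h_n(x)²` as Fourier integrals, the
series becomes an exponential series under a double integral, which is Gaussian. -/
theorem hasSum_mehler {r : ℝ} (hr0 : 0 ≤ r) (hr1 : r < 1) (x : ℝ) :
    HasSum (fun n => r ^ n * hermiteFun n x ^ 2)
      ((Real.sqrt (Real.pi * (1 - r ^ 2)))⁻¹ * Real.exp (-(x ^ 2 * ((1 - r) / (1 + r))))) := by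
  have hr2 : 0 < 1 - r ^ 2 := by nlinarith
  set F : ℕ → ℝ × ℝ → ℂ := fun n z => (-2 * r * (z.1 * z.2)) ^ n / n.factorial *
    (mehlerFactor 0 x z.1 * mehlerFactor 0 x z.2) with hF
  have hsum : HasSum (fun n => ∫ z, F n z ∂(volume.prod volume))
      (∫ z : ℝ × ℝ, Complex.exp (-2 * r * (z.1 * z.2)) *
        (mehlerFactor 0 x z.1 * mehlerFactor 0 x z.2) ∂(volume.prod volume)) := by
    have hexp : ∀ z : ℝ × ℝ, HasSum (fun n : ℕ => (2 * r * (|z.1| * |z.2|)) ^ n / n.factorial *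
        (Real.exp (-z.1 ^ 2) * Real.exp (-z.2 ^ 2))) (Real.exp (2 * r * (|z.1| * |z.2|)) *
        (Real.exp (-z.1 ^ 2) * Real.exp (-z.2 ^ 2))) := fun z => by
      refine HasSum.mul_right _ ?_
      rw [Real.exp_eq_exp_ℝ]
      exact NormedSpace.expSeries_div_hasSum_exp _
    refine hasSum_integral_of_dominated_convergence
      (fun n z => (2 * r * (|z.1| * |z.2|)) ^ n / n.factorial *
        (Real.exp (-z.1 ^ 2) * Real.exp (-z.2 ^ 2))) ?_ ?_ ?_ ?_ ?_
    · intro n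
      refine Continuous.aestronglyMeasurable ?_
      have := continuous_mehlerFactor 0 x
      rw [hF]
      fun_prop
    · refine fun n => Eventually.of_forall fun z => le_of_eq ?_
      simp only [hF]
      rw [norm_mul, norm_mul, norm_mehlerFactor, norm_mehlerFactor, norm_div, norm_pow]
      simp [abs_of_nonneg hr0]
    · exact Eventually.of_forall fun z => (hexp z).summable
    · refine (integrable_exp_prod hr0 hr1).congr (Eventually.of_forall fun z => ?_)
      exact (hexp z).tsum_eq.symm
    · refine Eventually.of_forall fun z => HasSum.mul_right _ ?_
      rw [Complex.exp_eq_exp_ℂ]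
      exact NormedSpace.expSeries_div_hasSum_exp _
  rw [integral_mehler_prod hr0 hr1] at hsum
  -- each term is a product of two Fourier integrals, that is, a multiple of `r^n h_n(x)²`
  have hterm : ∀ n, ((r ^ n * hermiteFun n x ^ 2 : ℝ) : ℂ) =
      ((Real.exp (x ^ 2) / (Real.pi * Real.sqrt Real.pi) : ℝ) : ℂ) *
        ∫ z, F n z ∂(volume.prod volume) := by
    intro n
    have e1 : ∀ z : ℝ × ℝ, F n z = ((r ^ n / (n.factorial * 2 ^ n) : ℝ) : ℂ) *
        (mehlerFactor n x z.1 * mehlerFactor n x z.2) := fun z => by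
      simp only [hF, mehlerFactor, pow_zero, one_mul]
      have e2 : (-2 * (r : ℂ) * (z.1 * z.2)) ^ n =
          (r / 2) ^ n * ((2 * Complex.I * z.1) ^ n * (2 * Complex.I * z.2) ^ n) := by
        rw [← mul_pow, ← mul_pow]
        congr 1
        linear_combination (-2 * (r : ℂ) * z.1 * z.2) * Complex.I_sq
      rw [e2, div_pow]
      push_cast
      field_simp
    simp_rw [e1]
    rw [integral_const_mul, integral_prod_mul]
    have e3 := gaussDeriv_eq_integral n x
    have hp : (Real.sqrt Real.pi : ℂ) ≠ 0 := by
      exact_mod_cast (Real.sqrt_pos.2 Real.pi_pos).ne'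
    have e4 : ∫ t, mehlerFactor n x t = (Real.sqrt Real.pi : ℂ) * gaussDeriv n x := by
      rw [e3, ← mul_assoc, mul_inv_cancel₀ hp, one_mul]
    rw [e4]
    have e5 : hermiteFun n x ^ 2 = (n.factorial * 2 ^ n * Real.sqrt Real.pi)⁻¹ *
        Real.exp (x ^ 2) * gaussDeriv n x ^ 2 := by
      have e6 : Real.exp (x ^ 2) = Real.exp (x ^ 2 / 2) ^ 2 := by
        rw [← Real.exp_nat_mul]
        congr 1
        push_cast
        ring
      rw [hermiteFun_eq, ← hermiteConst_sq, e6, mul_pow, mul_pow, mul_pow, ← pow_mul,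
        mul_comm n 2, pow_mul]
      norm_num
    rw [e5]
    norm_cast
    have hs : Real.sqrt Real.pi * Real.sqrt Real.pi = Real.pi :=
      Real.mul_self_sqrt Real.pi_pos.le
    have hs0 : Real.sqrt Real.pi ≠ 0 := (Real.sqrt_pos.2 Real.pi_pos).ne'
    rw [show Real.sqrt Real.pi * gaussDeriv n x * (Real.sqrt Real.pi * gaussDeriv n x) =
      Real.pi * gaussDeriv n x ^ 2 by rw [mul_mul_mul_comm, hs, sq]]
    have hpi := Real.pi_pos.ne'
    field_simp
  have h1 := hsum.mul_left ((Real.exp (x ^ 2) / (Real.pi * Real.sqrt Real.pi) : ℝ) : ℂ)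
  simp_rw [← hterm] at h1
  rw [← Complex.ofReal_mul] at h1
  have h2 := Complex.hasSum_ofReal.1 h1
  convert h2 using 1
  have hs0 : Real.sqrt Real.pi ≠ 0 := (Real.sqrt_pos.2 Real.pi_pos).ne'
  have hq : Real.sqrt (1 - r ^ 2) ≠ 0 := (Real.sqrt_pos.2 hr2).ne'
  have hs : Real.sqrt Real.pi ^ 2 = Real.pi := Real.sq_sqrt Real.pi_pos.le
  rw [Real.sqrt_mul Real.pi_pos.le, Real.sqrt_div Real.pi_pos.le, sub_eq_add_neg (-x ^ 2),
    Real.exp_add, Real.exp_neg (x ^ 2), ← hs]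
  have he := (Real.exp_pos (x ^ 2)).ne'
  rw [Real.sqrt_sq (Real.sqrt_nonneg _)]
  field_simp

/-! ### Bounds for weighted sums of squares of Hermite functions -/

/-- Mehler's formula at `r = 1 - τ`, as an upper bound for finite sums. -/
theorem sum_one_sub_pow_mul_hermiteFun_sq_le {τ : ℝ} (h0 : 0 < τ) (h1 : τ ≤ 1 / 2)
    (s : Finset ℕ) (x : ℝ) :
    ∑ n ∈ s, (1 - τ) ^ n * hermiteFun n x ^ 2 ≤
      (Real.sqrt τ)⁻¹ * Real.exp (-(x ^ 2 * τ / 2)) := by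
  have hr0 : 0 ≤ 1 - τ := by linarith
  have h := hasSum_mehler hr0 (by linarith : 1 - τ < 1) x
  refine (sum_le_hasSum s (fun n _ => by positivity) h).trans ?_
  have h2 : τ ≤ Real.pi * (1 - (1 - τ) ^ 2) := by
    have h3 : τ ≤ 1 - (1 - τ) ^ 2 := by nlinarith
    nlinarith [Real.pi_gt_three]
  refine mul_le_mul ?_ ?_ (Real.exp_pos _).le (by positivity)
  · exact inv_anti₀ (Real.sqrt_pos.2 h0) (Real.sqrt_le_sqrt h2)
  · refine Real.exp_le_exp.2 (neg_le_neg ?_)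
    rw [mul_div_assoc]
    refine mul_le_mul_of_nonneg_left ?_ (sq_nonneg x)
    rw [div_le_div_iff₀ (by norm_num) (by linarith)]
    nlinarith

theorem half_le_one_sub_pow {τ : ℝ} (h1 : τ ≤ 1 / 2) {n : ℕ} (hn : n * τ ≤ 1 / 2) :
    1 / 2 ≤ (1 - τ) ^ n := by
  have := one_add_mul_le_pow (a := -τ) (by linarith) n
  rw [← sub_eq_add_neg] at this
  linarith

/-- The spectral function of the first `M + 1` Hermite functions, from Mehler's formula with
`1 - r` comparable to `1 / (M + 1)`. -/
theorem sum_range_hermiteFun_sq_le (M : ℕ) (x : ℝ) :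
    ∑ n ∈ Finset.range (M + 1), hermiteFun n x ^ 2 ≤ 4 * Real.sqrt (M + 1) := by
  set τ : ℝ := (2 * ((M : ℝ) + 1))⁻¹ with hτ
  have hM : (0 : ℝ) < M + 1 := by positivity
  have h0 : 0 < τ := by positivity
  have h1 : τ ≤ 1 / 2 := by
    rw [hτ, one_div]
    exact inv_anti₀ (by norm_num) (by linarith [(Nat.cast_nonneg M : (0 : ℝ) ≤ M)])
  have h2 := sum_one_sub_pow_mul_hermiteFun_sq_le h0 h1 (Finset.range (M + 1)) x
  have h3 : ∑ n ∈ Finset.range (M + 1), hermiteFun n x ^ 2 ≤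
      ∑ n ∈ Finset.range (M + 1), 2 * ((1 - τ) ^ n * hermiteFun n x ^ 2) := by
    refine Finset.sum_le_sum fun n hn => ?_
    have hn' : (n : ℝ) ≤ M := by
      exact_mod_cast Nat.lt_succ_iff.1 (Finset.mem_range.1 hn)
    have : 1 / 2 ≤ (1 - τ) ^ n := by
      refine half_le_one_sub_pow h1 ?_
      rw [hτ, ← div_eq_mul_inv, div_le_div_iff₀ (by positivity) (by norm_num)]
      linarith
    nlinarith [sq_nonneg (hermiteFun n x)]
  rw [← Finset.mul_sum] at h3
  have h4 : Real.exp (-(x ^ 2 * τ / 2)) ≤ 1 := by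
    rw [Real.exp_le_one_iff]
    have : 0 ≤ x ^ 2 * τ / 2 := by positivity
    linarith
  have h5 : (Real.sqrt τ)⁻¹ ≤ 2 * Real.sqrt (M + 1) := by
    rw [hτ, Real.sqrt_inv, inv_inv]
    refine Real.sqrt_le_iff.2 ⟨by positivity, ?_⟩
    rw [mul_pow, Real.sq_sqrt hM.le]
    linarith
  have h6 : 0 ≤ (Real.sqrt τ)⁻¹ := by positivity
  nlinarith

/-- The majorant `(1 + x²)^{-5/16}` of the Green function of the harmonic oscillator (on the
diagonal, with a small loss of powers of the frequency). It is bounded and square integrable. -/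
def greenMajorant (x : ℝ) : ℝ := (1 + x ^ 2) ^ (-(5 / 16) : ℝ)

theorem greenMajorant_pos (x : ℝ) : 0 < greenMajorant x := Real.rpow_pos_of_pos (by positivity) _

theorem greenMajorant_le_one (x : ℝ) : greenMajorant x ≤ 1 :=
  Real.rpow_le_one_of_one_le_of_nonpos (by nlinarith [sq_nonneg x]) (by norm_num)

theorem continuous_greenMajorant : Continuous greenMajorant := by
  unfold greenMajorant
  exact Continuous.rpow_const (by fun_prop) fun x => Or.inl (by positivity)

theorem integrable_greenMajorant_sq : Integrable fun x => greenMajorant x ^ 2 := by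
  have h := integrable_rpow_neg_one_add_norm_sq (E := ℝ) (μ := volume) (r := 5 / 4)
    (by norm_num)
  refine h.congr (Eventually.of_forall fun x => ?_)
  simp only [greenMajorant]
  rw [← Real.rpow_natCast ((1 + x ^ 2) ^ (-(5 / 16) : ℝ)), ← Real.rpow_mul (by positivity),
    Real.norm_eq_abs, sq_abs]
  norm_num

/-- The Gaussian factor in Mehler's formula with `1 - r = 2^{-(j+2)}` is traded for
`(1 + x²)^{-5/16}`, at the price of a factor `2^{5j/16}`. -/
theorem exp_neg_le_greenMajorant (j : ℕ) (x : ℝ) :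
    Real.exp (-(x ^ 2 * ((2 : ℝ) ^ (j + 2))⁻¹ / 2)) ≤
      2 * ((2 : ℝ) ^ (5 / 16 : ℝ)) ^ j * greenMajorant x := by
  set y : ℝ := x ^ 2 * ((2 : ℝ) ^ (j + 2))⁻¹ / 2 with hy
  have hy0 : 0 ≤ y := by positivity
  have h1 : Real.exp (-y) ≤ (1 + y) ^ (-(5 / 16) : ℝ) := by
    have h2 : 1 + y ≤ Real.exp y := by linarith [Real.add_one_le_exp y]
    calc Real.exp (-y) = (Real.exp y)⁻¹ := Real.exp_neg y
      _ ≤ (1 + y)⁻¹ := inv_anti₀ (by linarith) h2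
      _ = (1 + y) ^ (-1 : ℝ) := (Real.rpow_neg_one _).symm
      _ ≤ (1 + y) ^ (-(5 / 16) : ℝ) :=
        Real.rpow_le_rpow_of_exponent_le (by linarith) (by norm_num)
  refine h1.trans ?_
  have h3 : ((2 : ℝ) ^ (j + 3))⁻¹ * (1 + x ^ 2) ≤ 1 + y := by
    have h4 : ((2 : ℝ) ^ (j + 3))⁻¹ ≤ 1 := inv_le_one_of_one_le₀ (one_le_pow₀ (by norm_num))
    have h5 : y = ((2 : ℝ) ^ (j + 3))⁻¹ * x ^ 2 := by
      rw [hy, pow_succ _ (j + 2)]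
      field_simp
    rw [h5, mul_add, mul_one]
    linarith
  refine (Real.rpow_le_rpow_of_nonpos (by positivity) h3 (by norm_num)).trans ?_
  rw [Real.mul_rpow (by positivity) (by positivity), ← greenMajorant]
  refine mul_le_mul_of_nonneg_right ?_ (greenMajorant_pos x).le
  rw [Real.inv_rpow (by positivity), Real.rpow_neg (by positivity), inv_inv,
    ← Real.rpow_natCast 2, ← Real.rpow_mul (by norm_num), ← Real.rpow_natCast,
    ← Real.rpow_mul (by norm_num)]
  push_cast
  rw [show ((j : ℝ) + 3) * (5 / 16) = 15 / 16 + 5 / 16 * j by ring, Real.rpow_add (by norm_num)]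
  refine mul_le_mul_of_nonneg_right ?_ (by positivity)
  calc (2 : ℝ) ^ (15 / 16 : ℝ) ≤ (2 : ℝ) ^ (1 : ℝ) :=
        Real.rpow_le_rpow_of_exponent_le (by norm_num) (by norm_num)
    _ = 2 := Real.rpow_one 2

/-- The sum `∑ (n+1)^{-7/8} h_n(x)²` is estimated by decomposing the weight `(n+1)^{-7/8}` into
dyadic pieces, each of which is controlled by Mehler's formula with `1 - r` comparable to
the inverse frequency. -/
theorem exists_sum_rpow_mul_hermiteFun_sq_le : ∃ C : ℝ, 0 < C ∧ ∀ (s : Finset ℕ) (x : ℝ),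
    ∑ n ∈ s, ((n : ℝ) + 1) ^ (-(7 / 8) : ℝ) * hermiteFun n x ^ 2 ≤ C * greenMajorant x := by
  -- at the dyadic scale `2^j`: `ρ^j` for the weight, `2^{j/2}` from Mehler's formula, and `2^{5j/16}`
  -- from the Gaussian factor; the product `θ^j` is summable
  set ρ : ℝ := (2 : ℝ) ^ (-(7 / 8) : ℝ) with hρ
  have hρ0 : 0 < ρ := Real.rpow_pos_of_pos (by norm_num) _
  set θ : ℝ := (2 : ℝ) ^ (-(1 / 16) : ℝ) with hθ
  have hθ0 : 0 < θ := Real.rpow_pos_of_pos (by norm_num) _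
  have hθ1 : θ < 1 := Real.rpow_lt_one_of_one_lt_of_neg (by norm_num) (by norm_num)
  have hθ2 : ρ * Real.sqrt 2 * (2 : ℝ) ^ (5 / 16 : ℝ) = θ := by
    rw [Real.sqrt_eq_rpow, hρ, hθ, ← Real.rpow_add (by norm_num), ← Real.rpow_add (by norm_num)]
    norm_num
  refine ⟨8 * (1 - θ)⁻¹, by have := sub_pos.2 hθ1; positivity, fun s x => ?_⟩
  set τ : ℕ → ℝ := fun j => ((2 : ℝ) ^ (j + 2))⁻¹ with hτ
  have hτ0 : ∀ j, 0 < τ j := fun j => by positivity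
  have hτ1 : ∀ j, τ j ≤ 1 / 2 := fun j => by
    have h4 : (2 : ℝ) ^ 1 ≤ (2 : ℝ) ^ (j + 2) := pow_le_pow_right₀ (by norm_num) (by omega)
    rw [hτ, one_div]
    exact inv_anti₀ (by norm_num) (by simpa using h4)
  -- the term `j = log₂ (n + 1)` alone dominates the weight of `n`
  have hpt : ∀ n ∈ s, ((n : ℝ) + 1) ^ (-(7 / 8) : ℝ) ≤
      ∑ j ∈ s.image (fun n => Nat.log 2 (n + 1)), 2 * (ρ ^ j * (1 - τ j) ^ n) := by
    intro n hn
    have hpos : ∀ j, 0 ≤ 2 * (ρ ^ j * (1 - τ j) ^ n) := fun j => by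
      have : 0 ≤ 1 - τ j := by linarith [hτ1 j]
      positivity
    refine le_trans ?_ (Finset.single_le_sum (fun j _ => hpos j)
      (Finset.mem_image_of_mem (fun n => Nat.log 2 (n + 1)) hn))
    set j := Nat.log 2 (n + 1) with hj
    have h1 : (2 : ℝ) ^ j ≤ n + 1 := by exact_mod_cast Nat.pow_log_le_self 2 (Nat.succ_ne_zero n)
    have h2 : ((n : ℝ) + 1) < 2 ^ (j + 1) := by
      exact_mod_cast Nat.lt_pow_succ_log_self (by norm_num) (n + 1)
    have h3 : 1 / 2 ≤ (1 - τ j) ^ n := by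
      refine half_le_one_sub_pow (hτ1 j) ?_
      rw [hτ]
      simp only
      rw [← div_eq_mul_inv, div_le_div_iff₀ (by positivity) (by norm_num), pow_succ _ (j + 1)]
      linarith
    have h4 : ((n : ℝ) + 1) ^ (-(7 / 8) : ℝ) ≤ ρ ^ j := by
      refine (Real.rpow_le_rpow_of_nonpos (by positivity) h1 (by norm_num)).trans (le_of_eq ?_)
      rw [hρ, ← Real.rpow_natCast, ← Real.rpow_natCast, ← Real.rpow_mul (by norm_num),
        ← Real.rpow_mul (by norm_num), mul_comm]
    nlinarith [pow_pos hρ0 j]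
  calc ∑ n ∈ s, ((n : ℝ) + 1) ^ (-(7 / 8) : ℝ) * hermiteFun n x ^ 2
      ≤ ∑ n ∈ s, (∑ j ∈ s.image (fun n => Nat.log 2 (n + 1)),
          2 * (ρ ^ j * (1 - τ j) ^ n)) * hermiteFun n x ^ 2 :=
        Finset.sum_le_sum fun n hn => mul_le_mul_of_nonneg_right (hpt n hn) (sq_nonneg _)
    _ = ∑ j ∈ s.image (fun n => Nat.log 2 (n + 1)),
          2 * ρ ^ j * ∑ n ∈ s, (1 - τ j) ^ n * hermiteFun n x ^ 2 := by
        simp_rw [Finset.sum_mul, Finset.mul_sum]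
        rw [Finset.sum_comm]
        refine Finset.sum_congr rfl fun j _ => Finset.sum_congr rfl fun n _ => ?_
        ring
    _ ≤ ∑ j ∈ s.image (fun n => Nat.log 2 (n + 1)), θ ^ j * (8 * greenMajorant x) := by
        refine Finset.sum_le_sum fun j _ => ?_
        have h1 := (sum_one_sub_pow_mul_hermiteFun_sq_le (hτ0 j) (hτ1 j) s x).trans
          (mul_le_mul_of_nonneg_left (exp_neg_le_greenMajorant j x) (by positivity))
        have h2 : (Real.sqrt (τ j))⁻¹ = 2 * Real.sqrt 2 ^ j := by
          have e : (2 : ℝ) ^ (j + 2) = (2 * Real.sqrt 2 ^ j) ^ 2 := by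
            rw [mul_pow, ← pow_mul, mul_comm j 2, pow_mul, Real.sq_sqrt (by norm_num)]
            ring
          rw [hτ]
          simp only
          rw [Real.sqrt_inv, inv_inv, e, Real.sqrt_sq (by positivity)]
        rw [h2] at h1
        refine (mul_le_mul_of_nonneg_left h1 (by positivity)).trans (le_of_eq ?_)
        rw [← hθ2, mul_pow, mul_pow]
        ring
    _ = (∑ j ∈ s.image (fun n => Nat.log 2 (n + 1)), θ ^ j) * (8 * greenMajorant x) := by
        rw [Finset.sum_mul]
    _ ≤ (1 - θ)⁻¹ * (8 * greenMajorant x) := by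
        refine mul_le_mul_of_nonneg_right ?_ (by have := greenMajorant_pos x; positivity)
        exact sum_le_hasSum _ (fun j _ => by positivity)
          (hasSum_geometric_of_lt_one hθ0.le hθ1)
    _ = 8 * (1 - θ)⁻¹ * greenMajorant x := by ring

theorem freq_pos (n : ℕ) : 0 < freq n := Real.sqrt_pos.2 (by positivity)

theorem freq_sq (n : ℕ) : freq n ^ 2 = 2 * n + 1 := Real.sq_sqrt (by positivity)

/-- The variance `a_n = 2 / λ_n²` of the `n`-th coefficient of the Gaussian field. -/
def coeffVar (n : ℕ) : ℝ := 2 / freq n ^ 2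

theorem coeffVar_eq (n : ℕ) : coeffVar n = 2 / (2 * n + 1) := by rw [coeffVar, freq_sq]

theorem coeffVar_pos (n : ℕ) : 0 < coeffVar n := by rw [coeffVar_eq]; positivity

theorem coeffVar_le (n : ℕ) : coeffVar n ≤ 2 / (n + 1) := by
  rw [coeffVar_eq]
  exact div_le_div_of_nonneg_left (by norm_num) (by positivity)
    (by linarith [(Nat.cast_nonneg n : (0 : ℝ) ≤ n)])

/-- The pointwise variance of the Gaussian field restricted to the frequencies `n ≥ M`. -/
theorem exists_sum_coeffVar_mul_hermiteFun_sq_le : ∃ C : ℝ, 0 < C ∧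
    ∀ (M : ℕ) (s : Finset ℕ), (∀ n ∈ s, M ≤ n) → ∀ x : ℝ,
      ∑ n ∈ s, coeffVar n * hermiteFun n x ^ 2 ≤
        C * ((M : ℝ) + 1) ^ (-(1 / 8) : ℝ) * greenMajorant x := by
  obtain ⟨C, hC, h⟩ := exists_sum_rpow_mul_hermiteFun_sq_le
  refine ⟨2 * C, by positivity, fun M s hs x => ?_⟩
  have hM : 0 ≤ ((M : ℝ) + 1) ^ (-(1 / 8) : ℝ) := by positivity
  calc ∑ n ∈ s, coeffVar n * hermiteFun n x ^ 2
      ≤ ∑ n ∈ s, 2 * ((M : ℝ) + 1) ^ (-(1 / 8) : ℝ) *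
          (((n : ℝ) + 1) ^ (-(7 / 8) : ℝ) * hermiteFun n x ^ 2) := by
        refine Finset.sum_le_sum fun n hn => ?_
        have hn1 : (0 : ℝ) < n + 1 := by positivity
        have e : 2 / ((n : ℝ) + 1) =
            2 * (((n : ℝ) + 1) ^ (-(1 / 8) : ℝ) * ((n : ℝ) + 1) ^ (-(7 / 8) : ℝ)) := by
          rw [← Real.rpow_add hn1]
          norm_num
          rw [Real.rpow_neg_one, div_eq_mul_inv]
        have h1 : ((n : ℝ) + 1) ^ (-(1 / 8) : ℝ) ≤ ((M : ℝ) + 1) ^ (-(1 / 8) : ℝ) := by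
          refine Real.rpow_le_rpow_of_nonpos (by positivity) ?_ (by norm_num)
          have : (M : ℝ) ≤ n := by exact_mod_cast hs n hn
          linarith
        have h2 : 0 ≤ ((n : ℝ) + 1) ^ (-(7 / 8) : ℝ) := by positivity
        have h3 := coeffVar_le n
        rw [e] at h3
        have h4 : coeffVar n ≤
            2 * (((M : ℝ) + 1) ^ (-(1 / 8) : ℝ) * ((n : ℝ) + 1) ^ (-(7 / 8) : ℝ)) :=
          h3.trans (by gcongr)
        nlinarith [mul_le_mul_of_nonneg_right h4 (sq_nonneg (hermiteFun n x))]
    _ = 2 * ((M : ℝ) + 1) ^ (-(1 / 8) : ℝ) *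
          ∑ n ∈ s, ((n : ℝ) + 1) ^ (-(7 / 8) : ℝ) * hermiteFun n x ^ 2 := by
        rw [Finset.mul_sum]
    _ ≤ 2 * ((M : ℝ) + 1) ^ (-(1 / 8) : ℝ) * (C * greenMajorant x) :=
        mul_le_mul_of_nonneg_left (h s x) (by positivity)
    _ = 2 * C * ((M : ℝ) + 1) ^ (-(1 / 8) : ℝ) * greenMajorant x := by ring

/-! ### Hermite expansions of Schwartz functions and of tempered distributions -/

/-- The Hermite coefficient `∫ h_n ψ` of a Schwartz function. -/
def hermiteCoeff (n : ℕ) (ψ : 𝓢(ℝ, ℂ)) : ℂ := ∫ x, hermiteS n x * ψ x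

/-- The harmonic oscillator `-∂_x² + x² = (x - ∂_x)(x + ∂_x) + 1`. -/
def harmonicCLM : 𝓢(ℝ, ℂ) →L[ℂ] 𝓢(ℝ, ℂ) := raiseCLM ∘L lowerCLM + ContinuousLinearMap.id ℂ _

theorem raiseCLM_lowerCLM_hermiteS (n : ℕ) :
    raiseCLM (lowerCLM (hermiteS n)) = (2 * n : ℂ) • hermiteS n := by
  rw [lowerCLM_hermiteS, map_smul, raiseCLM_hermiteS, smul_smul]
  cases n with
  | zero => simp
  | succ n =>
    rw [Nat.add_sub_cancel, ← Complex.ofReal_mul]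
    push_cast
    rw [← Complex.ofReal_mul, Real.mul_self_sqrt (by positivity)]
    push_cast
    rfl

theorem hermiteCoeff_harmonicCLM (n : ℕ) (ψ : 𝓢(ℝ, ℂ)) :
    hermiteCoeff n (harmonicCLM ψ) = (2 * n + 1) * hermiteCoeff n ψ := by
  have h1 : ∫ x, hermiteS n x * raiseCLM (lowerCLM ψ) x = 2 * n * hermiteCoeff n ψ := by
    calc ∫ x, hermiteS n x * raiseCLM (lowerCLM ψ) x
        = ∫ x, raiseCLM (lowerCLM ψ) x * hermiteS n x := by simp_rw [mul_comm]
      _ = ∫ x, lowerCLM (hermiteS n) x * lowerCLM ψ x := by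
        rw [integral_raiseCLM_mul]; simp_rw [mul_comm]
      _ = ∫ x, raiseCLM (lowerCLM (hermiteS n)) x * ψ x := (integral_raiseCLM_mul _ _).symm
      _ = 2 * n * hermiteCoeff n ψ := by
        rw [raiseCLM_lowerCLM_hermiteS, hermiteCoeff, ← integral_const_mul]
        refine integral_congr_ae (Eventually.of_forall fun x => ?_)
        simp only [smul_apply, smul_eq_mul]
        ring
  have h2 : ∀ x, hermiteS n x * harmonicCLM ψ x =
      hermiteS n x * raiseCLM (lowerCLM ψ) x + hermiteS n x * ψ x := fun x => by
    rw [← mul_add]; rfl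
  rw [hermiteCoeff]
  simp_rw [h2]
  rw [integral_add (integrable_schwartz_mul _ _) (integrable_schwartz_mul _ _), h1, hermiteCoeff]
  ring

theorem hermiteCoeff_harmonicCLM_pow (k n : ℕ) (ψ : 𝓢(ℝ, ℂ)) :
    hermiteCoeff n ((harmonicCLM ^ k) ψ) = (2 * n + 1) ^ k * hermiteCoeff n ψ := by
  induction k with
  | zero => simp
  | succ k ih =>
    rw [pow_succ' harmonicCLM, mul_apply_eq_comp, hermiteCoeff_harmonicCLM, ih]
    ring

theorem exists_norm_hermiteCoeff_le (ψ : 𝓢(ℝ, ℂ)) : ∃ C : ℝ, ∀ n, ‖hermiteCoeff n ψ‖ ≤ C := by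
  refine ⟨1 + ∫ x, ‖ψ x‖ ^ 2, fun n => ?_⟩
  have i1 : Integrable fun x => ‖ψ x‖ ^ 2 := (ψ.memLp 2).integrable_norm_pow (by norm_num)
  have i2 : Integrable fun x => hermiteFun n x ^ 2 := by
    simpa only [← sq] using integrable_hermiteFun_mul n n
  have e : ∫ x, hermiteFun n x ^ 2 = 1 := by
    simpa only [← sq, if_true] using integral_hermiteFun_mul n n
  rw [← e, ← integral_add i2 i1]
  refine (norm_integral_le_integral_norm _).trans
    (integral_mono (integrable_schwartz_mul _ _).norm (i2.add i1) fun x => ?_)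
  simp only [norm_mul, hermiteS_apply, Complex.norm_real, Real.norm_eq_abs]
  nlinarith [sq_abs (hermiteFun n x), sq_nonneg (|hermiteFun n x| - ‖ψ x‖),
    sq_nonneg (hermiteFun n x), sq_nonneg ‖ψ x‖]

/-- The Hermite coefficients of a Schwartz function decay rapidly. -/
theorem exists_norm_hermiteCoeff_mul_pow_le (k : ℕ) (ψ : 𝓢(ℝ, ℂ)) :
    ∃ C : ℝ, ∀ n : ℕ, ‖hermiteCoeff n ψ‖ * ((n : ℝ) + 1) ^ k ≤ C := by
  obtain ⟨C, hC⟩ := exists_norm_hermiteCoeff_le ((harmonicCLM ^ k) ψ)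
  refine ⟨C, fun n => le_trans ?_ (hC n)⟩
  rw [hermiteCoeff_harmonicCLM_pow, norm_mul, norm_pow, mul_comm]
  have : ‖(2 * n + 1 : ℂ)‖ = 2 * n + 1 := by
    rw [show (2 * n + 1 : ℂ) = ((2 * n + 1 : ℝ) : ℂ) by push_cast; rfl, Complex.norm_real,
      Real.norm_of_nonneg (by positivity)]
  rw [this]
  gcongr
  linarith [(Nat.cast_nonneg n : (0 : ℝ) ≤ n)]

theorem summable_inv_add_one_sq : Summable fun n : ℕ => (((n : ℝ) + 1) ^ 2)⁻¹ := by
  have := (summable_nat_add_iff 1).2 (Real.summable_nat_pow_inv.2 (by norm_num : 1 < 2))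
  simpa using this

theorem norm_hermiteS_le (n : ℕ) (x : ℝ) : ‖hermiteS n x‖ ≤ 2 * ((n : ℝ) + 1) := by
  rw [hermiteS_apply, Complex.norm_real, Real.norm_eq_abs]
  refine abs_le_of_sq_le_sq ?_ (by positivity)
  have h1 := Finset.single_le_sum (f := fun n => hermiteFun n x ^ 2) (fun n _ => sq_nonneg _)
    (Finset.mem_range.2 (Nat.lt_succ_self n))
  have h2 := sum_range_hermiteFun_sq_le n x
  have h3 : Real.sqrt (n + 1) ≤ n + 1 := by
    refine Real.sqrt_le_iff.2 ⟨by positivity, ?_⟩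
    nlinarith [(Nat.cast_nonneg n : (0 : ℝ) ≤ n)]
  nlinarith [(Nat.cast_nonneg n : (0 : ℝ) ≤ n)]

/-- If a seminorm grows polynomially along the Hermite functions, so does its composition with the
ladder operators, hence with `x` and with `∂_x`. -/
theorem exists_seminorm_mulX_deriv_hermiteS_le (a b : ℕ) (q : Seminorm ℂ 𝓢(ℝ, ℂ))
    (hq : ∃ (C : ℝ) (m : ℕ), 0 ≤ C ∧ ∀ n : ℕ, q (hermiteS n) ≤ C * ((n : ℝ) + 1) ^ m) :
    ∃ (C : ℝ) (m : ℕ), 0 ≤ C ∧ ∀ n : ℕ,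
      q ((mulXCLM ^ a) ((SchwartzMap.derivCLM ℂ ℂ ^ b) (hermiteS n))) ≤
        C * ((n : ℝ) + 1) ^ m := by
  have hsq : ∀ n : ℕ, Real.sqrt (2 * n) ≤ 2 * ((n : ℝ) + 1) ∧
      Real.sqrt (2 * (n + 1)) ≤ 2 * ((n : ℝ) + 1) := fun n => by
    have hn : (0 : ℝ) ≤ n := n.cast_nonneg
    constructor <;> refine Real.sqrt_le_iff.2 ⟨by positivity, ?_⟩ <;> nlinarith
  have hm : ∀ n, mulXCLM (hermiteS n) = (2⁻¹ * Real.sqrt (2 * n) : ℂ) • hermiteS (n - 1) +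
      (2⁻¹ * Real.sqrt (2 * (n + 1)) : ℂ) • hermiteS (n + 1) := fun n => by
    rw [mul_smul, mul_smul, ← lowerCLM_hermiteS, ← raiseCLM_hermiteS]
    ext x
    simp only [add_apply, smul_apply, smul_eq_mul, lowerCLM_apply, raiseCLM_apply, mulXCLM_apply]
    ring
  have hd : ∀ n, SchwartzMap.derivCLM ℂ ℂ (hermiteS n) =
      (2⁻¹ * Real.sqrt (2 * n) : ℂ) • hermiteS (n - 1) +
      (-2⁻¹ * Real.sqrt (2 * (n + 1)) : ℂ) • hermiteS (n + 1) := fun n => by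
    rw [mul_smul, mul_smul, ← lowerCLM_hermiteS, ← raiseCLM_hermiteS]
    ext x
    simp only [add_apply, smul_apply, smul_eq_mul, lowerCLM_apply, raiseCLM_apply,
      SchwartzMap.derivCLM_apply]
    ring
  -- a sequence of combinations of neighbours with linearly growing coefficients
  have step : ∀ (q : Seminorm ℂ 𝓢(ℝ, ℂ)) (L : 𝓢(ℝ, ℂ) →L[ℂ] 𝓢(ℝ, ℂ)) (e : ℂ), ‖e‖ = 2⁻¹ →
      (∀ n, L (hermiteS n) = (2⁻¹ * Real.sqrt (2 * n) : ℂ) • hermiteS (n - 1) +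
        (e * Real.sqrt (2 * (n + 1)) : ℂ) • hermiteS (n + 1)) →
      (∃ (C : ℝ) (m : ℕ), 0 ≤ C ∧ ∀ n : ℕ, q (hermiteS n) ≤ C * ((n : ℝ) + 1) ^ m) →
      ∃ (C : ℝ) (m : ℕ), 0 ≤ C ∧ ∀ n : ℕ, q (L (hermiteS n)) ≤ C * ((n : ℝ) + 1) ^ m := by
    intro q L e he hL ⟨C, m, hC, h⟩
    refine ⟨2 * C * 2 ^ m, m + 1, by positivity, fun n => ?_⟩
    have hn : (0 : ℝ) ≤ n := n.cast_nonneg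
    have b1 : q (hermiteS (n - 1)) ≤ C * 2 ^ m * ((n : ℝ) + 1) ^ m := by
      refine (h _).trans ?_
      rw [mul_assoc, ← mul_pow]
      have : ((n - 1 : ℕ) : ℝ) ≤ n := by exact_mod_cast Nat.sub_le n 1
      gcongr
      linarith
    have b2 : q (hermiteS (n + 1)) ≤ C * 2 ^ m * ((n : ℝ) + 1) ^ m := by
      refine (h _).trans ?_
      rw [mul_assoc, ← mul_pow]
      push_cast
      gcongr
      linarith
    have n1 : ‖(2⁻¹ * Real.sqrt (2 * n) : ℂ)‖ ≤ n + 1 := by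
      rw [norm_mul, Complex.norm_real, Real.norm_of_nonneg (Real.sqrt_nonneg _)]
      have : ‖(2⁻¹ : ℂ)‖ = 2⁻¹ := by simp
      rw [this]
      linarith [(hsq n).1]
    have n2 : ‖(e * Real.sqrt (2 * (n + 1)) : ℂ)‖ ≤ n + 1 := by
      rw [norm_mul, he, Complex.norm_real, Real.norm_of_nonneg (Real.sqrt_nonneg _)]
      linarith [(hsq n).2]
    rw [hL]
    refine (map_add_le_add q _ _).trans ?_
    rw [map_smul_eq_mul, map_smul_eq_mul]
    have p1 := mul_le_mul n1 b1 (apply_nonneg q _) (by positivity)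
    have p2 := mul_le_mul n2 b2 (apply_nonneg q _) (by positivity)
    calc _ ≤ ((n : ℝ) + 1) * (C * 2 ^ m * ((n : ℝ) + 1) ^ m) +
          ((n : ℝ) + 1) * (C * 2 ^ m * ((n : ℝ) + 1) ^ m) := add_le_add p1 p2
      _ = 2 * C * 2 ^ m * ((n : ℝ) + 1) ^ (m + 1) := by ring
  induction a generalizing q with
  | succ a ih =>
    have h1 := ih (q.comp (mulXCLM : 𝓢(ℝ, ℂ) →ₗ[ℂ] 𝓢(ℝ, ℂ)))
      (step q mulXCLM 2⁻¹ (by simp) hm hq)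
    obtain ⟨C, m, hC, h⟩ := h1
    refine ⟨C, m, hC, fun n => ?_⟩
    rw [pow_succ' mulXCLM]
    exact h n
  | zero =>
    induction b generalizing q with
    | zero => simpa using hq
    | succ b ih =>
      have h1 := ih (q.comp (SchwartzMap.derivCLM ℂ ℂ : 𝓢(ℝ, ℂ) →ₗ[ℂ] 𝓢(ℝ, ℂ)))
        (step q _ (-2⁻¹) (by simp) hd hq)
      obtain ⟨C, m, hC, h⟩ := h1
      refine ⟨C, m, hC, fun n => ?_⟩
      rw [pow_succ' (SchwartzMap.derivCLM ℂ ℂ)]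
      exact h n

theorem iteratedDeriv_eq_derivCLM_pow (b : ℕ) (f : 𝓢(ℝ, ℂ)) :
    iteratedDeriv b f = (SchwartzMap.derivCLM ℂ ℂ ^ b) f := by
  induction b with
  | zero => simp
  | succ b ih =>
    rw [iteratedDeriv_succ, ih, pow_succ' (SchwartzMap.derivCLM ℂ ℂ)]
    rfl

theorem mulXCLM_pow_apply (a : ℕ) (f : 𝓢(ℝ, ℂ)) (x : ℝ) : (mulXCLM ^ a) f x = x ^ a * f x := by
  induction a with
  | zero => simp
  | succ a ih =>
    rw [pow_succ' mulXCLM, mul_apply_eq_comp, mulXCLM_apply, ih]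
    ring

/-- Every Schwartz seminorm of `h_n` is bounded by a power of `n + 1`. -/
theorem exists_seminorm_hermiteS_le (a b : ℕ) : ∃ (C : ℝ) (m : ℕ), 0 ≤ C ∧ ∀ n : ℕ,
    SchwartzMap.seminorm ℂ a b (hermiteS n) ≤ C * ((n : ℝ) + 1) ^ m := by
  obtain ⟨C, m, hC, h⟩ := exists_seminorm_mulX_deriv_hermiteS_le a b
    (SchwartzMap.seminorm ℂ 0 0) ⟨2, 1, by norm_num, fun n => by
      refine SchwartzMap.seminorm_le_bound ℂ 0 0 _ (by positivity) fun x => ?_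
      simpa using norm_hermiteS_le n x⟩
  refine ⟨C, m, hC, fun n => ?_⟩
  refine SchwartzMap.seminorm_le_bound' ℂ a b _ (by positivity) fun x => ?_
  refine le_trans ?_ (h n)
  refine le_trans (le_of_eq ?_) (SchwartzMap.norm_le_seminorm ℂ _ x)
  rw [mulXCLM_pow_apply, norm_mul, norm_pow, Complex.norm_real, iteratedDeriv_eq_derivCLM_pow,
    Real.norm_eq_abs]

/-- A series of Schwartz functions that converges absolutely in every Schwartz seminorm converges
in the Schwartz space. -/
theorem exists_hasSum_of_summable_seminorm (f : ℕ → 𝓢(ℝ, ℂ))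
    (hf : ∀ a b : ℕ, Summable fun n => SchwartzMap.seminorm ℂ a b (f n)) :
    ∃ F : 𝓢(ℝ, ℂ), HasSum f F := by
  have hb : ∀ (b n : ℕ) (x : ℝ), ‖iteratedFDeriv ℝ b (f n) x‖ ≤
      SchwartzMap.seminorm ℂ 0 b (f n) := fun b n x =>
    SchwartzMap.norm_iteratedFDeriv_le_seminorm ℂ (f n) b x
  have hsm : ∀ n, ContDiff ℝ ((⊤ : ℕ∞) : WithTop ℕ∞) (f n) := fun n => (f n).smooth _
  have hit : ∀ (b : ℕ) (x : ℝ), iteratedFDeriv ℝ b (fun y => ∑' n, f n y) x =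
      ∑' n, iteratedFDeriv ℝ b (f n) x := fun b x =>
    iteratedFDeriv_tsum_apply (N := (⊤ : ℕ∞)) hsm
      (v := fun b n => SchwartzMap.seminorm ℂ 0 b (f n)) (fun b _ => hf 0 b)
      (fun b n x _ => hb b n x) (by exact_mod_cast le_top) x
  have hsx : ∀ (b : ℕ) (x : ℝ), Summable fun n => iteratedFDeriv ℝ b (f n) x := fun b x =>
    Summable.of_norm_bounded (hf 0 b) fun n => hb b n x
  have hle : ∀ (a b n : ℕ) (x : ℝ), ‖x‖ ^ a * ‖iteratedFDeriv ℝ b (f n) x‖ ≤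
      SchwartzMap.seminorm ℂ a b (f n) := fun a b n x => SchwartzMap.le_seminorm ℂ a b (f n) x
  -- the weighted tails are bounded by the tails of the series of seminorms
  have htail : ∀ (a b : ℕ) (s : Finset ℕ) (x : ℝ),
      ‖x‖ ^ a * ‖(∑' n, iteratedFDeriv ℝ b (f n) x) - ∑ n ∈ s, iteratedFDeriv ℝ b (f n) x‖ ≤
        (∑' n, SchwartzMap.seminorm ℂ a b (f n)) - ∑ n ∈ s, SchwartzMap.seminorm ℂ a b (f n) := by
    intro a b s x
    have h1 := ((hsx b x).hasSum.sub (hasSum_sum_of_ne_finset_zero (s := s)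
      (f := fun n => if n ∈ s then iteratedFDeriv ℝ b (f n) x else 0)
      fun n hn => if_neg hn))
    have h2 := ((hf a b).hasSum.sub (hasSum_sum_of_ne_finset_zero (s := s)
      (f := fun n => if n ∈ s then SchwartzMap.seminorm ℂ a b (f n) else 0)
      fun n hn => if_neg hn))
    rw [Finset.sum_congr rfl fun n hn => if_pos hn] at h1 h2
    rcases eq_or_ne (‖x‖ ^ a) 0 with h0 | h0
    · rw [h0, zero_mul]
      refine h2.nonneg fun n => ?_
      split_ifs
      · simp
      · simp
    have hx : 0 < ‖x‖ ^ a := lt_of_le_of_ne (by positivity) h0.symm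
    rw [← le_div_iff₀' hx]
    refine h1.norm_le_of_bounded (h2.div_const _) fun n => ?_
    rw [le_div_iff₀' hx]
    split_ifs
    · simp
    · simpa only [sub_zero] using hle a b n x
  let F : 𝓢(ℝ, ℂ) :=
    { toFun := fun y => ∑' n, f n y
      smooth' := contDiff_tsum (N := (⊤ : ℕ∞)) hsm
        (v := fun b n => SchwartzMap.seminorm ℂ 0 b (f n)) (fun b _ => hf 0 b)
        (fun b n x _ => hb b n x)
      decay' := fun a b => ⟨∑' n, SchwartzMap.seminorm ℂ a b (f n), fun x => by
        rw [hit]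
        simpa using htail a b ∅ x⟩ }
  refine ⟨F, ?_⟩
  rw [HasSum, SummationFilter.unconditional_filter,
    (schwartz_withSeminorms ℂ ℝ ℂ).tendsto_nhds]
  rintro ⟨a, b⟩ ε hε
  have h1 : Tendsto (fun s : Finset ℕ => (∑' n, SchwartzMap.seminorm ℂ a b (f n)) -
      ∑ n ∈ s, SchwartzMap.seminorm ℂ a b (f n)) atTop (𝓝 0) := by
    have h2 : Tendsto (fun s : Finset ℕ => ∑ n ∈ s, SchwartzMap.seminorm ℂ a b (f n)) atTop
        (𝓝 (∑' n, SchwartzMap.seminorm ℂ a b (f n))) := (hf a b).hasSum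
    simpa using h2.const_sub (∑' n, SchwartzMap.seminorm ℂ a b (f n))
  filter_upwards [h1.eventually_lt_const hε] with s hs
  refine lt_of_le_of_lt ?_ hs
  rw [SchwartzMap.schwartzSeminormFamily_apply, ← map_neg_eq_map, neg_sub]
  have h0 : 0 ≤ (∑' n, SchwartzMap.seminorm ℂ a b (f n)) -
      ∑ n ∈ s, SchwartzMap.seminorm ℂ a b (f n) :=
    sub_nonneg.2 ((hf a b).sum_le_tsum s fun n _ => apply_nonneg _ _)
  refine SchwartzMap.seminorm_le_bound ℂ a b _ h0 fun x => ?_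
  have e : ⇑(F - ∑ n ∈ s, f n) = (fun y => ∑' n, f n y) - fun y => ∑ n ∈ s, f n y := by
    ext y
    simp only [sub_apply, Pi.sub_apply, sum_apply]
    rfl
  have hF : ContDiffAt ℝ b (fun y => ∑' n, f n y) x := F.contDiffAt _
  have hS : ContDiffAt ℝ b (fun y => ∑ n ∈ s, f n y) x :=
    ContDiffAt.sum fun n _ => (f n).contDiffAt _
  rw [e, iteratedFDeriv_sub_apply hF hS, hit,
    iteratedFDeriv_fun_sum_apply fun n _ => (f n).contDiffAt _]
  exact htail a b s x

theorem hermiteFun_zero_eq (x : ℝ) :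
    hermiteFun 0 x = hermiteConst 0 * Real.exp (-(x ^ 2 / 2)) := by
  rw [hermiteFun_eq, gaussDeriv_zero, mul_assoc _ (Real.exp _), ← Real.exp_add]
  simp only [pow_zero, one_mul]
  congr 2
  ring

/-- The Hermite functions are total: a Schwartz function all of whose Hermite coefficients vanish
is zero. Indeed `h_0 ψ` is orthogonal to all monomials, so that its Fourier transform, which is
given by its everywhere convergent Taylor series, vanishes. -/
theorem eq_zero_of_hermiteCoeff_eq_zero {ψ : 𝓢(ℝ, ℂ)} (h : ∀ n, hermiteCoeff n ψ = 0) :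
    ψ = 0 := by
  -- orthogonality to the span of the Hermite functions, which is stable under multiplication by `x`
  have hspan : ∀ g ∈ Submodule.span ℂ (Set.range hermiteS), ∫ x, g x * ψ x = 0 := by
    intro g hg
    induction hg using Submodule.span_induction with
    | mem g hg =>
      obtain ⟨n, rfl⟩ := hg
      exact h n
    | zero => simp
    | add f g _ _ hf hg =>
      simp only [add_apply, add_mul]
      rw [integral_add (integrable_schwartz_mul _ _) (integrable_schwartz_mul _ _), hf, hg,
        add_zero]
    | smul a f _ hf =>
      simp only [smul_apply, smul_eq_mul, mul_assoc]
      rw [integral_const_mul, hf, mul_zero]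
  have hX : ∀ g ∈ Submodule.span ℂ (Set.range hermiteS),
      mulXCLM g ∈ Submodule.span ℂ (Set.range hermiteS) := by
    intro g hg
    induction hg using Submodule.span_induction with
    | mem g hg =>
      obtain ⟨n, rfl⟩ := hg
      have e : mulXCLM (hermiteS n) = (2⁻¹ * Real.sqrt (2 * n) : ℂ) • hermiteS (n - 1) +
          (2⁻¹ * Real.sqrt (2 * (n + 1)) : ℂ) • hermiteS (n + 1) := by
        rw [mul_smul, mul_smul, ← lowerCLM_hermiteS, ← raiseCLM_hermiteS]
        ext x
        simp only [add_apply, smul_apply, smul_eq_mul, lowerCLM_apply, raiseCLM_apply,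
          mulXCLM_apply]
        ring
      rw [e]
      exact Submodule.add_mem _
        (Submodule.smul_mem _ _ (Submodule.subset_span ⟨_, rfl⟩))
        (Submodule.smul_mem _ _ (Submodule.subset_span ⟨_, rfl⟩))
    | zero => simp
    | add f g _ _ hf hg =>
      rw [map_add]
      exact Submodule.add_mem _ hf hg
    | smul a f _ hf =>
      rw [map_smul]
      exact Submodule.smul_mem _ _ hf
  have hpow : ∀ a : ℕ, (mulXCLM ^ a) (hermiteS 0) ∈ Submodule.span ℂ (Set.range hermiteS) := by
    intro a
    induction a with
    | zero => exact Submodule.subset_span ⟨0, by simp⟩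
    | succ a ih =>
      rw [pow_succ' mulXCLM]
      exact hX _ ih
  have hmono : ∀ a : ℕ, ∫ x : ℝ, (x : ℂ) ^ a * (hermiteS 0 x * ψ x) = 0 := fun a => by
    have := hspan _ (hpow a)
    simp_rw [mulXCLM_pow_apply, mul_assoc] at this
    exact this
  set φ : 𝓢(ℝ, ℂ) := SchwartzMap.smulLeftCLM ℂ (hermiteS 0) ψ with hφ
  have hφx : ∀ x, φ x = hermiteS 0 x * ψ x := fun x => by
    rw [hφ, SchwartzMap.smulLeftCLM_apply_apply (hermiteS 0).hasTemperateGrowth, smul_eq_mul]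
  obtain ⟨B, hB⟩ : ∃ B, ∀ x, ‖ψ x‖ ≤ B := ⟨_, SchwartzMap.norm_le_seminorm ℂ ψ⟩
  have hF : FourierTransform.fourier φ = 0 := by
    ext w
    rw [SchwartzMap.fourier_coe, Real.fourier_real_eq_integral_exp_smul]
    set A : ℝ := 2 * Real.pi * |w| with hA
    have hexpb : ∀ x : ℝ, HasSum (fun n : ℕ => (A * |x|) ^ n / n.factorial * ‖φ x‖)
        (Real.exp (A * |x|) * ‖φ x‖) := fun x => by
      refine HasSum.mul_right _ ?_
      rw [Real.exp_eq_exp_ℝ]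
      exact NormedSpace.expSeries_div_hasSum_exp _
    have hint : Integrable fun x : ℝ => Real.exp (A * |x|) * ‖φ x‖ := by
      refine ((integrable_exp_neg_mul_sq (b := 1 / 4) (by norm_num)).const_mul
        (Real.exp (A ^ 2) * (hermiteConst 0 * B))).mono' ?_ (Eventually.of_forall fun x => ?_)
      · have := φ.continuous
        exact (by fun_prop : Continuous fun x : ℝ => Real.exp (A * |x|) *
          ‖φ x‖).aestronglyMeasurable
      · rw [Real.norm_of_nonneg (by positivity), hφx, norm_mul, hermiteS_apply, Complex.norm_real,
          hermiteFun_zero_eq, Real.norm_of_nonneg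
            (mul_nonneg (hermiteConst_pos 0).le (Real.exp_pos _).le)]
        have e1 : Real.exp (A * |x|) * Real.exp (-(x ^ 2 / 2)) ≤
            Real.exp (A ^ 2) * Real.exp (-(1 / 4) * x ^ 2) := by
          rw [← Real.exp_add, ← Real.exp_add]
          refine Real.exp_le_exp.2 ?_
          nlinarith [sq_nonneg (A - |x| / 2), sq_abs x]
        have hc := (hermiteConst_pos 0).le
        calc Real.exp (A * |x|) * (hermiteConst 0 * Real.exp (-(x ^ 2 / 2)) * ‖ψ x‖)
            = (Real.exp (A * |x|) * Real.exp (-(x ^ 2 / 2))) * (hermiteConst 0 * ‖ψ x‖) := by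
              ring
          _ ≤ (Real.exp (A ^ 2) * Real.exp (-(1 / 4) * x ^ 2)) * (hermiteConst 0 * B) := by
              gcongr
              exact hB x
          _ = _ := by ring
    have hs : HasSum (fun n : ℕ => ∫ x : ℝ, (((-2 * Real.pi * x * w : ℝ) : ℂ) * Complex.I) ^ n /
        n.factorial * φ x)
        (∫ x : ℝ, Complex.exp (((-2 * Real.pi * x * w : ℝ) : ℂ) * Complex.I) • φ x) := by
      refine hasSum_integral_of_dominated_convergence
        (fun n x => (A * |x|) ^ n / n.factorial * ‖φ x‖) ?_ ?_ ?_ ?_ ?_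
      · intro n
        have := φ.continuous
        exact Continuous.aestronglyMeasurable (by fun_prop)
      · refine fun n => Eventually.of_forall fun x => le_of_eq ?_
        rw [norm_mul, norm_div, norm_pow, norm_mul, Complex.norm_I, Complex.norm_real,
          Real.norm_eq_abs, Complex.norm_natCast]
        simp only [abs_mul, abs_neg, abs_two, abs_of_pos Real.pi_pos, hA]
        ring
      · exact Eventually.of_forall fun x => (hexpb x).summable
      · exact hint.congr (Eventually.of_forall fun x => (hexpb x).tsum_eq.symm)
      · refine Eventually.of_forall fun x => HasSum.mul_right _ ?_
        rw [Complex.exp_eq_exp_ℂ]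
        exact NormedSpace.expSeries_div_hasSum_exp _
    have hz : ∀ n : ℕ, ∫ x : ℝ, (((-2 * Real.pi * x * w : ℝ) : ℂ) * Complex.I) ^ n /
        n.factorial * φ x = 0 := fun n => by
      have e : ∀ x : ℝ, (((-2 * Real.pi * x * w : ℝ) : ℂ) * Complex.I) ^ n / n.factorial * φ x =
          ((-2 * Real.pi * w * Complex.I) ^ n / n.factorial) *
            ((x : ℂ) ^ n * (hermiteS 0 x * ψ x)) := fun x => by
        rw [hφx]
        push_cast
        rw [show (-2 * (Real.pi : ℂ) * x * w * Complex.I) =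
          (-2 * Real.pi * w * Complex.I) * x by ring, mul_pow]
        ring
      simp_rw [e]
      rw [integral_const_mul, hmono, mul_zero]
    simp_rw [hz] at hs
    exact (hs.unique hasSum_zero)
  have hφ0 : φ = 0 := by
    have := FourierTransform.fourierInv_fourier_eq (F := 𝓢(ℝ, ℂ)) φ
    rw [hF] at this
    rw [← this]
    exact (FourierTransform.fourierInvCLM ℂ 𝓢(ℝ, ℂ)).map_zero
  ext x
  have h1 : φ x = 0 := by rw [hφ0]; rfl
  rw [hφx] at h1
  refine (mul_eq_zero.1 h1).resolve_left ?_
  rw [hermiteS_apply, hermiteFun_zero_eq]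
  exact_mod_cast (mul_pos (hermiteConst_pos 0) (Real.exp_pos _)).ne'

theorem dist_map_smul (u : 𝓢'(ℝ, ℂ)) (a : ℂ) (ψ : 𝓢(ℝ, ℂ)) : u (a • ψ) = a * u ψ :=
  map_smul (show 𝓢(ℝ, ℂ) →L[ℂ] ℂ from u) a ψ

theorem dist_map_sub (u : 𝓢'(ℝ, ℂ)) (φ ψ : 𝓢(ℝ, ℂ)) : u (φ - ψ) = u φ - u ψ :=
  map_sub (show 𝓢(ℝ, ℂ) →L[ℂ] ℂ from u) φ ψ

theorem dist_hasSum (u : 𝓢'(ℝ, ℂ)) {f : ℕ → 𝓢(ℝ, ℂ)} {F : 𝓢(ℝ, ℂ)} (h : HasSum f F) :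
    HasSum (fun n => u (f n)) (u F) :=
  (show 𝓢(ℝ, ℂ) →L[ℂ] ℂ from u).hasSum h

/-- The pairing with the Hermite function `h_n` as a tempered distribution. -/
theorem hermiteS_toTemperedDistribution_apply (n : ℕ) (ψ : 𝓢(ℝ, ℂ)) :
    (hermiteS n : 𝓢'(ℝ, ℂ)) ψ = hermiteCoeff n ψ := by
  refine (SchwartzMap.toTemperedDistributionCLM_apply_apply volume (hermiteS n) ψ).trans ?_
  rw [hermiteCoeff]
  refine integral_congr_ae (Eventually.of_forall fun x => ?_)
  simp only [smul_eq_mul, mul_comm]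

theorem hermiteCoeff_hermiteS (n m : ℕ) : hermiteCoeff n (hermiteS m) = if n = m then 1 else 0 :=
  integral_hermiteS_mul n m

/-- The Hermite expansion of a Schwartz function converges in the Schwartz space. -/
theorem hasSum_hermiteCoeff_smul_hermiteS (ψ : 𝓢(ℝ, ℂ)) :
    HasSum (fun n => hermiteCoeff n ψ • hermiteS n) ψ := by
  obtain ⟨F, hF⟩ := exists_hasSum_of_summable_seminorm
    (fun n => hermiteCoeff n ψ • hermiteS n) (by
      intro a b
      obtain ⟨C, m, hC, hm⟩ := exists_seminorm_hermiteS_le a b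
      obtain ⟨D, hD⟩ := exists_norm_hermiteCoeff_mul_pow_le (m + 2) ψ
      refine Summable.of_nonneg_of_le (fun n => apply_nonneg _ _) (fun n => ?_)
        (summable_inv_add_one_sq.mul_left (D * C))
      have hn : (0 : ℝ) < (n : ℝ) + 1 := by positivity
      rw [map_smul_eq_mul, ← div_eq_mul_inv, le_div_iff₀ (by positivity)]
      calc ‖hermiteCoeff n ψ‖ * SchwartzMap.seminorm ℂ a b (hermiteS n) * ((n : ℝ) + 1) ^ 2
          ≤ ‖hermiteCoeff n ψ‖ * (C * ((n : ℝ) + 1) ^ m) * ((n : ℝ) + 1) ^ 2 := by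
            gcongr
            exact hm n
        _ = (‖hermiteCoeff n ψ‖ * ((n : ℝ) + 1) ^ (m + 2)) * C := by ring
        _ ≤ D * C := mul_le_mul_of_nonneg_right (hD n) hC)
  have hc : ∀ m, hermiteCoeff m (F - ψ) = 0 := by
    intro m
    have h1 := dist_hasSum (hermiteS m : 𝓢'(ℝ, ℂ)) hF
    have h2 : ∀ n, (hermiteS m : 𝓢'(ℝ, ℂ)) (hermiteCoeff n ψ • hermiteS n) =
        if n = m then hermiteCoeff m ψ else 0 := fun n => by
      rw [dist_map_smul, hermiteS_toTemperedDistribution_apply, hermiteCoeff_hermiteS]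
      by_cases hnm : n = m
      · subst hnm; simp
      · simp [hnm, Ne.symm hnm]
    have h3 : HasSum (fun n => if n = m then hermiteCoeff m ψ else 0)
        ((hermiteS m : 𝓢'(ℝ, ℂ)) F) := by
      simpa only [h2] using h1
    have h4 := h3.unique (hasSum_ite_eq m (hermiteCoeff m ψ))
    rw [← hermiteS_toTemperedDistribution_apply, dist_map_sub, h4,
      hermiteS_toTemperedDistribution_apply, sub_self]
  have := eq_zero_of_hermiteCoeff_eq_zero hc
  rwa [sub_eq_zero.1 this] at hF

/-- The Hermite expansion of a tempered distribution. -/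
theorem hasSum_coeff_mul_hermiteCoeff (u : 𝓢'(ℝ, ℂ)) (ψ : 𝓢(ℝ, ℂ)) :
    HasSum (fun n => coeff n u * hermiteCoeff n ψ) (u ψ) := by
  have h := dist_hasSum u (hasSum_hermiteCoeff_smul_hermiteS ψ)
  convert h using 1
  exact funext fun n => ((dist_map_smul u _ _).trans (mul_comm _ _)).symm

/-- A tempered distribution is determined by its Hermite coefficients. -/
theorem ext_of_coeff {u v : 𝓢'(ℝ, ℂ)} (h : ∀ n, coeff n u = coeff n v) : u = v := by
  refine ContinuousLinearMap.ext fun ψ => ?_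
  have h1 := hasSum_coeff_mul_hermiteCoeff u ψ
  simp_rw [h] at h1
  exact h1.unique (hasSum_coeff_mul_hermiteCoeff v ψ)

/-- A Hermite series with coefficients of polynomial growth converges in the tempered
distributions: after division by a power of the eigenvalues it converges in `L²`, and this power
is restored by a power of the harmonic oscillator acting on the test function. -/
theorem summable_smul_hermiteS {c : ℕ → ℂ} {C : ℝ} {m : ℕ}
    (hc : ∀ n, ‖c n‖ ≤ C * ((n : ℝ) + 1) ^ m) :
    Summable fun n => c n • (hermiteS n : 𝓢'(ℝ, ℂ)) := by
  set d : ℕ → ℂ := fun n => c n / (2 * n + 1 : ℂ) ^ (m + 2) with hd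
  have hnorm : ∀ n : ℕ, ‖(2 * n + 1 : ℂ)‖ = 2 * n + 1 := fun n => by
    rw [show (2 * n + 1 : ℂ) = ((2 * n + 1 : ℝ) : ℂ) by push_cast; rfl, Complex.norm_real,
      Real.norm_of_nonneg (by positivity)]
  have hne : ∀ n : ℕ, (2 * n + 1 : ℂ) ≠ 0 := fun n => by
    rw [← norm_ne_zero_iff, hnorm]
    positivity
  have hC : 0 ≤ C := by simpa using (norm_nonneg _).trans (hc 0)
  have hL2 : ∀ n, ‖(hermiteS n).toLp 2‖ = 1 := fun n => by
    rw [SchwartzMap.norm_toLp' (by norm_num) (by norm_num)]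
    have e := integral_hermiteFun_mul n n
    simp only [if_true, ← sq] at e
    simp [hermiteS_apply, e]
  have hsum : Summable fun n => d n • (hermiteS n).toLp 2 := by
    refine Summable.of_norm_bounded (summable_inv_add_one_sq.mul_left C) fun n => ?_
    rw [norm_smul, hL2, mul_one, hd]
    simp only
    rw [norm_div, norm_pow, hnorm, div_le_iff₀ (by positivity)]
    have hn : (0 : ℝ) ≤ n := n.cast_nonneg
    calc ‖c n‖ ≤ C * ((n : ℝ) + 1) ^ m := hc n
      _ = C * (((n : ℝ) + 1) ^ 2)⁻¹ * ((n : ℝ) + 1) ^ (m + 2) := by field_simp; ring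
      _ ≤ C * (((n : ℝ) + 1) ^ 2)⁻¹ * (2 * (n : ℝ) + 1) ^ (m + 2) := by
        gcongr
        linarith
  have h1 := (Lp.toTemperedDistributionCLM ℂ (volume : Measure ℝ) 2).hasSum hsum.hasSum
  set D := Lp.toTemperedDistributionCLM ℂ (volume : Measure ℝ) 2
    (∑' n, d n • (hermiteS n).toLp 2 volume) with hD
  refine ⟨ContinuousLinearMap.toPointwiseConvergenceCLM _ _ _ _
    ((D : 𝓢(ℝ, ℂ) →L[ℂ] ℂ) ∘L harmonicCLM ^ (m + 2)), ?_⟩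
  rw [HasSum, PointwiseConvergenceCLM.tendsto_iff_forall_tendsto]
  intro ψ
  rw [HasSum, PointwiseConvergenceCLM.tendsto_iff_forall_tendsto] at h1
  refine (h1 ((harmonicCLM ^ (m + 2)) ψ)).congr fun s => ?_
  simp only [sum_apply]
  refine Finset.sum_congr rfl fun n _ => ?_
  rw [map_smul, Lp.toTemperedDistributionCLM_apply, Lp.toTemperedDistribution_toLp_eq,
    smul_apply, smul_apply, hermiteS_toTemperedDistribution_apply,
    hermiteS_toTemperedDistribution_apply, hermiteCoeff_harmonicCLM_pow, smul_eq_mul, smul_eq_mul,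
    hd]
  have := pow_ne_zero (m + 2) (hne n)
  field_simp

/-- The coefficients of a convergent Hermite series. -/
theorem coeff_tsum_smul_hermiteS {c : ℕ → ℂ}
    (hc : Summable fun n => c n • (hermiteS n : 𝓢'(ℝ, ℂ))) (m : ℕ) :
    coeff m (∑' n, c n • (hermiteS n : 𝓢'(ℝ, ℂ))) = c m := by
  have h1 := hc.hasSum
  rw [HasSum, PointwiseConvergenceCLM.tendsto_iff_forall_tendsto] at h1
  have h2 := h1 (hermiteS m)
  have h3 : HasSum (fun n => if n = m then c m else 0)
      (coeff m (∑' n, c n • (hermiteS n : 𝓢'(ℝ, ℂ)))) := by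
    refine h2.congr fun s => ?_
    rw [sum_apply]
    refine Finset.sum_congr rfl fun n _ => ?_
    rw [smul_apply, hermiteS_toTemperedDistribution_apply, hermiteCoeff_hermiteS]
    by_cases hnm : n = m
    · subst hnm; simp
    · simp [hnm]
  exact h3.unique (hasSum_ite_eq m (c m))

/-! ### Linear combinations of complex Gaussian variables -/

/-- The real and imaginary parts are independent with law `N(0, 1/2)`. -/
theorem stdComplexGaussian_eq_map_prod :
    stdComplexGaussian = ((gaussianReal 0 (1 / 2)).prod (gaussianReal 0 (1 / 2))).map
      Complex.measurableEquivRealProd.symm := by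
  have hv : (1 / 2 : NNReal) ≠ 0 := by norm_num
  have hmp := Complex.volume_preserving_equiv_real_prod.symm
  rw [gaussianReal_of_var_ne_zero _ hv, prod_withDensity (by fun_prop) (by fun_prop)]
  refine Measure.ext_of_lintegral _ fun f hf => ?_
  rw [lintegral_map hf (by fun_prop), lintegral_withDensity_eq_lintegral_mul _ (by fun_prop)
    (by fun_prop), stdComplexGaussian, lintegral_withDensity_eq_lintegral_mul _ (by fun_prop) hf]
  have h := hmp.lintegral_comp_emb Complex.measurableEquivRealProd.symm.measurableEmbedding
    ((fun z => ENNReal.ofReal (Real.pi⁻¹ * Real.exp (-‖z‖ ^ 2))) * f)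
  rw [← h]
  refine lintegral_congr fun p => ?_
  simp only [Pi.mul_apply]
  congr 1
  have hn : ‖Complex.measurableEquivRealProd.symm p‖ ^ 2 = p.1 ^ 2 + p.2 ^ 2 := by
    rw [← Complex.normSq_eq_norm_sq, Complex.normSq_apply]
    simp [Complex.measurableEquivRealProd_symm_apply]
    ring
  rw [hn, gaussianPDF, gaussianPDF, ← ENNReal.ofReal_mul (gaussianPDFReal_nonneg _ _ _),
    gaussianPDFReal, gaussianPDFReal]
  congr 1
  have h2 : (2 * Real.pi * ((1 / 2 : NNReal) : ℝ)) = Real.pi := by push_cast; ring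
  rw [h2]
  have h3 : Real.pi⁻¹ = (√Real.pi)⁻¹ * (√Real.pi)⁻¹ := by
    rw [← mul_inv, Real.mul_self_sqrt Real.pi_pos.le]
  rw [h3, neg_add, Real.exp_add]
  push_cast
  ring_nf

theorem hasLaw_re_stdComplexGaussian :
    HasLaw Complex.re (gaussianReal 0 (1 / 2)) stdComplexGaussian where
  aemeasurable := Complex.measurable_re.aemeasurable
  map_eq := by
    rw [stdComplexGaussian_eq_map_prod, Measure.map_map (by fun_prop) (by fun_prop)]
    have : Complex.re ∘ Complex.measurableEquivRealProd.symm = Prod.fst := by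
      ext p; simp [Complex.measurableEquivRealProd_symm_apply]
    rw [this, Measure.map_fst_prod]
    simp

theorem hasLaw_im_stdComplexGaussian :
    HasLaw Complex.im (gaussianReal 0 (1 / 2)) stdComplexGaussian where
  aemeasurable := Complex.measurable_im.aemeasurable
  map_eq := by
    rw [stdComplexGaussian_eq_map_prod, Measure.map_map (by fun_prop) (by fun_prop)]
    have : Complex.im ∘ Complex.measurableEquivRealProd.symm = Prod.snd := by
      ext p; simp [Complex.measurableEquivRealProd_symm_apply]
    rw [this, Measure.map_snd_prod]
    simp

instance : IsProbabilityMeasure stdComplexGaussian :=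
  hasLaw_re_stdComplexGaussian.isProbabilityMeasure_iff.2 inferInstance

theorem integral_stdComplexGaussian (f : ℂ → ℝ) :
    ∫ z, f z ∂stdComplexGaussian = Real.pi⁻¹ * ∫ z : ℂ, f z * Real.exp (-‖z‖ ^ 2) := by
  rw [stdComplexGaussian, integral_withDensity_eq_integral_toReal_smul (by fun_prop)
    (ae_of_all _ fun _ => ENNReal.ofReal_lt_top), ← integral_const_mul]
  refine integral_congr_ae (ae_of_all _ fun z => ?_)
  simp only [smul_eq_mul]
  rw [ENNReal.toReal_ofReal (by positivity)]
  ring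

theorem integral_norm_pow_stdComplexGaussian (k : ℕ) :
    ∫ z, ‖z‖ ^ (2 * k) ∂stdComplexGaussian = k.factorial := by
  rw [integral_stdComplexGaussian]
  have h := Complex.integral_rpow_mul_exp_neg_mul_rpow (p := 2) (q := ((2 * k : ℕ) : ℝ)) (b := 1)
    (by norm_num) (by have : (0 : ℝ) ≤ ((2 * k : ℕ) : ℝ) := by positivity
                      linarith) one_pos
  have h2 : (((2 * k : ℕ) : ℝ) + 2) / 2 = (k : ℝ) + 1 := by push_cast; ring
  rw [h2, Real.Gamma_nat_eq_factorial] at h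
  have h3 : ∫ z : ℂ, ‖z‖ ^ (2 * k) * Real.exp (-‖z‖ ^ 2) =
      2 * Real.pi / 2 * 1 ^ (-((((2 * k : ℕ) : ℝ) + 2) / 2)) * k.factorial := by
    rw [h2]
    refine Eq.trans (integral_congr_ae (ae_of_all _ fun z => ?_)) (h.trans ?_)
    · simp only [Real.rpow_natCast]
      norm_num
    · simp
  rw [h3, Real.one_rpow]
  field_simp [Real.pi_ne_zero]

theorem integrable_norm_pow_stdComplexGaussian (k : ℕ) :
    Integrable (fun z => ‖z‖ ^ (2 * k)) stdComplexGaussian := by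
  refine Integrable.of_integral_ne_zero ?_
  rw [integral_norm_pow_stdComplexGaussian]
  exact_mod_cast k.factorial_ne_zero

theorem integral_exp_neg_mul_norm_sq_stdComplexGaussian {t : ℝ} (ht : 0 ≤ t) :
    ∫ z, Real.exp (-t * ‖z‖ ^ 2) ∂stdComplexGaussian = (1 + t)⁻¹ := by
  rw [integral_stdComplexGaussian]
  have h := Complex.integral_exp_neg_mul_rpow (p := 2) (b := 1 + t) (by norm_num) (by linarith)
  have h3 : ∫ z : ℂ, Real.exp (-t * ‖z‖ ^ 2) * Real.exp (-‖z‖ ^ 2) = Real.pi * (1 + t)⁻¹ := by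
    refine Eq.trans (integral_congr_ae (ae_of_all _ fun z => ?_)) (h.trans ?_)
    · simp only [← Real.exp_add, Real.rpow_two]
      ring_nf
    · rw [neg_div, div_self two_ne_zero, Real.rpow_neg_one]
      norm_num
  rw [h3, ← mul_assoc, inv_mul_cancel₀ Real.pi_ne_zero, one_mul]

section GaussianSequence

variable {X : Type*} [MeasurableSpace X] {μ : Measure X} [IsProbabilityMeasure μ] {γ : ℕ → X → ℂ}

/-- A real linear functional that maps the standard complex Gaussian law to `N(0, 1/2)` maps a
real linear combination of independent such variables to a Gaussian of the expected variance. -/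
theorem hasLaw_sum_gaussianReal (hγ : ∀ n, HasLaw (γ n) stdComplexGaussian μ)
    (hind : iIndepFun γ μ) {L : ℂ → ℝ} (hLm : Measurable L)
    (hL : HasLaw L (gaussianReal 0 (1 / 2)) stdComplexGaussian) (b : ℕ → ℝ) (s : Finset ℕ) :
    HasLaw (fun ω => ∑ n ∈ s, b n * L (γ n ω))
      (gaussianReal 0 (Real.toNNReal ((∑ n ∈ s, b n ^ 2) / 2))) μ := by
  classical
  induction s using Finset.induction_on with
  | empty =>
    simp only [Finset.sum_empty, zero_div, Real.toNNReal_zero, gaussianReal_zero_var]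
    exact ⟨aemeasurable_const, by simp⟩
  | insert a s ha ih =>
    have h1 : HasLaw (fun ω => b a * L (γ a ω))
        (gaussianReal 0 (Real.toNNReal (b a ^ 2 / 2))) μ := by
      have := gaussianReal_const_mul (hL.fun_comp (hγ a)) (b a)
      rw [mul_zero] at this
      convert this using 2
      ext
      rw [Real.coe_toNNReal _ (by positivity)]
      push_cast
      simp
      ring
    have hi2 : iIndepFun (fun n ω => b n * L (γ n ω)) μ :=
      hind.comp (fun n z => b n * L z) fun n => by fun_prop
    have h3 := hi2.indepFun_finsetSum_of_notMem₀
      (fun n => (((hL.fun_comp (hγ n)).aemeasurable).const_mul (b n))) ha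
    have h4 : HasLaw ((fun ω => b a * L (γ a ω)) + fun ω => ∑ n ∈ s, b n * L (γ n ω))
        (gaussianReal (0 + 0)
          (Real.toNNReal (b a ^ 2 / 2) + Real.toNNReal ((∑ n ∈ s, b n ^ 2) / 2))) μ := by
      refine ⟨h1.aemeasurable.add ih.aemeasurable, ?_⟩
      refine gaussianReal_add_gaussianReal_of_indepFun ?_ h1.map_eq ih.map_eq
      refine h3.symm.congr (ae_of_all _ fun _ => rfl) (ae_of_all _ fun ω => ?_)
      simp
    rw [add_zero, ← Real.toNNReal_add (by positivity)
      (div_nonneg (Finset.sum_nonneg fun _ _ => sq_nonneg _) (by norm_num)), ← add_div,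
      ← Finset.sum_insert (f := fun n => b n ^ 2) ha] at h4
    refine h4.congr (ae_of_all _ fun ω => ?_)
    simp [Finset.sum_insert ha]

/-- A change of variables: `√2 |y|` with `y ∼ N(0, K/2)` has the law of `√K |ξ|` with
`ξ ∼ N(0, 1)`. -/
theorem lintegral_gaussianReal_abs_sqrt_two {F : ℝ → ℝ≥0∞} (hF : Measurable F) {K : ℝ}
    (hK : 0 ≤ K) :
    ∫⁻ y, F (√2 * |y|) ∂(gaussianReal 0 (Real.toNNReal (K / 2))) =
      ∫⁻ ξ, F (√K * |ξ|) ∂(gaussianReal 0 1) := by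
  have h : gaussianReal 0 (Real.toNNReal (K / 2)) =
      (gaussianReal 0 1).map (fun x => √(K / 2) * x) := by
    rw [gaussianReal_map_const_mul, mul_zero, mul_one]
    congr 1
    ext
    rw [Real.coe_toNNReal _ (by positivity)]
    exact (Real.sq_sqrt (by positivity)).symm
  rw [h, lintegral_map (by fun_prop) (by fun_prop)]
  refine lintegral_congr fun ξ => ?_
  rw [abs_mul, abs_of_nonneg (Real.sqrt_nonneg _), ← mul_assoc, ← Real.sqrt_mul (by norm_num)]
  congr 4
  ring

/-- Domination of a radial functional of the Gaussian variable `∑ b_n γ_n` by that of a real one: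
`|z| ≤ √2 max(|re z|, |im z|)`. -/
theorem lintegral_norm_sum_le (hγ : ∀ n, HasLaw (γ n) stdComplexGaussian μ)
    (hind : iIndepFun γ μ) (b : ℕ → ℝ) (s : Finset ℕ) {F : ℝ → ℝ≥0∞} (hF : Measurable F)
    (hmono : MonotoneOn F (Set.Ici 0)) :
    ∫⁻ ω, F ‖∑ n ∈ s, (b n : ℂ) * γ n ω‖ ∂μ ≤
      2 * ∫⁻ ξ, F (√(∑ n ∈ s, b n ^ 2) * |ξ|) ∂(gaussianReal 0 1) := by
  have hre := hasLaw_sum_gaussianReal hγ hind Complex.measurable_re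
    hasLaw_re_stdComplexGaussian b s
  have him := hasLaw_sum_gaussianReal hγ hind Complex.measurable_im
    hasLaw_im_stdComplexGaussian b s
  have hK : 0 ≤ ∑ n ∈ s, b n ^ 2 := Finset.sum_nonneg fun _ _ => sq_nonneg _
  have hm : Measurable fun y : ℝ => F (√2 * |y|) := by fun_prop
  have e1 := hre.lintegral_comp (f := fun y => F (√2 * |y|)) hm.aemeasurable
  have e2 := him.lintegral_comp (f := fun y => F (√2 * |y|)) hm.aemeasurable
  rw [lintegral_gaussianReal_abs_sqrt_two hF hK] at e1 e2
  refine le_trans ?_ ((lintegral_add_left' (hm.comp_aemeasurable hre.aemeasurable)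
    (fun ω => F (√2 * |∑ n ∈ s, b n * (γ n ω).im|))).trans (by rw [two_mul, e2, ← e1]; rfl)).le
  refine lintegral_mono fun ω => ?_
  set z := ∑ n ∈ s, (b n : ℂ) * γ n ω with hz
  have hzr : ∑ n ∈ s, b n * (γ n ω).re = z.re := by simp [hz]
  have hzi : ∑ n ∈ s, b n * (γ n ω).im = z.im := by simp [hz]
  simp only [Function.comp_apply, hzr, hzi]
  have hn := Complex.norm_le_sqrt_two_mul_max z
  rcases le_total |z.re| |z.im| with h | h
  · rw [max_eq_right h] at hn
    exact (hmono (norm_nonneg _) (Set.mem_Ici.2 (by positivity)) hn).trans le_add_self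
  · rw [max_eq_left h] at hn
    exact (hmono (norm_nonneg _) (Set.mem_Ici.2 (by positivity)) hn).trans le_self_add

end GaussianSequence

/-- The constant `2 𝔼 e^{ξ²/4}`, `ξ ∼ N(0, 1)`: the moments below are all estimated through the
pointwise domination of the integrand by a multiple of `e^{ξ²/4}`. -/
def gaussConst : ℝ≥0∞ := 2 * ∫⁻ ξ, ENNReal.ofReal (Real.exp (ξ ^ 2 / 4)) ∂(gaussianReal 0 1)

theorem gaussConst_ne_top : gaussConst ≠ ∞ := by
  refine ENNReal.mul_ne_top (by norm_num) ?_
  rw [gaussianReal_of_var_ne_zero _ one_ne_zero,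
    lintegral_withDensity_eq_lintegral_mul _ (by fun_prop) (by fun_prop)]
  have hi : Integrable (fun ξ : ℝ => (√(2 * Real.pi))⁻¹ * Real.exp (-(1 / 4) * ξ ^ 2)) :=
    (integrable_exp_neg_mul_sq (by norm_num)).const_mul _
  refine ne_of_lt (lt_of_eq_of_lt (lintegral_congr fun ξ => ?_) hi.lintegral_lt_top)
  rw [Pi.mul_apply, gaussianPDF, ← ENNReal.ofReal_mul (gaussianPDFReal_nonneg _ _ _),
    gaussianPDFReal, mul_assoc, ← Real.exp_add]
  congr 3
  · simp
  · simp
    ring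

theorem pow_two_mul_le_mul_exp (m : ℕ) (ξ : ℝ) :
    |ξ| ^ (2 * m) ≤ (4 * m) ^ m * Real.exp (ξ ^ 2 / 4) := by
  have h := Real.pow_div_factorial_le_exp (ξ ^ 2 / 4) (by positivity) m
  rw [div_pow, div_div, div_le_iff₀ (by positivity)] at h
  rw [pow_mul, sq_abs, mul_pow]
  have hf : ((m.factorial : ℕ) : ℝ) ≤ (m : ℝ) ^ m := by exact_mod_cast Nat.factorial_le_pow m
  calc (ξ ^ 2) ^ m ≤ Real.exp (ξ ^ 2 / 4) * (4 ^ m * m.factorial) := h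
    _ ≤ Real.exp (ξ ^ 2 / 4) * (4 ^ m * (m : ℝ) ^ m) := by gcongr
    _ = _ := by ring

section GaussianSequence

variable {X : Type*} [MeasurableSpace X] {μ : Measure X} [IsProbabilityMeasure μ] {γ : ℕ → X → ℂ}

theorem lintegral_norm_sum_le_gaussConst (hγ : ∀ n, HasLaw (γ n) stdComplexGaussian μ)
    (hind : iIndepFun γ μ) (b : ℕ → ℝ) (s : Finset ℕ) {f : ℝ → ℝ} (hf : Measurable f)
    (hmono : MonotoneOn f (Set.Ici 0)) {A : ℝ}
    (hA : ∀ ξ, f (√(∑ n ∈ s, b n ^ 2) * |ξ|) ≤ A * Real.exp (ξ ^ 2 / 4)) :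
    ∫⁻ ω, ENNReal.ofReal (f ‖∑ n ∈ s, (b n : ℂ) * γ n ω‖) ∂μ ≤
      ENNReal.ofReal A * gaussConst := by
  refine (lintegral_norm_sum_le hγ hind b s (F := fun y => ENNReal.ofReal (f y)) (by fun_prop)
    fun x hx y hy hxy => ENNReal.ofReal_le_ofReal (hmono hx hy hxy)).trans ?_
  rw [gaussConst, mul_left_comm]
  refine mul_le_mul' le_rfl ?_
  rw [← lintegral_const_mul _ (by fun_prop)]
  refine lintegral_mono fun ξ => ?_
  rw [← ENNReal.ofReal_mul' (by positivity)]
  exact ENNReal.ofReal_le_ofReal (hA ξ)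

theorem lintegral_norm_sum_pow_two_mul_le (hγ : ∀ n, HasLaw (γ n) stdComplexGaussian μ)
    (hind : iIndepFun γ μ) (b : ℕ → ℝ) (s : Finset ℕ) (m : ℕ) :
    ∫⁻ ω, ENNReal.ofReal (‖∑ n ∈ s, (b n : ℂ) * γ n ω‖ ^ (2 * m)) ∂μ ≤
      ENNReal.ofReal ((4 * m * ∑ n ∈ s, b n ^ 2) ^ m) * gaussConst := by
  refine lintegral_norm_sum_le_gaussConst hγ hind b s (f := fun y => y ^ (2 * m)) (by fun_prop)
    (fun x hx y _ hxy => pow_le_pow_left₀ hx hxy _) fun ξ => ?_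
  have hK : 0 ≤ ∑ n ∈ s, b n ^ 2 := Finset.sum_nonneg fun _ _ => sq_nonneg _
  rw [mul_pow, pow_mul, Real.sq_sqrt hK, mul_pow (4 * (m : ℝ))]
  have := mul_le_mul_of_nonneg_left (pow_two_mul_le_mul_exp m ξ) (pow_nonneg hK m)
  linarith

theorem lintegral_norm_sum_pow_le (hγ : ∀ n, HasLaw (γ n) stdComplexGaussian μ)
    (hind : iIndepFun γ μ) (b : ℕ → ℝ) (s : Finset ℕ) (q : ℕ) :
    ∫⁻ ω, ENNReal.ofReal (‖∑ n ∈ s, (b n : ℂ) * γ n ω‖ ^ q) ∂μ ≤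
      ENNReal.ofReal ((1 + (4 * q) ^ q) * √(∑ n ∈ s, b n ^ 2) ^ q) * gaussConst := by
  refine lintegral_norm_sum_le_gaussConst hγ hind b s (f := fun y => y ^ q) (by fun_prop)
    (fun x hx y _ hxy => pow_le_pow_left₀ hx hxy _) fun ξ => ?_
  have h1 : |ξ| ^ q ≤ (1 + (4 * q) ^ q) * Real.exp (ξ ^ 2 / 4) := by
    have h2 := pow_two_mul_le_mul_exp q ξ
    have h3 : |ξ| ^ q ≤ 1 + |ξ| ^ (2 * q) := by
      rw [mul_comm 2 q, pow_mul]
      nlinarith [sq_nonneg (|ξ| ^ q - 1), sq_nonneg (|ξ| ^ q)]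
    have h4 : (1 : ℝ) ≤ Real.exp (ξ ^ 2 / 4) := Real.one_le_exp (by positivity)
    linarith
  rw [mul_pow]
  have := mul_le_mul_of_nonneg_left h1 (pow_nonneg (Real.sqrt_nonneg (∑ n ∈ s, b n ^ 2)) q)
  linarith

theorem lintegral_norm_sum_pow_four_mul_exp_le (hγ : ∀ n, HasLaw (γ n) stdComplexGaussian μ)
    (hind : iIndepFun γ μ) (b : ℕ → ℝ) (s : Finset ℕ) {t : ℝ} (ht : 0 ≤ t)
    (htK : t * ∑ n ∈ s, b n ^ 2 ≤ 1 / 8) :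
    ∫⁻ ω, ENNReal.ofReal (‖∑ n ∈ s, (b n : ℂ) * γ n ω‖ ^ 4 *
        Real.exp (t * ‖∑ n ∈ s, (b n : ℂ) * γ n ω‖ ^ 2)) ∂μ ≤
      ENNReal.ofReal (128 * (∑ n ∈ s, b n ^ 2) ^ 2) * gaussConst := by
  refine lintegral_norm_sum_le_gaussConst hγ hind b s
    (f := fun y => y ^ 4 * Real.exp (t * y ^ 2)) (by fun_prop) ?_ fun ξ => ?_
  · intro x hx y _ hxy
    have hx' : 0 ≤ x := hx
    dsimp only
    gcongr
  · have hK : 0 ≤ ∑ n ∈ s, b n ^ 2 := Finset.sum_nonneg fun _ _ => sq_nonneg _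
    set K := ∑ n ∈ s, b n ^ 2
    have h := Real.pow_div_factorial_le_exp (ξ ^ 2 / 8) (by positivity) 2
    have h1 : ξ ^ 4 ≤ 128 * Real.exp (ξ ^ 2 / 8) := by
      norm_num [Nat.factorial] at h
      linarith [h, (by ring : (ξ ^ 2 / 8) ^ 2 / 2 = ξ ^ 4 / 128)]
    have h2 : Real.exp (t * (√K * |ξ|) ^ 2) ≤ Real.exp (ξ ^ 2 / 8) := by
      refine Real.exp_le_exp.2 ?_
      rw [mul_pow, Real.sq_sqrt hK, sq_abs]
      nlinarith [sq_nonneg ξ]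
    have h3 : (√K * |ξ|) ^ 4 = K ^ 2 * ξ ^ 4 := by
      rw [mul_pow, show √K ^ 4 = (√K ^ 2) ^ 2 by ring, Real.sq_sqrt hK,
        show |ξ| ^ 4 = (|ξ| ^ 2) ^ 2 by ring, sq_abs]
      ring
    have h4 : Real.exp (ξ ^ 2 / 4) = Real.exp (ξ ^ 2 / 8) * Real.exp (ξ ^ 2 / 8) := by
      rw [← Real.exp_add]
      ring_nf
    rw [h3, h4]
    calc K ^ 2 * ξ ^ 4 * Real.exp (t * (√K * |ξ|) ^ 2)
        ≤ K ^ 2 * (128 * Real.exp (ξ ^ 2 / 8)) * Real.exp (ξ ^ 2 / 8) := by gcongr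
      _ = _ := by ring

/-! ### Sums of squares of Gaussian variables -/

theorem exp_mul_inv_one_add_le {t : ℝ} (ht : 0 ≤ t) :
    Real.exp t * (1 + t)⁻¹ ≤ Real.exp (t ^ 2 / 2) := by
  have h1 : t - t ^ 2 / 2 ≤ Real.log (1 + t) := by
    refine le_trans ?_ (Real.le_log_one_add_of_nonneg ht)
    rw [le_div_iff₀ (by linarith)]
    nlinarith [pow_nonneg ht 3]
  have h2 := Real.exp_le_exp.2 h1
  rw [Real.exp_log (by linarith), Real.exp_sub, div_le_iff₀ (Real.exp_pos _)] at h2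
  rw [← div_eq_mul_inv, div_le_iff₀ (by linarith)]
  linarith

/-- Chernoff's bound for the lower tail of a sum of squares. -/
theorem measureReal_one_le_sum_one_sub_le (hγ : ∀ n, HasLaw (γ n) stdComplexGaussian μ)
    (hind : iIndepFun γ μ) {a : ℕ → ℝ} (ha : ∀ n, 0 ≤ a n) (s : Finset ℕ) {t : ℝ}
    (ht : 0 ≤ t) :
    μ.real {ω | 1 ≤ ∑ n ∈ s, a n * (1 - ‖γ n ω‖ ^ 2)} ≤
      Real.exp (-t + t ^ 2 / 2 * ∑ n ∈ s, a n ^ 2) := by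
  have hm : ∀ n, AEMeasurable (fun ω => a n * (1 - ‖γ n ω‖ ^ 2)) μ := fun n =>
    ((((hγ n).aemeasurable.norm.pow_const 2).const_sub 1).const_mul (a n))
  have hi : iIndepFun (fun n ω => a n * (1 - ‖γ n ω‖ ^ 2)) μ :=
    hind.comp (fun n z => a n * (1 - ‖z‖ ^ 2)) fun n => by fun_prop
  have hbd : ∀ n ω, a n * (1 - ‖γ n ω‖ ^ 2) ≤ a n := fun n ω => by
    nlinarith [ha n, mul_nonneg (ha n) (sq_nonneg ‖γ n ω‖)]
  have hint : Integrable (fun ω => Real.exp (t * ∑ n ∈ s, a n * (1 - ‖γ n ω‖ ^ 2))) μ := by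
    refine Integrable.of_bound (Real.measurable_exp.comp_aemeasurable
      ((Finset.aemeasurable_fun_sum s fun n _ => hm n).const_mul t)).aestronglyMeasurable
      (Real.exp (t * ∑ n ∈ s, a n)) (ae_of_all _ fun ω => ?_)
    rw [Real.norm_of_nonneg (Real.exp_pos _).le]
    exact Real.exp_le_exp.2 (mul_le_mul_of_nonneg_left (Finset.sum_le_sum fun n _ => hbd n ω) ht)
  have h1 := measure_ge_le_exp_mul_mgf (X := fun ω => ∑ n ∈ s, a n * (1 - ‖γ n ω‖ ^ 2)) 1 ht hint
  have h2 : mgf (fun ω => ∑ n ∈ s, a n * (1 - ‖γ n ω‖ ^ 2)) μ t =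
      ∏ n ∈ s, mgf (fun ω => a n * (1 - ‖γ n ω‖ ^ 2)) μ t := by
    have := hi.mgf_sum₀ (t := t) hm s
    rw [← this]
    congr 1
    ext ω
    simp
  have h3 : ∀ n, mgf (fun ω => a n * (1 - ‖γ n ω‖ ^ 2)) μ t ≤
      Real.exp (t ^ 2 / 2 * a n ^ 2) := fun n => by
    have e1 : ∀ ω, Real.exp (t * (a n * (1 - ‖γ n ω‖ ^ 2))) =
        Real.exp (t * a n) * Real.exp (-(t * a n) * ‖γ n ω‖ ^ 2) := fun ω => by
      rw [← Real.exp_add]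
      ring_nf
    have e2 := (hγ n).integral_comp (f := fun z => Real.exp (-(t * a n) * ‖z‖ ^ 2))
      (by fun_prop)
    simp only [Function.comp_def] at e2
    rw [mgf]
    simp only [e1]
    rw [integral_const_mul, e2,
      integral_exp_neg_mul_norm_sq_stdComplexGaussian (mul_nonneg ht (ha n))]
    refine (exp_mul_inv_one_add_le (mul_nonneg ht (ha n))).trans (le_of_eq ?_)
    ring_nf
  refine h1.trans ?_
  rw [h2, mul_one, Real.exp_add, Finset.mul_sum, Real.exp_sum]
  gcongr with n hn
  · exact fun n _ => mgf_nonneg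
  · exact h3 n

theorem memLp_two_norm_sq_sub_one {ν : Measure X} (hγ : ∀ n, HasLaw (γ n) stdComplexGaussian ν)
    (a : ℝ) (n : ℕ) : MemLp (fun ω => a * (‖γ n ω‖ ^ 2 - 1)) 2 ν := by
  have hm : MemLp (fun z : ℂ => ‖z‖ ^ 2) 2 stdComplexGaussian := by
    rw [memLp_two_iff_integrable_sq (by fun_prop)]
    simpa [← pow_mul] using integrable_norm_pow_stdComplexGaussian 2
  have h2 : MemLp (fun z : ℂ => a * (‖z‖ ^ 2 - 1)) 2 stdComplexGaussian :=
    (hm.sub (memLp_const 1)).const_mul a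
  rw [← (hγ n).map_eq] at h2
  exact h2.comp_of_map (hγ n).aemeasurable

/-- The variance of a sum of independent centred squares, `|γ_n|²` being an exponential variable of
variance `1`. -/
theorem integral_sum_norm_sq_sub_one_sq (hγ : ∀ n, HasLaw (γ n) stdComplexGaussian μ)
    (hind : iIndepFun γ μ) (a : ℕ → ℝ) (s : Finset ℕ) :
    ∫ ω, (∑ n ∈ s, a n * (‖γ n ω‖ ^ 2 - 1)) ^ 2 ∂μ = ∑ n ∈ s, a n ^ 2 := by
  have hI : ∀ k : ℕ, Integrable (fun z : ℂ => ‖z‖ ^ (2 * k)) stdComplexGaussian :=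
    integrable_norm_pow_stdComplexGaussian
  have hI1 : Integrable (fun z : ℂ => ‖z‖ ^ 2) stdComplexGaussian := by simpa using hI 1
  have hI2 : Integrable (fun z : ℂ => ‖z‖ ^ 4) stdComplexGaussian := by simpa using hI 2
  have h1 : ∫ z, ‖z‖ ^ 2 ∂stdComplexGaussian = 1 := by
    simpa using integral_norm_pow_stdComplexGaussian 1
  have h2 : ∫ z, ‖z‖ ^ 4 ∂stdComplexGaussian = 2 := by
    simpa using integral_norm_pow_stdComplexGaussian 2
  have hmean : ∀ n, ∫ ω, a n * (‖γ n ω‖ ^ 2 - 1) ∂μ = 0 := fun n => by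
    have e := (hγ n).integral_comp (f := fun z => a n * (‖z‖ ^ 2 - 1)) (by fun_prop)
    simp only [Function.comp_def] at e
    rw [e, integral_const_mul, integral_sub hI1 (integrable_const _), h1]
    simp
  have hvar : ∀ n, ∫ ω, (a n * (‖γ n ω‖ ^ 2 - 1)) ^ 2 ∂μ = a n ^ 2 := fun n => by
    have e := (hγ n).integral_comp (f := fun z => (a n * (‖z‖ ^ 2 - 1)) ^ 2) (by fun_prop)
    simp only [Function.comp_def] at e
    have e2 : ∀ z : ℂ, (a n * (‖z‖ ^ 2 - 1)) ^ 2 = a n ^ 2 * (‖z‖ ^ 4 - 2 * ‖z‖ ^ 2 + 1) :=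
      fun z => by ring
    rw [e]
    simp only [e2]
    rw [integral_const_mul, integral_add (f := fun z : ℂ => ‖z‖ ^ 4 - 2 * ‖z‖ ^ 2)
      (hI2.sub (hI1.const_mul 2)) (integrable_const _),
      integral_sub hI2 (hI1.const_mul 2), integral_const_mul, h1, h2]
    simp
  have hL := fun n => memLp_two_norm_sq_sub_one hγ (a n) n
  have hi : iIndepFun (fun n ω => a n * (‖γ n ω‖ ^ 2 - 1)) μ :=
    hind.comp (fun n z => a n * (‖z‖ ^ 2 - 1)) fun n => by fun_prop
  have hv := IndepFun.variance_sum (μ := μ) (s := s) (fun n _ => hL n)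
    fun i _ j _ hij => hi.indepFun hij
  have hsum : (∑ n ∈ s, fun ω => a n * (‖γ n ω‖ ^ 2 - 1)) =
      fun ω => ∑ n ∈ s, a n * (‖γ n ω‖ ^ 2 - 1) := by
    ext ω
    simp
  rw [hsum, variance_of_integral_eq_zero
    (Finset.aemeasurable_fun_sum s fun n _ => (hL n).aestronglyMeasurable.aemeasurable)] at hv
  · rw [hv]
    refine Finset.sum_congr rfl fun n _ => ?_
    rw [variance_of_integral_eq_zero (hL n).aestronglyMeasurable.aemeasurable (hmean n), hvar]
  · rw [integral_finsetSum _ fun n _ => (hL n).integrable one_le_two]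
    exact Finset.sum_eq_zero fun n _ => hmean n

end GaussianSequence

/-! ### Measurability in the Sobolev spaces -/

theorem HSob.ext_toDist {s : ℝ} {u v : HSob s} (h : u.toDist = v.toDist) : u = v := Subtype.ext h

theorem HSob.coeff_add {s : ℝ} (n : ℕ) (u v : HSob s) :
    coeff n (u + v).toDist = coeff n u.toDist + coeff n v.toDist := rfl

theorem HSob.toEll2_apply {s : ℝ} (u : HSob s) (n : ℕ) :
    HSob.toEll2 s u n = ((freq n ^ s : ℝ) : ℂ) * coeff n u.toDist := rfl

theorem HSob.isometry_toEll2 (s : ℝ) : Isometry (HSob.toEll2 s) :=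
  AddMonoidHomClass.isometry_of_norm _ fun _ => rfl

theorem freq_rpow_ne_zero (n : ℕ) (s : ℝ) : ((freq n ^ s : ℝ) : ℂ) ≠ 0 :=
  Complex.ofReal_ne_zero.2 (Real.rpow_pos_of_pos (freq_pos n) s).ne'

theorem HSob.continuous_coeff {s : ℝ} (n : ℕ) :
    Continuous fun u : HSob s => coeff n u.toDist := by
  have h1 : Continuous fun u : HSob s => HSob.toEll2 s u n :=
    (continuous_apply n).comp
      ((lp.uniformContinuous_coe (E := fun _ : ℕ => ℂ) (p := 2)).continuous.comp
        (HSob.isometry_toEll2 s).continuous)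
  have h2 : (fun u : HSob s => coeff n u.toDist) =
      fun u => ((freq n ^ s : ℝ) : ℂ)⁻¹ * HSob.toEll2 s u n := by
    funext u
    rw [HSob.toEll2_apply, inv_mul_cancel_left₀ (freq_rpow_ne_zero n s)]
  rw [h2]
  exact continuous_const.mul h1

theorem HSob.measurable_coeff {s : ℝ} (n : ℕ) :
    Measurable fun u : HSob s => coeff n u.toDist := (HSob.continuous_coeff n).measurable

theorem coeff_hermiteS (m n : ℕ) :
    coeff m (hermiteS n : 𝓢'(ℝ, ℂ)) = if n = m then 1 else 0 :=
  (hermiteS_toTemperedDistribution_apply n (hermiteS m)).trans (hermiteCoeff_hermiteS n m)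

theorem weightedCoeff_hermiteS (s : ℝ) (n : ℕ) :
    weightedCoeff s (hermiteS n : 𝓢'(ℝ, ℂ)) =
      Pi.single (M := fun _ : ℕ => ℂ) n ((freq n ^ s : ℝ) : ℂ) := by
  funext m
  rw [weightedCoeff, coeff_hermiteS, Pi.single_apply]
  rcases eq_or_ne n m with rfl | h
  · simp
  · simp [h, h.symm]

/-- The Hermite function `h_n` as an element of `𝓗^s`. -/
def HSob.basis (s : ℝ) (n : ℕ) : HSob s :=
  ⟨hermiteS n, by
    change Memℓp (weightedCoeff s _) 2
    rw [weightedCoeff_hermiteS]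
    exact (lp.single (E := fun _ : ℕ => ℂ) 2 n ((freq n ^ s : ℝ) : ℂ)).2⟩

theorem HSob.toEll2_smul_basis (s : ℝ) (n : ℕ) (a : ℂ) :
    HSob.toEll2 s (a • HSob.basis s n) =
      lp.single (E := fun _ : ℕ => ℂ) 2 n (((freq n ^ s : ℝ) : ℂ) * a) := by
  rw [map_smul]
  ext m
  change a * weightedCoeff s (hermiteS n : 𝓢'(ℝ, ℂ)) m = _
  rw [weightedCoeff_hermiteS, lp.single_apply]
  rcases eq_or_ne m n with rfl | h
  · simp [mul_comm]
  · simp [h]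

theorem HSob.tendsto_sum_coeff_smul_basis {s : ℝ} (u : HSob s) :
    Tendsto (fun N => ∑ n ∈ Finset.range N, coeff n u.toDist • HSob.basis s n) atTop (𝓝 u) := by
  rw [(HSob.isometry_toEll2 s).isUniformInducing.isInducing.tendsto_nhds_iff]
  have h := (lp.hasSum_single (p := 2) (by norm_num) (HSob.toEll2 s u)).tendsto_sum_nat
  refine h.congr fun N => ?_
  rw [Function.comp_apply, map_sum]
  refine Finset.sum_congr rfl fun n _ => ?_
  rw [HSob.toEll2_smul_basis, HSob.toEll2_apply]

/-- The Borel `σ`-algebra of `𝓗^s` is generated by the coefficients. -/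
theorem HSob.measurable_of_coeff {α : Type*} [MeasurableSpace α] {s : ℝ} {f : α → HSob s}
    (hf : ∀ n, Measurable fun a => coeff n (f a).toDist) : Measurable f := by
  refine measurable_of_tendsto_metrizable
    (f := fun N a => ∑ n ∈ Finset.range N, coeff n (f a).toDist • HSob.basis s n) (fun N => ?_)
    (tendsto_pi_nhds.2 fun a => HSob.tendsto_sum_coeff_smul_basis (f a))
  have hc : Continuous fun c : ℕ → ℂ => ∑ n ∈ Finset.range N, c n • HSob.basis s n := by
    refine continuous_finsetSum _ fun n _ => ?_
    have h1 : Continuous fun z : ℂ => z • HSob.basis s n := by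
      rw [(HSob.isometry_toEll2 s).isUniformInducing.isInducing.continuous_iff]
      have : (HSob.toEll2 s ∘ fun z : ℂ => z • HSob.basis s n) =
          fun z => z • HSob.toEll2 s (HSob.basis s n) := by
        funext z
        simp
      rw [this]
      exact continuous_id.smul continuous_const
    exact h1.comp (continuous_apply n)
  exact hc.measurable.comp (measurable_pi_lambda _ hf)

/-- Measurability of the addition for the product `σ`-algebra, checked on the coefficients, so that
no second countability is needed. -/
theorem HSob.measurable_add {s : ℝ} : Measurable fun p : HSob s × HSob s => p.1 + p.2 :=
  HSob.measurable_of_coeff fun n =>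
    ((HSob.measurable_coeff n).comp measurable_fst).add
      ((HSob.measurable_coeff n).comp measurable_snd)

theorem toDist_ofCoeffs_of_mem {s : ℝ} {c : ℕ → ℂ}
    (h : (∑' n, c n • (hermiteS n : 𝓢'(ℝ, ℂ))) ∈ sobolevSubmodule s) :
    (ofCoeffs s c).toDist = ∑' n, c n • (hermiteS n : 𝓢'(ℝ, ℂ)) :=
  congrArg HSob.toDist (dif_pos h)

theorem ofCoeffs_of_notMem {s : ℝ} {c : ℕ → ℂ}
    (h : (∑' n, c n • (hermiteS n : 𝓢'(ℝ, ℂ))) ∉ sobolevSubmodule s) :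
    ofCoeffs s c = 0 := dif_neg h

open scoped Classical in
/-- If the weighted coefficients are not square summable then either the series diverges in the
tempered distributions, and its sum is the junk value `0`, or its sum is not in `𝓗^s`; in both cases
`ofCoeffs` returns `0`. -/
theorem coeff_ofCoeffs (s : ℝ) (c : ℕ → ℂ) (n : ℕ) :
    coeff n (ofCoeffs s c).toDist =
      if Memℓp (fun m => ((freq m ^ s : ℝ) : ℂ) * c m) 2 then c n else 0 := by
  have h0 : coeff n (0 : HSob s).toDist = 0 := rfl
  by_cases hs : Summable fun n => c n • (hermiteS n : 𝓢'(ℝ, ℂ))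
  · have hw : weightedCoeff s (∑' n, c n • (hermiteS n : 𝓢'(ℝ, ℂ))) =
        fun m => ((freq m ^ s : ℝ) : ℂ) * c m := by
      funext m
      rw [weightedCoeff, coeff_tsum_smul_hermiteS hs]
    have hmem : (∑' n, c n • (hermiteS n : 𝓢'(ℝ, ℂ))) ∈ sobolevSubmodule s ↔
        Memℓp (fun m => ((freq m ^ s : ℝ) : ℂ) * c m) 2 := by
      rw [← hw]
      rfl
    by_cases hM : Memℓp (fun m => ((freq m ^ s : ℝ) : ℂ) * c m) 2
    · rw [if_pos hM, toDist_ofCoeffs_of_mem (hmem.2 hM)]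
      exact coeff_tsum_smul_hermiteS hs n
    · rw [if_neg hM, ofCoeffs_of_notMem (mt hmem.1 hM)]
      exact h0
  · have ht := tsum_eq_zero_of_not_summable hs
    have hz : ofCoeffs s c = 0 := by
      refine HSob.ext_toDist ((toDist_ofCoeffs_of_mem ?_).trans ht)
      rw [ht]
      exact Submodule.zero_mem _
    rw [hz, h0, if_neg]
    -- square summable weighted coefficients grow polynomially, so that the series would converge
    intro hM
    refine hs ?_
    obtain ⟨m, hm⟩ := exists_nat_ge |s|
    set B := ‖(⟨_, hM⟩ : lp (fun _ : ℕ => ℂ) 2)‖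
    refine summable_smul_hermiteS (C := B * 2 ^ m) (m := m) fun n => ?_
    have h1 : ‖((freq n ^ s : ℝ) : ℂ) * c n‖ ≤ B :=
      lp.norm_apply_le_norm (by norm_num) (⟨_, hM⟩ : lp (fun _ : ℕ => ℂ) 2) n
    have hpos := Real.rpow_pos_of_pos (freq_pos n) s
    rw [norm_mul, Complex.norm_real, Real.norm_of_nonneg hpos.le] at h1
    have hf1 : 1 ≤ freq n := Real.one_le_sqrt.2 (by
      have : (0 : ℝ) ≤ n := n.cast_nonneg
      linarith)
    have hf2 : freq n ≤ 2 * (n + 1) := by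
      rw [freq, Real.sqrt_le_iff]
      have : (0 : ℝ) ≤ n := n.cast_nonneg
      constructor <;> nlinarith
    have h2 : (freq n ^ s)⁻¹ ≤ 2 ^ m * ((n : ℝ) + 1) ^ m := by
      rw [← Real.rpow_neg (freq_pos n).le, ← mul_pow]
      calc freq n ^ (-s) ≤ freq n ^ (m : ℝ) :=
            Real.rpow_le_rpow_of_exponent_le hf1 ((neg_le_abs s).trans hm)
        _ = freq n ^ m := Real.rpow_natCast _ _
        _ ≤ _ := by gcongr
    calc ‖c n‖ = (freq n ^ s * ‖c n‖) * (freq n ^ s)⁻¹ := by field_simp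
      _ ≤ B * (2 ^ m * ((n : ℝ) + 1) ^ m) := by gcongr
      _ = _ := by ring

/-- Random Hermite series are measurable, including where they take the default value `0`. -/
theorem measurable_ofCoeffs {α : Type*} [MeasurableSpace α] (s : ℝ) {c : α → ℕ → ℂ}
    (hc : ∀ n, Measurable fun a => c a n) : Measurable fun a => ofCoeffs s (c a) := by
  classical
  refine HSob.measurable_of_coeff fun n => ?_
  simp only [coeff_ofCoeffs]
  refine Measurable.ite ?_ (hc n) measurable_const
  have : {a | Memℓp (fun m => ((freq m ^ s : ℝ) : ℂ) * c a m) 2} =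
      {a | ∑' m, ((‖((freq m ^ s : ℝ) : ℂ) * c a m‖₊ ^ 2 : NNReal) : ℝ≥0∞) < ∞} := by
    ext a
    rw [Set.mem_ofPred_eq, Set.mem_ofPred_eq, memℓp_gen_iff (by norm_num), lt_top_iff_ne_top,
      ENNReal.tsum_coe_ne_top_iff_summable, ← NNReal.summable_coe]
    simp
  rw [this]
  exact measurableSet_lt (Measurable.tsum fun m => by fun_prop) measurable_const

/-! ### The Gaussian measure on the Sobolev space -/

theorem summable_freq_rpow_mul_coeffVar {σ : ℝ} (hσ : 0 < σ) :
    Summable fun n => freq n ^ (2 * -σ) * coeffVar n := by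
  have h1 : Summable fun n : ℕ => 2 * (((n + 1 : ℕ) : ℝ) ^ (-1 - σ)) :=
    (((Real.summable_nat_rpow (p := -1 - σ)).2 (by linarith)).comp_injective
      (add_left_injective 1)).mul_left 2
  refine Summable.of_nonneg_of_le (fun n => mul_nonneg (Real.rpow_nonneg (freq_pos n).le _)
    (coeffVar_pos n).le) (fun n => ?_) h1
  have hn : (0 : ℝ) ≤ n := n.cast_nonneg
  have h2 : freq n ^ (2 * -σ) = (2 * (n : ℝ) + 1) ^ (-σ) := by
    rw [Real.rpow_mul (freq_pos n).le, Real.rpow_two, freq_sq]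
  have h3 : (2 * (n : ℝ) + 1) ^ (-σ) ≤ ((n : ℝ) + 1) ^ (-σ) :=
    Real.rpow_le_rpow_of_nonpos (by linarith) (by linarith) (by linarith)
  rw [h2]
  calc (2 * (n : ℝ) + 1) ^ (-σ) * coeffVar n ≤ ((n : ℝ) + 1) ^ (-σ) * (2 / ((n : ℝ) + 1)) := by
        exact mul_le_mul h3 (coeffVar_le n) (coeffVar_pos n).le (by positivity)
    _ = 2 * (((n + 1 : ℕ) : ℝ) ^ (-1 - σ)) := by
        push_cast
        rw [show -1 - σ = -σ - 1 by ring, Real.rpow_sub_one (by positivity)]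
        ring

section Law

variable {Ω : Type*} [MeasurableSpace Ω] {P : Measure Ω} {g : ℕ → Ω → ℂ} {σ : ℝ}

/-- The random series converges almost surely in `𝓗^{-σ}`, since the expectation
`∑ λ_n^{-2σ} · 2/λ_n²` of its squared norm is finite. -/
theorem ae_memℓp_randCoeff (hg : ∀ n, HasLaw (g n) stdComplexGaussian P) (hσ : 0 < σ) :
    ∀ᵐ ω ∂P, Memℓp (fun m => ((freq m ^ (-σ) : ℝ) : ℂ) * randCoeff g ω m) 2 := by
  have hsq : ∀ n ω, ‖((freq n ^ (-σ) : ℝ) : ℂ) * randCoeff g ω n‖ ^ 2 =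
      freq n ^ (2 * -σ) * coeffVar n * ‖g n ω‖ ^ 2 := fun n ω => by
    have hf := (freq_pos n).le
    rw [randCoeff, norm_mul, norm_mul, Complex.norm_real, Complex.norm_real,
      Real.norm_of_nonneg (Real.rpow_nonneg hf _), Real.norm_of_nonneg (by positivity), mul_pow,
      mul_pow, div_pow, Real.sq_sqrt (by norm_num), mul_comm 2 (-σ), Real.rpow_mul hf, coeffVar,
      Real.rpow_two]
    ring
  have hE : ∀ n, ∫⁻ ω, ENNReal.ofReal (‖g n ω‖ ^ 2) ∂P = 1 := fun n => by
    have e1 := (hg n).lintegral_comp (f := fun z => ENNReal.ofReal (‖z‖ ^ 2)) (by fun_prop)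
    have h1 := integral_norm_pow_stdComplexGaussian 1
    have h2 := integrable_norm_pow_stdComplexGaussian 1
    simp only [mul_one, Nat.factorial_one, Nat.cast_one] at h1 h2
    refine e1.trans ?_
    rw [← ofReal_integral_eq_lintegral_ofReal h2 (ae_of_all _ fun _ => by positivity), h1]
    simp
  have hw : ∀ n, 0 ≤ freq n ^ (2 * -σ) * coeffVar n := fun n =>
    mul_nonneg (Real.rpow_nonneg (freq_pos n).le _) (coeffVar_pos n).le
  have hm : ∀ n, AEMeasurable (fun ω => ENNReal.ofReal
      (freq n ^ (2 * -σ) * coeffVar n * ‖g n ω‖ ^ 2)) P := fun n => by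
    have := (hg n).aemeasurable
    fun_prop
  have hfin : ∫⁻ ω, ∑' n, ENNReal.ofReal (freq n ^ (2 * -σ) * coeffVar n * ‖g n ω‖ ^ 2) ∂P
      ≠ ∞ := by
    rw [lintegral_tsum hm]
    have : ∀ n, ∫⁻ ω, ENNReal.ofReal (freq n ^ (2 * -σ) * coeffVar n * ‖g n ω‖ ^ 2) ∂P =
        ENNReal.ofReal (freq n ^ (2 * -σ) * coeffVar n) := fun n => by
      simp only [ENNReal.ofReal_mul (hw n)]
      rw [lintegral_const_mul' _ _ ENNReal.ofReal_ne_top, hE, mul_one]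
    simp only [this]
    exact (summable_freq_rpow_mul_coeffVar hσ).tsum_ofReal_ne_top
  filter_upwards [ae_lt_top' (AEMeasurable.tsum hm) hfin] with ω hω
  rw [memℓp_gen_iff (by norm_num)]
  have h2 : Summable fun n => freq n ^ (2 * -σ) * coeffVar n * ‖g n ω‖ ^ 2 := by
    refine (ENNReal.summable_toReal hω.ne).congr fun n => ?_
    rw [ENNReal.toReal_ofReal (mul_nonneg (hw n) (sq_nonneg _))]
  refine h2.congr fun n => ?_
  rw [← hsq]
  norm_num

theorem ae_coeff_ofCoeffs_randCoeff (hg : ∀ n, HasLaw (g n) stdComplexGaussian P) (hσ : 0 < σ) :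
    ∀ᵐ ω ∂P, ∀ n, coeff n (ofCoeffs (-σ) (randCoeff g ω)).toDist = randCoeff g ω n := by
  filter_upwards [ae_memℓp_randCoeff hg hσ] with ω hω n
  rw [coeff_ofCoeffs, if_pos hω]

variable (σ) in
/-- The normalized coefficient `(λ_n/√2) c_n`, a standard complex Gaussian variable under `μ`. -/
def normCoeff (n : ℕ) (u : HSob (-σ)) : ℂ := ((freq n / √2 : ℝ) : ℂ) * coeff n u.toDist

theorem measurable_normCoeff (n : ℕ) : Measurable (normCoeff σ n) :=
  (HSob.measurable_coeff n).const_mul _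

theorem coeff_eq_mul_normCoeff (n : ℕ) (u : HSob (-σ)) :
    coeff n u.toDist = ((√(coeffVar n) : ℝ) : ℂ) * normCoeff σ n u := by
  have hf := freq_pos n
  have h2 : (0 : ℝ) < √2 := by positivity
  rw [normCoeff, ← mul_assoc, ← Complex.ofReal_mul, coeffVar, Real.sqrt_div (by norm_num),
    Real.sqrt_sq hf.le, div_mul_div_cancel₀ hf.ne', div_self h2.ne']
  simp

theorem measurable_ofCoeffs_randCoeff (hgm : ∀ n, Measurable (g n)) :
    Measurable fun ω => ofCoeffs (-σ) (randCoeff g ω) :=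
  measurable_ofCoeffs _ fun n => (hgm n).const_mul _

theorem isProbabilityMeasure_mu [IsProbabilityMeasure P] (hgm : ∀ n, Measurable (g n)) :
    IsProbabilityMeasure (mu P g σ) :=
  Measure.isProbabilityMeasure_map (measurable_ofCoeffs_randCoeff hgm).aemeasurable

theorem ae_normCoeff_ofCoeffs (hg : ∀ n, HasLaw (g n) stdComplexGaussian P) (hσ : 0 < σ) :
    ∀ᵐ ω ∂P, ∀ n, normCoeff σ n (ofCoeffs (-σ) (randCoeff g ω)) = g n ω := by
  filter_upwards [ae_coeff_ofCoeffs_randCoeff hg hσ] with ω hω n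
  have hf := freq_pos n
  have h2 : (0 : ℝ) < √2 := by positivity
  rw [normCoeff, hω n, randCoeff, ← mul_assoc, ← Complex.ofReal_mul, div_mul_div_cancel₀ h2.ne',
    div_self hf.ne']
  simp

theorem hasLaw_normCoeff (hgm : ∀ n, Measurable (g n))
    (hg : ∀ n, HasLaw (g n) stdComplexGaussian P) (hσ : 0 < σ) (n : ℕ) :
    HasLaw (normCoeff σ n) stdComplexGaussian (mu P g σ) where
  aemeasurable := (measurable_normCoeff n).aemeasurable
  map_eq := by
    rw [mu, Measure.map_map (measurable_normCoeff n) (measurable_ofCoeffs_randCoeff hgm),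
      ← (hg n).map_eq]
    refine Measure.map_congr ?_
    filter_upwards [ae_normCoeff_ofCoeffs hg hσ] with ω hω using hω n

theorem iIndepFun_normCoeff (hgm : ∀ n, Measurable (g n))
    (hg : ∀ n, HasLaw (g n) stdComplexGaussian P) (hind : iIndepFun g P) (hσ : 0 < σ) :
    iIndepFun (normCoeff σ) (mu P g σ) := by
  rw [iIndepFun_iff_measure_inter_preimage_eq_mul]
  intro S t ht
  have hae := ae_normCoeff_ofCoeffs hg hσ
  have hT := measurable_ofCoeffs_randCoeff (σ := σ) hgm
  have h1 : ∀ n ∈ S, mu P g σ (normCoeff σ n ⁻¹' t n) = P (g n ⁻¹' t n) := fun n hn => by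
    rw [mu, Measure.map_apply hT (measurable_normCoeff n (ht n hn))]
    refine measure_congr (eventuallyEq_set.2 ?_)
    filter_upwards [hae] with ω hω
    rw [Set.mem_preimage, Set.mem_preimage, Set.mem_preimage, hω n]
  rw [Finset.prod_congr rfl h1, ← hind.measure_inter_preimage_eq_mul S ht, mu,
    Measure.map_apply hT
      (Finset.measurableSet_biInter S fun n hn => measurable_normCoeff n (ht n hn))]
  refine measure_congr (eventuallyEq_set.2 ?_)
  filter_upwards [hae] with ω hω
  simp only [Set.mem_preimage, Set.mem_iInter, hω]

end Law

/-! ### The truncations and the cut-off potential energies -/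

theorem cutoff_eq_zero {χ : ℝ → ℝ} (hχs : tsupport χ ⊆ Set.Ioo (-1) 1) {n N : ℕ} (h : N ≤ n) :
    χ ((2 * n + 1) / (2 * N + 1)) = 0 := by
  refine image_eq_zero_of_notMem_tsupport fun hm => ?_
  have h1 := (hχs hm).2
  rw [div_lt_one (by positivity)] at h1
  have : (N : ℝ) ≤ n := by exact_mod_cast h
  linarith

theorem SN_eq_sum {χ : ℝ → ℝ} (hχs : tsupport χ ⊆ Set.Ioo (-1) 1) {s : ℝ} (N : ℕ) (u : HSob s)
    (x : ℝ) : SN χ N u x = ∑ n ∈ Finset.range (N + 1),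
      (χ ((2 * n + 1) / (2 * N + 1)) : ℂ) * coeff n u.toDist * (hermiteFun n x : ℂ) := by
  refine tsum_eq_sum fun n hn => ?_
  rw [Finset.mem_range, not_lt] at hn
  rw [cutoff_eq_zero hχs (by omega)]
  simp

theorem integral_normSq_PiN {s : ℝ} (N : ℕ) (u : HSob s) :
    ∫ x, ‖PiN N u x‖ ^ 2 = ∑ n ∈ Finset.range (N + 1), ‖coeff n u.toDist‖ ^ 2 :=
  integral_normSq_hermite_sum _ _

theorem measurable_SN_uncurry {χ : ℝ → ℝ} (hχs : tsupport χ ⊆ Set.Ioo (-1) 1) {s : ℝ} (N : ℕ) :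
    Measurable fun p : HSob s × ℝ => SN χ N p.1 p.2 := by
  simp only [SN_eq_sum hχs]
  refine Finset.measurable_fun_sum _ fun n _ => ?_
  refine (((HSob.measurable_coeff n).comp measurable_fst).const_mul _).mul ?_
  exact Complex.measurable_ofReal.comp
    ((continuous_hermiteFun n).measurable.comp measurable_snd)

theorem measurable_integral_SN_pow {χ : ℝ → ℝ} (hχs : tsupport χ ⊆ Set.Ioo (-1) 1) {s : ℝ}
    (N q : ℕ) : Measurable fun u : HSob s => ∫ x, ‖SN χ N u x‖ ^ q :=
  (StronglyMeasurable.integral_prod_right (f := fun (u : HSob s) (x : ℝ) => ‖SN χ N u x‖ ^ q)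
    ((measurable_SN_uncurry hχs N).norm.pow_const q).stronglyMeasurable).measurable

theorem measurable_GN {σ : ℝ} {χ ζ : ℝ → ℝ} (hχs : tsupport χ ⊆ Set.Ioo (-1) 1)
    (hζ : Continuous ζ) (N : ℕ) : Measurable (GN σ χ ζ N) := by
  have h1 : Measurable fun u : HSob (-σ) => ∫ x, ‖PiN N u x‖ ^ 2 := by
    simp only [integral_normSq_PiN]
    exact Finset.measurable_fun_sum _ fun n _ => (HSob.measurable_coeff n).norm.pow_const 2
  exact (hζ.measurable.comp (h1.sub_const _)).mul
    (Real.measurable_exp.comp ((measurable_integral_SN_pow hχs N 4).const_mul _))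

/-- `G_N` depends on the frequencies `n ≤ N` only. -/
theorem GN_congr {σ : ℝ} {χ ζ : ℝ → ℝ} (hχs : tsupport χ ⊆ Set.Ioo (-1) 1) {N : ℕ}
    {u v : HSob (-σ)} (h : ∀ n ≤ N, coeff n u.toDist = coeff n v.toDist) :
    GN σ χ ζ N u = GN σ χ ζ N v := by
  have h' : ∀ n ∈ Finset.range (N + 1), coeff n u.toDist = coeff n v.toDist := fun n hn =>
    h n (by rw [Finset.mem_range] at hn; omega)
  have h1 : ∀ x, PiN N u x = PiN N v x := fun x =>
    Finset.sum_congr rfl fun n hn => by rw [h' n hn]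
  have h2 : ∀ x, SN χ N u x = SN χ N v x := fun x => by
    rw [SN_eq_sum hχs, SN_eq_sum hχs]
    exact Finset.sum_congr rfl fun n hn => by rw [h' n hn]
  simp only [GN, h1, h2]

theorem Memℓp.of_norm_le {ι : Type*} {f h : ι → ℂ} (hh : Memℓp h 2) (hle : ∀ i, ‖f i‖ ≤ ‖h i‖) :
    Memℓp f 2 := by
  rw [memℓp_gen_iff (by norm_num)] at hh ⊢
  exact Summable.of_nonneg_of_le (fun i => by positivity)
    (fun i => Real.rpow_le_rpow (norm_nonneg _) (hle i) (by norm_num)) hh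

section Independence

variable {Ω : Type*} [MeasurableSpace Ω] {P : Measure Ω} {g : ℕ → Ω → ℂ} {σ : ℝ}

/-- The parts of the random series carried by disjoint sets of frequencies are independent. -/
theorem indepFun_ofCoeffs_ite (hgm : ∀ n, Measurable (g n)) (hind : iIndepFun g P) (N : ℕ) :
    IndepFun (fun ω => ofCoeffs (-σ) fun n => if n ≤ N then 0 else randCoeff g ω n)
      (fun ω => ofCoeffs (-σ) fun n => if n ≤ N then randCoeff g ω n else 0) P := by
  have key := indep_iSup_of_disjoint (m := fun n => MeasurableSpace.comap (g n) inferInstance)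
    (fun n => (hgm n).comap_le) hind.iIndep (S := {n | ¬ n ≤ N}) (T := {n | n ≤ N})
    (Set.disjoint_left.2 fun n h1 h2 => h1 h2)
  have hmeas : ∀ (S : Set ℕ) (n : ℕ), n ∈ S →
      Measurable[⨆ n ∈ S, MeasurableSpace.comap (g n) inferInstance] (g n) := fun S n hn =>
    measurable_iff_comap_le.2 (le_iSup₂_of_le n hn le_rfl)
  rw [IndepFun_iff_Indep]
  refine indep_of_indep_of_le_left (indep_of_indep_of_le_right key ?_) ?_
  · rw [← measurable_iff_comap_le]
    refine @measurable_ofCoeffs _ (_) (-σ) _ fun n => ?_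
    by_cases h : n ≤ N
    · simp only [if_pos h]
      exact @Measurable.const_mul _ _ _ _ _ (_) _ (hmeas _ n h) _
    · simp only [if_neg h]
      exact @measurable_const _ _ _ (_) _
  · rw [← measurable_iff_comap_le]
    refine @measurable_ofCoeffs _ (_) (-σ) _ fun n => ?_
    by_cases h : n ≤ N
    · simp only [if_pos h]
      exact @measurable_const _ _ _ (_) _
    · simp only [if_neg h]
      exact @Measurable.const_mul _ _ _ _ _ (_) _ (hmeas _ n h) _

/-- As `G_N` depends on the frequencies `n ≤ N` only, the product of `μ^N` and `G_N dμ̃_N` is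
`G_N dμ`. -/
theorem rhoFocN_eq_withDensity [IsProbabilityMeasure P] (hgm : ∀ n, Measurable (g n))
    (hg : ∀ n, HasLaw (g n) stdComplexGaussian P) (hind : iIndepFun g P) (hσ : 0 < σ)
    {χ ζ : ℝ → ℝ} (hχs : tsupport χ ⊆ Set.Ioo (-1) 1) (hζ : Continuous ζ) (N : ℕ) :
    rhoFocN P g σ χ ζ N =
      (mu P g σ).withDensity fun u => ENNReal.ofReal (GN σ χ ζ N u) := by
  set lo : Ω → HSob (-σ) := fun ω => ofCoeffs (-σ) fun n => if n ≤ N then randCoeff g ω n else 0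
    with hlo
  set hi : Ω → HSob (-σ) := fun ω => ofCoeffs (-σ) fun n => if n ≤ N then 0 else randCoeff g ω n
    with hhi
  have hrm : ∀ n, Measurable fun ω => randCoeff g ω n := fun n => (hgm n).const_mul _
  have hlom : Measurable lo := measurable_ofCoeffs _ fun n => by
    by_cases h : n ≤ N
    · simpa only [if_pos h] using hrm n
    · simpa only [if_neg h] using measurable_const
  have hhim : Measurable hi := measurable_ofCoeffs _ fun n => by
    by_cases h : n ≤ N
    · simpa only [if_pos h] using measurable_const
    · simpa only [if_neg h] using hrm n
  -- almost surely: on the null set where the series diverges, `lo` may still be nonzero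
  have hlohi : ∀ᵐ ω ∂P, hi ω + lo ω = ofCoeffs (-σ) (randCoeff g ω) := by
    filter_upwards [ae_memℓp_randCoeff hg hσ] with ω hω
    refine HSob.ext_toDist (ext_of_coeff fun n => ?_)
    have h1 : Memℓp (fun m => ((freq m ^ (-σ) : ℝ) : ℂ) *
        if m ≤ N then randCoeff g ω m else 0) 2 :=
      Memℓp.of_norm_le hω fun m => by
        split_ifs
        · exact le_rfl
        · simp only [mul_zero, norm_zero]
          positivity
    have h2 : Memℓp (fun m => ((freq m ^ (-σ) : ℝ) : ℂ) *
        if m ≤ N then 0 else randCoeff g ω m) 2 :=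
      Memℓp.of_norm_le hω fun m => by
        split_ifs
        · simp only [mul_zero, norm_zero]
          positivity
        · exact le_rfl
    rw [HSob.coeff_add, hlo, hhi, coeff_ofCoeffs, coeff_ofCoeffs, coeff_ofCoeffs, if_pos hω,
      if_pos h1, if_pos h2]
    split_ifs <;> simp
  have hhi0 : ∀ ω, ∀ n ≤ N, coeff n (hi ω).toDist = 0 := fun ω n hn => by
    rw [hhi, coeff_ofCoeffs, if_pos hn, ite_self]
  have hw : Measurable fun u : HSob (-σ) => ENNReal.ofReal (GN σ χ ζ N u) :=
    (measurable_GN hχs hζ N).ennreal_ofReal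
  have : IsProbabilityMeasure (muLow P g σ N) := Measure.isProbabilityMeasure_map hlom.aemeasurable
  have : IsProbabilityMeasure (muHigh P g σ N) :=
    Measure.isProbabilityMeasure_map hhim.aemeasurable
  have hprod : (muHigh P g σ N).prod (muLow P g σ N) = P.map fun ω => (hi ω, lo ω) :=
    ((indepFun_iff_map_prod_eq_prod_map_map hhim.aemeasurable hlom.aemeasurable).1
      (indepFun_ofCoeffs_ite hgm hind N)).symm
  have hmu : mu P g σ = P.map fun ω => hi ω + lo ω :=
    Measure.map_congr (hlohi.mono fun ω h => h.symm)
  have hpm : Measurable fun ω => (hi ω, lo ω) := hhim.prodMk hlom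
  have hsm : Measurable fun ω => hi ω + lo ω := HSob.measurable_add.comp hpm
  refine Measure.ext_of_lintegral _ fun F hF => ?_
  have hw2 : Measurable fun p : HSob (-σ) × HSob (-σ) => ENNReal.ofReal (GN σ χ ζ N p.2) :=
    hw.comp measurable_snd
  have hF2 : Measurable fun p : HSob (-σ) × HSob (-σ) => F (p.1 + p.2) :=
    hF.comp HSob.measurable_add
  rw [rhoFocN, lintegral_map hF HSob.measurable_add, rhoFocLow, prod_withDensity_right hw, hprod,
    lintegral_withDensity_eq_lintegral_mul _ hw2 hF2, lintegral_map (hw2.mul hF2) hpm, hmu,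
    lintegral_withDensity_eq_lintegral_mul _ hw hF, lintegral_map (hw.mul hF) hsm]
  refine lintegral_congr fun ω => ?_
  simp only [Pi.mul_apply]
  rw [GN_congr (u := hi ω + lo ω) (v := lo ω) hχs fun n hn => by
    rw [HSob.coeff_add, hhi0 ω n hn, zero_add]]

end Independence

/-! ### Convergence of the random series in `L^q` -/

theorem eLpNorm_natCast_pow {α E : Type*} [MeasurableSpace α] [NormedAddCommGroup E]
    {ν : Measure α} {q : ℕ} (hq : q ≠ 0) (f : α → E) :
    eLpNorm f (q : ℝ≥0∞) ν ^ q = ∫⁻ x, ‖f x‖ₑ ^ q ∂ν := by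
  have hq' : (q : ℝ) ≠ 0 := Nat.cast_ne_zero.2 hq
  rw [eLpNorm_eq_lintegral_rpow_enorm_toReal (by exact_mod_cast hq) (by simp),
    ENNReal.toReal_natCast, ← ENNReal.rpow_natCast, ← ENNReal.rpow_mul, one_div,
    inv_mul_cancel₀ hq', ENNReal.rpow_one]
  simp

theorem enorm_pow_eq_ofReal {E : Type*} [NormedAddCommGroup E] (x : E) (q : ℕ) :
    ‖x‖ₑ ^ q = ENNReal.ofReal (‖x‖ ^ q) := by
  rw [ENNReal.ofReal_pow (norm_nonneg _), ofReal_norm]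

section RandomSeries

variable {σ : ℝ}

/-- The finite sum `∑_{n ∈ s} w_n c_n h_n`. -/
def multSum (w : ℕ → ℝ) (s : Finset ℕ) (u : HSob (-σ)) (x : ℝ) : ℂ :=
  ∑ n ∈ s, (w n : ℂ) * coeff n u.toDist * (hermiteFun n x : ℂ)

/-- Pointwise in `x`, a multiplier sum is a real linear combination of the normalized coefficients. -/
theorem multSum_eq (w : ℕ → ℝ) (s : Finset ℕ) (u : HSob (-σ)) (x : ℝ) :
    multSum w s u x =
      ∑ n ∈ s, ((w n * √(coeffVar n) * hermiteFun n x : ℝ) : ℂ) * normCoeff σ n u := by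
  refine Finset.sum_congr rfl fun n _ => ?_
  rw [coeff_eq_mul_normCoeff]
  push_cast
  ring

theorem continuous_multSum (w : ℕ → ℝ) (s : Finset ℕ) (u : HSob (-σ)) :
    Continuous (multSum w s u) :=
  continuous_finsetSum _ fun n _ =>
    continuous_const.mul (Complex.continuous_ofReal.comp (continuous_hermiteFun n))

theorem measurable_multSum_uncurry (w : ℕ → ℝ) (s : Finset ℕ) :
    Measurable fun p : HSob (-σ) × ℝ => multSum w s p.1 p.2 := by
  refine Finset.measurable_fun_sum _ fun n _ => ?_
  refine (((HSob.measurable_coeff n).comp measurable_fst).const_mul _).mul ?_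
  exact Complex.measurable_ofReal.comp
    ((continuous_hermiteFun n).measurable.comp measurable_snd)

/-- The pointwise variances of the random sums `∑_{n ∈ s} w_n c_n h_n` with `s ⊆ [M, ∞)`. -/
theorem exists_sum_sq_le : ∃ C : ℝ, 0 < C ∧
    ∀ (M : ℕ) (s : Finset ℕ) (w : ℕ → ℝ) (W : ℝ), (∀ n ∈ s, M ≤ n) → (∀ n ∈ s, |w n| ≤ W) →
      ∀ x : ℝ, ∑ n ∈ s, (w n * √(coeffVar n) * hermiteFun n x) ^ 2 ≤
        W ^ 2 * (C * ((M : ℝ) + 1) ^ (-(1 / 8) : ℝ) * greenMajorant x) := by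
  obtain ⟨C, hC, h⟩ := exists_sum_coeffVar_mul_hermiteFun_sq_le
  refine ⟨C, hC, fun M s w W hs hw x => ?_⟩
  calc ∑ n ∈ s, (w n * √(coeffVar n) * hermiteFun n x) ^ 2
      ≤ ∑ n ∈ s, W ^ 2 * (coeffVar n * hermiteFun n x ^ 2) := by
        refine Finset.sum_le_sum fun n hn => ?_
        rw [mul_pow, mul_pow, Real.sq_sqrt (coeffVar_pos n).le, mul_assoc]
        have h1 : w n ^ 2 ≤ W ^ 2 := by
          rw [← sq_abs]
          exact pow_le_pow_left₀ (abs_nonneg _) (hw n hn) 2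
        exact mul_le_mul_of_nonneg_right h1
          (mul_nonneg (coeffVar_pos n).le (sq_nonneg _))
    _ ≤ _ := by
        rw [← Finset.mul_sum]
        exact mul_le_mul_of_nonneg_left (h M s hs x) (sq_nonneg _)

variable {μ : Measure (HSob (-σ))}

/-- Moments of the `L^q` norm of a random sum carried by frequencies `n ≥ M`. The hypothesis `4 ≤ q`
makes the power `greenMajorant^{q/2}` integrable. -/
theorem exists_lintegral_multSum_pow_le {q : ℕ} (hq : 4 ≤ q) : ∃ C : ℝ, 0 ≤ C ∧
    ∀ (μ : Measure (HSob (-σ))) [IsProbabilityMeasure μ],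
    (∀ n, HasLaw (normCoeff σ n) stdComplexGaussian μ) → iIndepFun (normCoeff σ) μ →
    ∀ (M : ℕ) (s : Finset ℕ) (w : ℕ → ℝ) (W : ℝ), 0 ≤ W → (∀ n ∈ s, M ≤ n) →
      (∀ n ∈ s, |w n| ≤ W) →
      ∫⁻ u, (∫⁻ x, ENNReal.ofReal (‖multSum w s u x‖ ^ q)) ∂μ ≤
        ENNReal.ofReal (C * (W * ((M : ℝ) + 1) ^ (-(1 / 16) : ℝ)) ^ q) := by
  obtain ⟨C, hC, hK⟩ := exists_sum_sq_le
  refine ⟨(1 + (4 * q) ^ q) * √C ^ q * (∫ x, greenMajorant x ^ 2) * gaussConst.toReal,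
    by have : 0 ≤ ∫ x, greenMajorant x ^ 2 := integral_nonneg fun x => sq_nonneg _
       positivity, fun μ _ hγ hind M s w W hW hs hw => ?_⟩
  rw [lintegral_lintegral_swap
    ((measurable_multSum_uncurry w s).norm.pow_const q).ennreal_ofReal.aemeasurable]
  set B : ℝ := (1 + (4 * q) ^ q) * (√C ^ q * (W * ((M : ℝ) + 1) ^ (-(1 / 16) : ℝ)) ^ q) with hB
  have hB0 : 0 ≤ B := by positivity
  have hpt : ∀ x, ∫⁻ u, ENNReal.ofReal (‖multSum w s u x‖ ^ q) ∂μ ≤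
      ENNReal.ofReal (B * greenMajorant x ^ 2) * gaussConst := fun x => by
    simp only [multSum_eq]
    refine (lintegral_norm_sum_pow_le hγ hind _ s q).trans ?_
    refine mul_le_mul' (ENNReal.ofReal_le_ofReal ?_) le_rfl
    have hφ := greenMajorant_pos x
    have h1 : √(∑ n ∈ s, (w n * √(coeffVar n) * hermiteFun n x) ^ 2) ≤
        √C * (W * ((M : ℝ) + 1) ^ (-(1 / 16) : ℝ)) * √(greenMajorant x) := by
      rw [Real.sqrt_le_left (by positivity)]
      refine (hK M s w W hs hw x).trans (le_of_eq ?_)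
      have e1 : (((M : ℝ) + 1) ^ (-(1 / 16) : ℝ)) ^ 2 = ((M : ℝ) + 1) ^ (-(1 / 8) : ℝ) := by
        rw [← Real.rpow_natCast, ← Real.rpow_mul (by positivity)]
        norm_num
      rw [mul_pow, mul_pow, mul_pow, Real.sq_sqrt hC.le, Real.sq_sqrt hφ.le, e1]
      ring
    have h2 : √(greenMajorant x) ^ q ≤ greenMajorant x ^ 2 := by
      have e2 : √(greenMajorant x) ^ 4 = greenMajorant x ^ 2 := by
        rw [show √(greenMajorant x) ^ 4 = (√(greenMajorant x) ^ 2) ^ 2 by ring,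
          Real.sq_sqrt hφ.le]
      rw [← e2]
      exact pow_le_pow_of_le_one (Real.sqrt_nonneg _)
        (Real.sqrt_le_one.2 (greenMajorant_le_one x)) hq
    calc (1 + (4 * (q : ℝ)) ^ q) *
          √(∑ n ∈ s, (w n * √(coeffVar n) * hermiteFun n x) ^ 2) ^ q
        ≤ (1 + (4 * (q : ℝ)) ^ q) *
          (√C * (W * ((M : ℝ) + 1) ^ (-(1 / 16) : ℝ)) * √(greenMajorant x)) ^ q := by gcongr
      _ = B * √(greenMajorant x) ^ q := by
          rw [hB]
          ring
      _ ≤ _ := by gcongr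
  refine (lintegral_mono hpt).trans ?_
  rw [lintegral_mul_const' _ _ gaussConst_ne_top,
    ← ofReal_integral_eq_lintegral_ofReal (integrable_greenMajorant_sq.const_mul B)
      (ae_of_all _ fun x => mul_nonneg hB0 (sq_nonneg _)), integral_const_mul]
  nth_rewrite 1 [← ENNReal.ofReal_toReal gaussConst_ne_top]
  rw [← ENNReal.ofReal_mul' ENNReal.toReal_nonneg]
  refine ENNReal.ofReal_le_ofReal (le_of_eq ?_)
  rw [hB]
  ring

/-- The finite sum `∑_{n ∈ s} w_n c_n h_n` as an element of `L^q(ℝ)`. -/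
def multSumLp (q : ℝ≥0∞) [Fact (1 ≤ q)] (w : ℕ → ℝ) (s : Finset ℕ) (u : HSob (-σ)) :
    Lp ℂ q (volume : Measure ℝ) :=
  ∑ n ∈ s, ((w n : ℂ) * coeff n u.toDist) • (hermiteS n).toLp q volume

theorem coeFn_multSumLp (q : ℝ≥0∞) [Fact (1 ≤ q)] (w : ℕ → ℝ) (s : Finset ℕ) (u : HSob (-σ)) :
    multSumLp q w s u =ᵐ[volume] multSum w s u := by
  classical
  induction s using Finset.induction_on with
  | empty =>
    simp only [multSumLp, Finset.sum_empty]
    exact Lp.coeFn_zero _ _ _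
  | insert a s ha ih =>
    simp only [multSumLp, Finset.sum_insert ha] at ih ⊢
    filter_upwards [Lp.coeFn_add (((w a : ℂ) * coeff a u.toDist) • (hermiteS a).toLp q volume)
      (∑ n ∈ s, ((w n : ℂ) * coeff n u.toDist) • (hermiteS n).toLp q volume),
      Lp.coeFn_smul ((w a : ℂ) * coeff a u.toDist) ((hermiteS a).toLp q volume), ih,
      (hermiteS a).coeFn_toLp q volume] with x h1 h2 h3 h4
    rw [h1, Pi.add_apply, h2, h3, Pi.smul_apply, h4, smul_eq_mul, hermiteS_apply, multSum,
      multSum, Finset.sum_insert ha]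

theorem aestronglyMeasurable_multSumLp (q : ℝ≥0∞) [Fact (1 ≤ q)] (w : ℕ → ℝ) (s : Finset ℕ) :
    AEStronglyMeasurable (multSumLp (σ := σ) q w s) μ :=
  Finset.aestronglyMeasurable_fun_sum _ fun n _ =>
    ((HSob.measurable_coeff n).const_mul _).stronglyMeasurable.aestronglyMeasurable.smul_const _

theorem enorm_multSumLp_pow {q : ℕ} (hq : q ≠ 0) [Fact (1 ≤ (q : ℝ≥0∞))] (w : ℕ → ℝ)
    (s : Finset ℕ) (u : HSob (-σ)) :
    ‖multSumLp (q : ℝ≥0∞) w s u‖ₑ ^ q = ∫⁻ x, ENNReal.ofReal (‖multSum w s u x‖ ^ q) := by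
  rw [Lp.enorm_def, eLpNorm_congr_ae (coeFn_multSumLp _ w s u), eLpNorm_natCast_pow hq]
  simp only [enorm_pow_eq_ofReal]

theorem norm_multSumLp_pow {q : ℕ} (hq : q ≠ 0) [Fact (1 ≤ (q : ℝ≥0∞))] (w : ℕ → ℝ)
    (s : Finset ℕ) (u : HSob (-σ)) :
    ‖multSumLp (q : ℝ≥0∞) w s u‖ ^ q = ∫ x, ‖multSum w s u x‖ ^ q := by
  rw [integral_eq_lintegral_of_nonneg_ae (ae_of_all _ fun x => by positivity)
    (by exact ((continuous_multSum w s u).norm.pow q).aestronglyMeasurable), ← enorm_multSumLp_pow hq,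
    ENNReal.toReal_pow, toReal_enorm]

/-- The norm in `L^q(μ; L^q(ℝ))` of a random sum carried by frequencies `n ≥ M`. -/
theorem exists_eLpNorm_multSumLp_le (σ : ℝ) {q : ℕ} (hq : 4 ≤ q) [Fact (1 ≤ (q : ℝ≥0∞))] :
    ∃ C : ℝ, 0 ≤ C ∧ ∀ (μ : Measure (HSob (-σ))) [IsProbabilityMeasure μ],
    (∀ n, HasLaw (normCoeff σ n) stdComplexGaussian μ) → iIndepFun (normCoeff σ) μ →
    ∀ (M : ℕ) (s : Finset ℕ) (w : ℕ → ℝ) (W : ℝ), 0 ≤ W → (∀ n ∈ s, M ≤ n) →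
      (∀ n ∈ s, |w n| ≤ W) →
      eLpNorm (multSumLp (σ := σ) (q : ℝ≥0∞) w s) (q : ℝ≥0∞) μ ≤
        ENNReal.ofReal (C * (W * ((M : ℝ) + 1) ^ (-(1 / 16) : ℝ))) := by
  obtain ⟨C, hC, h⟩ := exists_lintegral_multSum_pow_le (σ := σ) hq
  have hq0 : q ≠ 0 := by omega
  refine ⟨1 + C, by positivity, fun μ _ hγ hind M s w W hW hs hw => ?_⟩
  have h1 := h μ hγ hind M s w W hW hs hw
  simp only [← enorm_multSumLp_pow hq0] at h1
  rw [← eLpNorm_natCast_pow hq0] at h1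
  refine (ENNReal.pow_le_pow_left_iff hq0).1 (h1.trans ?_)
  rw [← ENNReal.ofReal_pow (by positivity), mul_pow (1 + C)]
  refine ENNReal.ofReal_le_ofReal (mul_le_mul_of_nonneg_right ?_ (by positivity))
  exact (by linarith : C ≤ 1 + C).trans (le_self_pow₀ (by linarith) hq0)

theorem multSumLp_sub_range {q : ℝ≥0∞} [Fact (1 ≤ q)] (w : ℕ → ℝ) {m n : ℕ} (h : m ≤ n) :
    multSumLp (σ := σ) q w (Finset.range n) - multSumLp q w (Finset.range m) =
      multSumLp q w (Finset.Ico m n) := by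
  funext u
  exact (Finset.sum_Ico_eq_sub _ h).symm

theorem tendsto_rate_atTop (C : ℝ) :
    Tendsto (fun M : ℕ => ENNReal.ofReal (C * ((M : ℝ) + 1) ^ (-(1 / 16) : ℝ))) atTop (𝓝 0) := by
  rw [← ENNReal.ofReal_zero]
  refine ENNReal.tendsto_ofReal ?_
  have h1 : Tendsto (fun M : ℕ => (M : ℝ) + 1) atTop atTop :=
    tendsto_atTop_add_const_right _ _ tendsto_natCast_atTop_atTop
  simpa using ((tendsto_rpow_neg_atTop (by norm_num : (0 : ℝ) < 1 / 16)).comp h1).const_mul C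

variable [IsProbabilityMeasure μ]

/-- The Hermite partial sums of a random `u` converge in `L^q(μ; L^q(ℝ))`. -/
theorem exists_tendsto_eLpNorm_multSumLp_range {q : ℕ} (hq : 4 ≤ q) [Fact (1 ≤ (q : ℝ≥0∞))]
    (hγ : ∀ n, HasLaw (normCoeff σ n) stdComplexGaussian μ) (hind : iIndepFun (normCoeff σ) μ) :
    ∃ F : HSob (-σ) → Lp ℂ (q : ℝ≥0∞) (volume : Measure ℝ), MemLp F (q : ℝ≥0∞) μ ∧
      Tendsto (fun N => eLpNorm
        (multSumLp (q : ℝ≥0∞) (fun _ => 1) (Finset.range N) - F) (q : ℝ≥0∞) μ) atTop (𝓝 0) := by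
  obtain ⟨C, hC, h⟩ := exists_eLpNorm_multSumLp_le σ hq
  have hmem : ∀ N, MemLp (multSumLp (σ := σ) (q : ℝ≥0∞) (fun _ => 1) (Finset.range N))
      (q : ℝ≥0∞) μ := fun N =>
    ⟨aestronglyMeasurable_multSumLp _ _ _, (h μ hγ hind 0 (Finset.range N) (fun _ => 1) 1
      zero_le_one (fun _ _ => Nat.zero_le _) (fun _ _ => by simp)).trans_lt
        ENNReal.ofReal_lt_top⟩
  have hle : ∀ N m n : ℕ, N ≤ m → m ≤ n →
      eLpNorm (multSumLp (σ := σ) (q : ℝ≥0∞) (fun _ => 1) (Finset.range n) -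
        multSumLp (q : ℝ≥0∞) (fun _ => 1) (Finset.range m)) (q : ℝ≥0∞) μ ≤
      ENNReal.ofReal (C * ((N : ℝ) + 1) ^ (-(1 / 16) : ℝ)) := fun N m n hNm hmn => by
    rw [multSumLp_sub_range _ hmn]
    have := h μ hγ hind N (Finset.Ico m n) (fun _ => 1) 1 zero_le_one
      (fun k hk => hNm.trans (Finset.mem_Ico.1 hk).1) (fun _ _ => by simp)
    rwa [one_mul] at this
  have hc : CauchySeq fun N => (hmem N).toLp := by
    rw [EMetric.cauchySeq_iff_le_tendsto_0]
    refine ⟨_, fun m n N hm hn => ?_, tendsto_rate_atTop C⟩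
    rcases le_total m n with hmn | hmn
    · rw [edist_comm, Lp.edist_toLp_toLp]
      exact hle N m n hm hmn
    · rw [Lp.edist_toLp_toLp]
      exact hle N n m hn hmn
  obtain ⟨F, hF⟩ := cauchySeq_tendsto_of_complete hc
  refine ⟨F, Lp.memLp F, ?_⟩
  rw [Lp.tendsto_Lp_iff_tendsto_eLpNorm'] at hF
  refine hF.congr fun N => eLpNorm_congr_ae ?_
  filter_upwards [(hmem N).coeFn_toLp] with u hu
  rw [Pi.sub_apply, Pi.sub_apply, hu]

/-- The multiplier `n ↦ χ((2n+1)/(2N+1))` of `S_N`. -/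
def cutoff (χ : ℝ → ℝ) (N n : ℕ) : ℝ := χ ((2 * n + 1) / (2 * N + 1))

theorem SN_eq_multSum {χ : ℝ → ℝ} (hχs : tsupport χ ⊆ Set.Ioo (-1) 1) (N : ℕ) (u : HSob (-σ))
    (x : ℝ) : SN χ N u x = multSum (cutoff χ N) (Finset.range (N + 1)) u x :=
  SN_eq_sum hχs N u x

theorem cutoff_eq_one {χ : ℝ → ℝ} (hχ1 : ∀ x ∈ Set.Icc (-(1 / 2) : ℝ) (1 / 2), χ x = 1)
    {N n : ℕ} (h : n < N / 2) : cutoff χ N n = 1 := by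
  refine hχ1 _ ⟨by have : (0 : ℝ) ≤ (2 * n + 1) / (2 * N + 1) := by positivity
                   linarith, ?_⟩
  rw [div_le_div_iff₀ (by positivity) (by norm_num)]
  have h2 : 2 * n + 2 ≤ N := by omega
  have h3 : (2 * n + 2 : ℝ) ≤ N := by exact_mod_cast h2
  linarith

/-- The smooth truncations `S_N u` have the same limit as the partial sums. -/
theorem tendsto_eLpNorm_multSumLp_cutoff {q : ℕ} (hq : 4 ≤ q) [Fact (1 ≤ (q : ℝ≥0∞))]
    (hγ : ∀ n, HasLaw (normCoeff σ n) stdComplexGaussian μ) (hind : iIndepFun (normCoeff σ) μ)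
    {χ : ℝ → ℝ} {W : ℝ} (hW : ∀ x, |χ x| ≤ W)
    (hχ1 : ∀ x ∈ Set.Icc (-(1 / 2) : ℝ) (1 / 2), χ x = 1)
    {F : HSob (-σ) → Lp ℂ (q : ℝ≥0∞) (volume : Measure ℝ)}
    (hFm : AEStronglyMeasurable F μ)
    (hF : Tendsto (fun N => eLpNorm
        (multSumLp (q : ℝ≥0∞) (fun _ => 1) (Finset.range N) - F) (q : ℝ≥0∞) μ) atTop (𝓝 0)) :
    Tendsto (fun N => eLpNorm
        (multSumLp (q : ℝ≥0∞) (cutoff χ N) (Finset.range (N + 1)) - F) (q : ℝ≥0∞) μ)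
      atTop (𝓝 0) := by
  obtain ⟨C, hC, h⟩ := exists_eLpNorm_multSumLp_le σ hq
  have hW0 : 0 ≤ W := (abs_nonneg _).trans (hW 0)
  -- the two truncations agree on the frequencies `n < N / 2`
  have hdiff : ∀ N, multSumLp (σ := σ) (q : ℝ≥0∞) (cutoff χ N) (Finset.range (N + 1)) -
      multSumLp (q : ℝ≥0∞) (fun _ => 1) (Finset.range (N + 1)) =
      multSumLp (q : ℝ≥0∞) (fun n => cutoff χ N n - 1) (Finset.Ico (N / 2) (N + 1)) := fun N => by
    funext u
    rw [Pi.sub_apply, multSumLp, multSumLp, multSumLp, ← Finset.sum_sub_distrib]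
    symm
    refine Finset.sum_subset_zero_on_sdiff (fun n hn => ?_) (fun n hn => ?_) fun n _ => ?_
    · exact Finset.mem_range.2 (Finset.mem_Ico.1 hn).2
    · rw [Finset.mem_sdiff, Finset.mem_range, Finset.mem_Ico, not_and_or, not_le] at hn
      rw [cutoff_eq_one hχ1 (by omega), sub_self]
    · rw [← sub_smul]
      congr 1
      push_cast
      ring
  have h1 : ∀ N, eLpNorm (multSumLp (σ := σ) (q : ℝ≥0∞) (cutoff χ N) (Finset.range (N + 1)) -
      multSumLp (q : ℝ≥0∞) (fun _ => 1) (Finset.range (N + 1))) (q : ℝ≥0∞) μ ≤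
      ENNReal.ofReal (C * (W + 1) * (((N / 2 : ℕ) : ℝ) + 1) ^ (-(1 / 16) : ℝ)) := fun N => by
    rw [hdiff, mul_assoc]
    refine h μ hγ hind (N / 2) _ _ (W + 1) (by linarith) (fun n hn => (Finset.mem_Ico.1 hn).1)
      fun n _ => ?_
    calc |cutoff χ N n - 1| ≤ |cutoff χ N n| + |1| := abs_sub _ _
      _ ≤ W + 1 := by
        rw [abs_one]
        exact add_le_add_left (hW _) 1
  have hhalf : Tendsto (fun N : ℕ => N / 2) atTop atTop :=
    Filter.tendsto_atTop_atTop.2 fun b => ⟨2 * b, fun a ha => by omega⟩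
  have h2 := ((tendsto_rate_atTop (C * (W + 1))).comp hhalf).add
    (hF.comp (tendsto_add_atTop_nat 1))
  rw [add_zero] at h2
  refine tendsto_of_tendsto_of_tendsto_of_le_of_le tendsto_const_nhds h2 (fun _ => zero_le)
    fun N => ?_
  have h3 : multSumLp (σ := σ) (q : ℝ≥0∞) (cutoff χ N) (Finset.range (N + 1)) - F =
      (multSumLp (q : ℝ≥0∞) (cutoff χ N) (Finset.range (N + 1)) -
        multSumLp (q : ℝ≥0∞) (fun _ => 1) (Finset.range (N + 1))) +
      (multSumLp (q : ℝ≥0∞) (fun _ => 1) (Finset.range (N + 1)) - F) := by abel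
  rw [h3]
  refine (eLpNorm_add_le ((aestronglyMeasurable_multSumLp _ _ _).sub
    (aestronglyMeasurable_multSumLp _ _ _)) ((aestronglyMeasurable_multSumLp _ _ _).sub hFm)
    Fact.out).trans ?_
  exact add_le_add (h1 N) le_rfl

/-! ### The `L^q` norm of a random distribution -/

/-- The function representing a distribution is unique, so that the infimum in `distLpNorm` is over
a single class. -/
theorem distLpNorm_eq_enorm {q : ℝ≥0∞} [Fact (1 ≤ q)] (f : Lp ℂ q (volume : Measure ℝ)) :
    distLpNorm q (Lp.toTemperedDistributionCLM ℂ (volume : Measure ℝ) q f) = ‖f‖ₑ := by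
  have happ : ∀ (h : Lp ℂ q (volume : Measure ℝ)) (ψ : 𝓢(ℝ, ℂ)),
      (Lp.toTemperedDistributionCLM ℂ (volume : Measure ℝ) q h) ψ = ∫ x, h x * ψ x :=
    fun h ψ => (Lp.toTemperedDistribution_apply h ψ).trans
      (integral_congr_ae (ae_of_all _ fun x => by simp [mul_comm]))
  refine le_antisymm ?_ (le_iInf₂ fun h hh => ?_)
  · rw [Lp.enorm_def]
    exact iInf₂_le (f : ℝ → ℂ) ⟨Lp.memLp f, happ f⟩
  · have h1 : Lp.toTemperedDistributionCLM ℂ (volume : Measure ℝ) q (hh.1.toLp h - f) = 0 := by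
      rw [map_sub, sub_eq_zero]
      refine ContinuousLinearMap.ext fun ψ => ?_
      refine (happ _ ψ).trans (Eq.trans ?_ (hh.2 ψ).symm)
      refine integral_congr_ae ?_
      filter_upwards [hh.1.coeFn_toLp] with x hx
      rw [hx]
    have h2 : hh.1.toLp h - f ∈
        (Lp.toTemperedDistributionCLM ℂ (volume : Measure ℝ) q).ker := h1
    rw [Lp.ker_toTemperedDistributionCLM_eq_bot, Submodule.mem_bot, sub_eq_zero] at h2
    rw [← h2, Lp.enorm_def, eLpNorm_congr_ae hh.1.coeFn_toLp]

/-- If a subsequence of the Hermite partial sums of `u` converges in `L^q`, then its limit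
represents `u`. -/
theorem toTemperedDistributionCLM_eq_of_tendsto {q : ℝ≥0∞} [Fact (1 ≤ q)] {u : HSob (-σ)}
    {f : Lp ℂ q (volume : Measure ℝ)} {ns : ℕ → ℕ} (hns : Tendsto ns atTop atTop)
    (h : Tendsto (fun j => multSumLp q (fun _ => 1) (Finset.range (ns j)) u) atTop (𝓝 f)) :
    Lp.toTemperedDistributionCLM ℂ (volume : Measure ℝ) q f = u.toDist := by
  have h1 := ((Lp.toTemperedDistributionCLM ℂ (volume : Measure ℝ) q).continuous.tendsto f).comp h
  rw [PointwiseConvergenceCLM.tendsto_iff_forall_tendsto] at h1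
  refine ContinuousLinearMap.ext fun ψ => tendsto_nhds_unique (h1 ψ) ?_
  refine (((hasSum_coeff_mul_hermiteCoeff u.toDist ψ).tendsto_sum_nat).comp hns).congr fun j => ?_
  simp only [Function.comp_apply, multSumLp, map_sum, map_smul]
  refine Eq.trans ?_ (sum_apply _ _ _).symm
  refine Finset.sum_congr rfl fun n _ => ?_
  refine Eq.trans ?_ (smul_apply _ _ _).symm
  rw [Lp.toTemperedDistributionCLM_apply, Lp.toTemperedDistribution_toLp_eq,
    hermiteS_toTemperedDistribution_apply]
  simp

end RandomSeries

/-! ### Convergence of measures with densities -/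

section Densities

variable {X : Type*} [MeasurableSpace X] {μ : Measure X}

theorem tendstoInMeasure_continuous_comp [IsFiniteMeasure μ] {E E' : Type*}
    [PseudoEMetricSpace E] [PseudoEMetricSpace E'] {f : ℕ → X → E} {f₀ : X → E}
    (hf : ∀ n, AEStronglyMeasurable (f n) μ) (h : TendstoInMeasure μ f atTop f₀) {φ : E → E'}
    (hφ : Continuous φ) :
    TendstoInMeasure μ (fun n x => φ (f n x)) atTop fun x => φ (f₀ x) := by
  rw [exists_seq_tendstoInMeasure_atTop_iff fun n => hφ.comp_aestronglyMeasurable (hf n)]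
  rw [exists_seq_tendstoInMeasure_atTop_iff hf] at h
  intro ns hns
  obtain ⟨ns', h1, h2⟩ := h ns hns
  refine ⟨ns', h1, ?_⟩
  filter_upwards [h2] with x hx
  exact (hφ.tendsto _).comp hx

theorem tendstoInMeasure_mul [IsFiniteMeasure μ] {f f' : ℕ → X → ℝ}
    {f₀ f₀' : X → ℝ} (hf : ∀ n, AEStronglyMeasurable (f n) μ)
    (hf' : ∀ n, AEStronglyMeasurable (f' n) μ) (h : TendstoInMeasure μ f atTop f₀)
    (h' : TendstoInMeasure μ f' atTop f₀') :
    TendstoInMeasure μ (fun n x => f n x * f' n x) atTop fun x => f₀ x * f₀' x := by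
  rw [exists_seq_tendstoInMeasure_atTop_iff hf] at h
  rw [exists_seq_tendstoInMeasure_atTop_iff hf'] at h'
  refine (exists_seq_tendstoInMeasure_atTop_iff fun n => (hf n).mul (hf' n)).2 ?_
  intro ns hns
  obtain ⟨a, ha, h2⟩ := h ns hns
  obtain ⟨b, hb, h4⟩ := h' (ns ∘ a) (hns.comp ha)
  refine ⟨a ∘ b, ha.comp hb, ?_⟩
  filter_upwards [h2, h4] with x hx hx'
  exact (hx.comp hb.tendsto_atTop).mul hx'

/-- A sequence that is bounded in `L²` is uniformly integrable. -/
theorem unifIntegrable_one_of_eLpNorm_two_le {f : ℕ → X → ℝ}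
    (hf : ∀ n, AEStronglyMeasurable (f n) μ) {C : ℝ≥0∞} (hC : C ≠ ∞)
    (hbd : ∀ n, eLpNorm (f n) 2 μ ≤ C) : UnifIntegrable f 1 μ := by
  intro ε hε
  set c : ℝ := C.toReal + 1 with hc
  have hcpos : 0 < c := by positivity
  have hCc : C ≤ ENNReal.ofReal c := by
    rw [← ENNReal.ofReal_toReal hC]
    exact ENNReal.ofReal_le_ofReal (by linarith)
  refine ⟨(ε / c) ^ 2, by positivity, fun i s hs hμs => ?_⟩
  rw [eLpNorm_indicator_eq_eLpNorm_restrict hs]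
  have h1 := eLpNorm_le_eLpNorm_mul_rpow_measure_univ (p := 1) (q := 2) (by norm_num)
    ((hf i).mono_measure (Measure.restrict_le_self (s := s)))
  have h2 : (μ.restrict s Set.univ) ^ (1 / (1 : ℝ≥0∞).toReal - 1 / (2 : ℝ≥0∞).toReal) ≤
      ENNReal.ofReal (ε / c) := by
    rw [Measure.restrict_apply_univ]
    refine (ENNReal.rpow_le_rpow hμs (by norm_num)).trans (le_of_eq ?_)
    rw [ENNReal.ofReal_rpow_of_nonneg (by positivity) (by norm_num), ← Real.rpow_natCast,
      ← Real.rpow_mul (by positivity)]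
    norm_num
  calc eLpNorm (f i) 1 (μ.restrict s) ≤ _ := h1
    _ ≤ ENNReal.ofReal c * ENNReal.ofReal (ε / c) := by
        refine mul_le_mul' (((eLpNorm_mono_measure _ Measure.restrict_le_self).trans
          (hbd i)).trans hCc) h2
    _ = ENNReal.ofReal ε := by
        rw [← ENNReal.ofReal_mul hcpos.le, mul_div_cancel₀ _ hcpos.ne']

/-- If densities converge in measure and are bounded in `L²`, then the measures converge weakly and
on every measurable set. -/
theorem tendsto_withDensity_of_tendstoInMeasure [TopologicalSpace X] [OpensMeasurableSpace X]
    [IsProbabilityMeasure μ] {w : ℕ → X → ℝ} {w₀ : X → ℝ} (hw : ∀ n, AEStronglyMeasurable (w n) μ)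
    (hpos : ∀ n x, 0 ≤ w n x) (hpos₀ : ∀ x, 0 ≤ w₀ x) {C : ℝ≥0∞} (hC : C ≠ ∞)
    (hbd : ∀ n, eLpNorm (w n) 2 μ ≤ C) (hlim : TendstoInMeasure μ w atTop w₀) :
    (∀ f : X →ᵇ ℝ, Tendsto (fun n => ∫ x, f x ∂(μ.withDensity fun x => ENNReal.ofReal (w n x)))
      atTop (𝓝 (∫ x, f x ∂(μ.withDensity fun x => ENNReal.ofReal (w₀ x))))) ∧
    ∀ A : Set X, MeasurableSet A →
      Tendsto (fun n => (μ.withDensity fun x => ENNReal.ofReal (w n x)) A) atTop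
        (𝓝 ((μ.withDensity fun x => ENNReal.ofReal (w₀ x)) A)) := by
  have hw₀ : AEStronglyMeasurable w₀ μ := hlim.aestronglyMeasurable hw
  have hmem₀ : MemLp w₀ 2 μ := ⟨hw₀, (eLpNorm_le_of_tendstoInMeasure
    (Eventually.of_forall hbd) hlim hw).trans_lt hC.lt_top⟩
  have hmem : ∀ n, MemLp (w n) 2 μ := fun n => ⟨hw n, (hbd n).trans_lt hC.lt_top⟩
  have hint₀ : Integrable w₀ μ := hmem₀.integrable one_le_two
  have hint : ∀ n, Integrable (w n) μ := fun n => (hmem n).integrable one_le_two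
  have hL1 := tendsto_Lp_finite_of_tendstoInMeasure le_rfl ENNReal.one_ne_top hw
    (memLp_one_iff_integrable.2 hint₀) (unifIntegrable_one_of_eLpNorm_two_le hw hC hbd) hlim
  have hdens : ∀ v : X → ℝ, AEStronglyMeasurable v μ → (∀ x, 0 ≤ v x) → ∀ f : X →ᵇ ℝ,
      ∫ x, f x ∂(μ.withDensity fun x => ENNReal.ofReal (v x)) = ∫ x, v x * f x ∂μ :=
    fun v hv h0 f => by
      rw [integral_withDensity_eq_integral_toReal_smul₀ hv.aemeasurable.ennreal_ofReal
        (ae_of_all _ fun _ => ENNReal.ofReal_lt_top)]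
      refine integral_congr_ae (ae_of_all _ fun x => ?_)
      simp only [ENNReal.toReal_ofReal (h0 x), smul_eq_mul]
  have hset : ∀ v : X → ℝ, Integrable v μ → (∀ x, 0 ≤ v x) → ∀ A : Set X, MeasurableSet A →
      (μ.withDensity fun x => ENNReal.ofReal (v x)) A = ENNReal.ofReal (∫ x in A, v x ∂μ) :=
    fun v hv h0 A hA => by
      rw [withDensity_apply _ hA, ofReal_integral_eq_lintegral_ofReal hv.integrableOn
        (ae_of_all _ h0)]
  have hfm : ∀ f : X →ᵇ ℝ, AEStronglyMeasurable f μ := fun f =>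
    f.continuous.measurable.aestronglyMeasurable
  refine ⟨fun f => ?_, fun A hA => ?_⟩
  · rw [hdens w₀ hw₀ hpos₀]
    simp only [fun n => hdens (w n) (hw n) (hpos n) f]
    have hfi : ∀ v, Integrable v μ → Integrable (fun x => v x * f x) μ := fun v hv =>
      hv.mul_bdd (c := ‖f‖) (hfm f) (ae_of_all _ fun x => f.norm_coe_le_norm x)
    refine tendsto_integral_of_L1' _ (hfi w₀ hint₀).aestronglyMeasurable
      (Eventually.of_forall fun n => hfi _ (hint n)) ?_
    have h2 : Tendsto (fun n => ENNReal.ofReal ‖f‖ * eLpNorm (w n - w₀) 1 μ) atTop (𝓝 0) := by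
      have := ENNReal.Tendsto.const_mul (a := ENNReal.ofReal ‖f‖) hL1
        (Or.inr ENNReal.ofReal_ne_top)
      rwa [mul_zero] at this
    refine tendsto_of_tendsto_of_tendsto_of_le_of_le tendsto_const_nhds h2 (fun _ => zero_le)
      fun n => ?_
    rw [eLpNorm_one_eq_lintegral_enorm, eLpNorm_one_eq_lintegral_enorm,
      ← lintegral_const_mul' _ _ ENNReal.ofReal_ne_top]
    refine lintegral_mono fun x => ?_
    simp only [Pi.sub_apply]
    rw [← sub_mul, enorm_mul, mul_comm, ← ofReal_norm (f x)]
    exact mul_le_mul' (ENNReal.ofReal_le_ofReal (f.norm_coe_le_norm x)) le_rfl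
  · rw [hset w₀ hint₀ hpos₀ A hA]
    simp only [fun n => hset (w n) (hint n) (hpos n) A hA]
    exact ENNReal.tendsto_ofReal (tendsto_setIntegral_of_L1' _ hint₀.aestronglyMeasurable
      (Eventually.of_forall hint) hL1 A)

end Densities

/-! ### The defocusing measure -/

section Defocusing

variable {σ : ℝ} {μ : Measure (HSob (-σ))} [IsProbabilityMeasure μ]

/-- The limit of the random series in `L^q(ℝ)`: its norm is the `L^q` norm of the random
distribution, and it is the limit of the smooth truncations. -/
theorem exists_limit_Lq {q : ℕ} (hq : 4 ≤ q) [Fact (1 ≤ (q : ℝ≥0∞))]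
    (hγ : ∀ n, HasLaw (normCoeff σ n) stdComplexGaussian μ) (hind : iIndepFun (normCoeff σ) μ)
    {χ : ℝ → ℝ} {W : ℝ} (hW : ∀ x, |χ x| ≤ W) (hχs : tsupport χ ⊆ Set.Ioo (-1) 1)
    (hχ1 : ∀ x ∈ Set.Icc (-(1 / 2) : ℝ) (1 / 2), χ x = 1) :
    ∃ F : HSob (-σ) → Lp ℂ (q : ℝ≥0∞) (volume : Measure ℝ), AEStronglyMeasurable F μ ∧
      (∀ᵐ u ∂μ, distLpNorm q u.toDist = ‖F u‖ₑ) ∧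
      TendstoInMeasure μ (fun N u => ∫ x, ‖SN χ N u x‖ ^ q) atTop fun u => ‖F u‖ ^ q := by
  obtain ⟨F, hF, hlim⟩ := exists_tendsto_eLpNorm_multSumLp_range hq hγ hind
  have hq0 : q ≠ 0 := by omega
  refine ⟨F, hF.aestronglyMeasurable, ?_, ?_⟩
  · have h1 := tendstoInMeasure_of_tendsto_eLpNorm (by exact_mod_cast hq0)
      (fun N => aestronglyMeasurable_multSumLp _ _ _) hF.aestronglyMeasurable hlim
    obtain ⟨ns, hns, h2⟩ := h1.exists_seq_tendsto_ae
    filter_upwards [h2] with u hu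
    rw [← toTemperedDistributionCLM_eq_of_tendsto hns.tendsto_atTop hu, distLpNorm_eq_enorm]
  · have h1 := tendstoInMeasure_of_tendsto_eLpNorm (by exact_mod_cast hq0)
      (fun N => aestronglyMeasurable_multSumLp _ _ _) hF.aestronglyMeasurable
      (tendsto_eLpNorm_multSumLp_cutoff hq hγ hind hW hχ1 hF.aestronglyMeasurable hlim)
    have h2 := tendstoInMeasure_continuous_comp
      (fun N => aestronglyMeasurable_multSumLp _ _ _) h1 (continuous_norm.pow q)
    refine h2.congr_left fun N => ae_of_all _ fun u => ?_
    simp only [Pi.pow_apply]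
    rw [norm_multSumLp_pow hq0]
    simp only [SN_eq_multSum hχs]

/-- The defocusing measure. The truncated densities are at most `1`, and the limit density is
positive almost surely because the `L^{k+1}` norm is finite. -/
theorem defocusing_conclusions (hγ : ∀ n, HasLaw (normCoeff σ n) stdComplexGaussian μ)
    (hind : iIndepFun (normCoeff σ) μ)
    {χ : ℝ → ℝ} {W : ℝ} (hW : ∀ x, |χ x| ≤ W) (hχs : tsupport χ ⊆ Set.Ioo (-1) 1)
    (hχ1 : ∀ x ∈ Set.Icc (-(1 / 2) : ℝ) (1 / 2), χ x = 1) {k : ℕ} (hk : 3 ≤ k) :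
    (AEMeasurable (fun u : HSob (-σ) => distLpNorm (k + 1) u.toDist) μ ∧
        ∀ᵐ u ∂μ, distLpNorm (k + 1) u.toDist < ∞) ∧
      (0 < (μ.withDensity fun u => ENNReal.ofReal (defocWeight σ k u)) Set.univ ∧
        (μ.withDensity fun u => ENNReal.ofReal (defocWeight σ k u)) Set.univ < ∞) ∧
      (∀ f : HSob (-σ) →ᵇ ℝ,
        Tendsto (fun N => ∫ u, f u ∂(μ.withDensity fun u => ENNReal.ofReal
            (Real.exp (-((∫ x, ‖SN χ N u x‖ ^ (k + 1)) / (k + 1)))))) atTop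
          (𝓝 (∫ u, f u ∂(μ.withDensity fun u => ENNReal.ofReal (defocWeight σ k u))))) ∧
      (∀ A : Set (HSob (-σ)), MeasurableSet A →
        Tendsto (fun N => (μ.withDensity fun u => ENNReal.ofReal
            (Real.exp (-((∫ x, ‖SN χ N u x‖ ^ (k + 1)) / (k + 1))))) A) atTop
          (𝓝 ((μ.withDensity fun u => ENNReal.ofReal (defocWeight σ k u)) A))) := by
  have hfact : Fact (1 ≤ ((k + 1 : ℕ) : ℝ≥0∞)) := ⟨by exact_mod_cast Nat.succ_pos k⟩
  obtain ⟨F, hFm, hFd', hFlim⟩ := exists_limit_Lq (q := k + 1) (by omega) hγ hind hW hχs hχ1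
  have hcast : ((k + 1 : ℕ) : ℝ≥0∞) = (k : ℝ≥0∞) + 1 := by push_cast; rfl
  have hFd : ∀ᵐ u ∂μ, distLpNorm (k + 1) u.toDist = ‖F u‖ₑ :=
    hFd'.mono fun u hu => by rw [← hu, hcast]
  have hwt : ∀ᵐ u ∂μ, defocWeight σ k u = Real.exp (-(‖F u‖ ^ (k + 1) / (k + 1))) := by
    filter_upwards [hFd] with u hu
    rw [defocWeight, hu, if_neg enorm_ne_top, toReal_enorm]
  have hpos : ∀ᵐ u ∂μ, 0 < defocWeight σ k u := hwt.mono fun u hu => hu ▸ Real.exp_pos _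
  have hnn : ∀ u, 0 ≤ defocWeight σ k u := fun u => by
    rw [defocWeight]
    split_ifs
    · exact le_rfl
    · exact (Real.exp_pos _).le
  have hφ : Continuous fun y : ℝ => Real.exp (-(y / (k + 1))) := by fun_prop
  have hSm : ∀ N, Measurable fun u : HSob (-σ) => ∫ x, ‖SN χ N u x‖ ^ (k + 1) := fun N =>
    measurable_integral_SN_pow hχs N (k + 1)
  have hlim : TendstoInMeasure μ (fun N u => Real.exp (-((∫ x, ‖SN χ N u x‖ ^ (k + 1)) /
      (k + 1)))) atTop (defocWeight σ k) :=
    (tendstoInMeasure_continuous_comp (fun N => (hSm N).aestronglyMeasurable) hFlim hφ).congr_right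
      (hwt.mono fun u hu => hu.symm)
  have hwm : ∀ N, AEStronglyMeasurable (fun u : HSob (-σ) =>
      Real.exp (-((∫ x, ‖SN χ N u x‖ ^ (k + 1)) / (k + 1)))) μ := fun N =>
    (hφ.measurable.comp (hSm N)).aestronglyMeasurable
  have hbd : ∀ N, eLpNorm (fun u : HSob (-σ) =>
      Real.exp (-((∫ x, ‖SN χ N u x‖ ^ (k + 1)) / (k + 1)))) 2 μ ≤ 1 := fun N => by
    refine (eLpNorm_le_of_ae_bound (C := 1) (ae_of_all _ fun u => ?_)).trans ?_
    · rw [Real.norm_of_nonneg (Real.exp_pos _).le, Real.exp_le_one_iff, neg_nonpos]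
      exact div_nonneg (integral_nonneg fun x => by positivity) (by positivity)
    · simp
  have hm₀ : AEMeasurable (defocWeight σ k) μ := (hlim.aestronglyMeasurable hwm).aemeasurable
  refine ⟨⟨hFm.enorm.congr (hFd.mono fun u hu => hu.symm), ?_⟩, ⟨?_, ?_⟩,
    tendsto_withDensity_of_tendstoInMeasure hwm (fun N u => (Real.exp_pos _).le) hnn
      ENNReal.one_ne_top hbd hlim⟩
  · filter_upwards [hFd] with u hu
    rw [hu]
    exact enorm_lt_top
  · rw [withDensity_apply _ MeasurableSet.univ, Measure.restrict_univ, pos_iff_ne_zero, Ne,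
      lintegral_eq_zero_iff' hm₀.ennreal_ofReal]
    intro h0
    have hF : ∀ᵐ u ∂μ, False := by
      filter_upwards [h0, hpos] with u h1 h2
      exact absurd (ENNReal.ofReal_eq_zero.1 h1) (not_le.2 h2)
    rw [ae_iff] at hF
    simp at hF
  · rw [withDensity_apply _ MeasurableSet.univ, Measure.restrict_univ]
    refine (lintegral_mono_ae (g := fun _ => 1) ?_).trans_lt (by simp)
    filter_upwards [hwt] with u hu
    rw [hu, ← ENNReal.ofReal_one]
    refine ENNReal.ofReal_le_ofReal ?_
    rw [Real.exp_le_one_iff, neg_nonpos]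
    positivity

end Defocusing

/-! ### Deviation estimates for the quartic potential energy -/

section Quartic

variable {σ : ℝ}

/-- The mass `∑_{n ∈ s} |c_n|²` carried by the frequencies in `s`. -/
def mass (s : Finset ℕ) (u : HSob (-σ)) : ℝ := ∑ n ∈ s, ‖coeff n u.toDist‖ ^ 2

theorem mass_nonneg (s : Finset ℕ) (u : HSob (-σ)) : 0 ≤ mass s u :=
  Finset.sum_nonneg fun _ _ => sq_nonneg _

theorem mass_mono {s t : Finset ℕ} (h : s ⊆ t) (u : HSob (-σ)) : mass s u ≤ mass t u :=
  Finset.sum_le_sum_of_subset_of_nonneg h fun _ _ _ => sq_nonneg _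

theorem measurable_mass (s : Finset ℕ) : Measurable (mass (σ := σ) s) :=
  Finset.measurable_fun_sum _ fun n _ => (HSob.measurable_coeff n).norm.pow_const 2

theorem integrable_norm_multSum_pow (w : ℕ → ℝ) (s : Finset ℕ) (u : HSob (-σ)) {q : ℕ}
    (hq : 1 ≤ q) : Integrable fun x => ‖multSum w s u x‖ ^ q := by
  have : Fact (1 ≤ (q : ℝ≥0∞)) := ⟨by exact_mod_cast hq⟩
  exact ((memLp_congr_ae (coeFn_multSumLp (q : ℝ≥0∞) w s u)).1 (Lp.memLp _)).integrable_norm_pow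
    (by omega)

theorem integral_norm_multSum_sq_le {w : ℕ → ℝ} {s : Finset ℕ} {W : ℝ}
    (hw : ∀ n ∈ s, |w n| ≤ W) (u : HSob (-σ)) :
    ∫ x, ‖multSum w s u x‖ ^ 2 ≤ W ^ 2 * mass s u := by
  refine (integral_normSq_hermite_sum s fun n => (w n : ℂ) * coeff n u.toDist).le.trans ?_
  rw [mass, Finset.mul_sum]
  refine Finset.sum_le_sum fun n hn => ?_
  rw [norm_mul, mul_pow, Complex.norm_real, Real.norm_eq_abs]
  gcongr
  exact hw n hn

/-- Bernstein's inequality: by Cauchy–Schwarz, the sup norm of a sum of low frequencies is bounded by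
its mass. -/
theorem norm_multSum_sq_le {w : ℕ → ℝ} {s : Finset ℕ} {W : ℝ} {M : ℕ}
    (hw : ∀ n ∈ s, |w n| ≤ W) (hs : s ⊆ Finset.range (M + 1)) (u : HSob (-σ)) (x : ℝ) :
    ‖multSum w s u x‖ ^ 2 ≤ W ^ 2 * mass s u * (4 * √(M + 1)) := by
  have h1 : ‖multSum w s u x‖ ≤ ∑ n ∈ s, (|w n| * ‖coeff n u.toDist‖) * |hermiteFun n x| := by
    refine (norm_sum_le _ _).trans (Finset.sum_le_sum fun n _ => ?_)
    rw [norm_mul, norm_mul, Complex.norm_real, Complex.norm_real, Real.norm_eq_abs,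
      Real.norm_eq_abs]
  have h2 := Finset.sum_mul_sq_le_sq_mul_sq s (fun n => |w n| * ‖coeff n u.toDist‖)
    fun n => |hermiteFun n x|
  have h3 : ∑ n ∈ s, (|w n| * ‖coeff n u.toDist‖) ^ 2 ≤ W ^ 2 * mass s u := by
    rw [mass, Finset.mul_sum]
    refine Finset.sum_le_sum fun n hn => ?_
    rw [mul_pow]
    gcongr
    exact hw n hn
  have h4 : ∑ n ∈ s, |hermiteFun n x| ^ 2 ≤ 4 * √(M + 1) := by
    simp only [sq_abs]
    exact (Finset.sum_le_sum_of_subset_of_nonneg hs fun _ _ _ => sq_nonneg _).trans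
      (sum_range_hermiteFun_sq_le M x)
  calc ‖multSum w s u x‖ ^ 2
      ≤ (∑ n ∈ s, (|w n| * ‖coeff n u.toDist‖) * |hermiteFun n x|) ^ 2 := by gcongr
    _ ≤ _ := h2
    _ ≤ _ := mul_le_mul h3 h4 (Finset.sum_nonneg fun _ _ => sq_nonneg _)
        (mul_nonneg (sq_nonneg _) (mass_nonneg _ _))

/-- The quartic energy of low frequencies is bounded by their mass. -/
theorem integral_norm_multSum_pow_four_le {w : ℕ → ℝ} {s : Finset ℕ} {W : ℝ} {M : ℕ}
    (hw : ∀ n ∈ s, |w n| ≤ W) (hs : s ⊆ Finset.range (M + 1)) (u : HSob (-σ)) :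
    ∫ x, ‖multSum w s u x‖ ^ 4 ≤ 4 * √(M + 1) * (W ^ 2 * mass s u) ^ 2 := by
  have h0 : 0 ≤ W ^ 2 * mass s u := mul_nonneg (sq_nonneg _) (mass_nonneg _ _)
  calc ∫ x, ‖multSum w s u x‖ ^ 4
      ≤ ∫ x, W ^ 2 * mass s u * (4 * √(M + 1)) * ‖multSum w s u x‖ ^ 2 := by
        refine integral_mono (integrable_norm_multSum_pow w s u (by norm_num))
          ((integrable_norm_multSum_pow w s u (by norm_num)).const_mul _) fun x => ?_
        have := mul_le_mul_of_nonneg_right (norm_multSum_sq_le hw hs u x)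
          (sq_nonneg ‖multSum w s u x‖)
        calc ‖multSum w s u x‖ ^ 4 = ‖multSum w s u x‖ ^ 2 * ‖multSum w s u x‖ ^ 2 := by ring
          _ ≤ _ := this
    _ = W ^ 2 * mass s u * (4 * √(M + 1)) * ∫ x, ‖multSum w s u x‖ ^ 2 := integral_const_mul _ _
    _ ≤ W ^ 2 * mass s u * (4 * √(M + 1)) * (W ^ 2 * mass s u) := by
        gcongr
        exact integral_norm_multSum_sq_le hw u
    _ = _ := by ring

/-- Jensen's inequality for the exponential and the measure `|f|² dx`, whose mass is at most `A`,
in the form given by the tangent of the exponential at the mean. -/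
theorem exp_integral_pow_four_le {f : ℝ → ℝ} {A p : ℝ} (hp : 0 ≤ p)
    (h2 : Integrable fun x => f x ^ 2) (h4 : Integrable fun x => f x ^ 4)
    (he : Integrable fun x => f x ^ 4 * Real.exp (p * A * f x ^ 2)) (hA : ∫ x, f x ^ 2 ≤ A) :
    Real.exp (p * ∫ x, f x ^ 4) ≤ 1 + p * ∫ x, f x ^ 4 * Real.exp (p * A * f x ^ 2) := by
  set m := ∫ x, f x ^ 2 with hm
  set y := p * ∫ x, f x ^ 4 with hy
  have hm0 : 0 ≤ m := integral_nonneg fun x => sq_nonneg _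
  rcases hm0.eq_or_lt with h0 | hmpos
  · have hz : ∀ᵐ x, f x ^ 2 = 0 :=
      (integral_eq_zero_iff_of_nonneg (fun x => sq_nonneg _) h2).1 h0.symm
    have h40 : ∫ x, f x ^ 4 = 0 := by
      rw [integral_congr_ae (g := fun _ => (0 : ℝ)), integral_zero]
      filter_upwards [hz] with x hx
      rw [show f x ^ 4 = (f x ^ 2) ^ 2 by ring, hx]
      simp
    rw [hy, h40, mul_zero, Real.exp_zero, le_add_iff_nonneg_right]
    exact mul_nonneg hp (integral_nonneg fun x => by positivity)
  · have hpt : ∀ x, Real.exp y * ((1 - y) * f x ^ 2 + p * m * f x ^ 4) ≤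
        f x ^ 2 + p * m * (f x ^ 4 * Real.exp (p * A * f x ^ 2)) := fun x => by
      set z := p * m * f x ^ 2 with hz
      have hz0 : 0 ≤ z := by positivity
      -- the tangent of the exponential at `y` lies below its graph
      have t1 : Real.exp y * (1 - y + z) ≤ Real.exp z := by
        have := Real.add_one_le_exp (z - y)
        rw [Real.exp_sub, le_div_iff₀ (Real.exp_pos _)] at this
        linarith
      have t2 : Real.exp z ≤ 1 + z * Real.exp z := by
        have := Real.add_one_le_exp (-z)
        rw [Real.exp_neg] at this
        have hE := Real.exp_pos z
        have h3 : (-z + 1) * Real.exp z ≤ 1 := by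
          calc (-z + 1) * Real.exp z ≤ (Real.exp z)⁻¹ * Real.exp z := by gcongr
            _ = 1 := inv_mul_cancel₀ hE.ne'
        linarith
      have t3 : Real.exp z ≤ Real.exp (p * A * f x ^ 2) := by
        rw [Real.exp_le_exp, hz]
        gcongr
      have t4 : Real.exp y * (1 - y + z) ≤ 1 + z * Real.exp (p * A * f x ^ 2) :=
        t1.trans (t2.trans (by gcongr))
      have := mul_le_mul_of_nonneg_left t4 (sq_nonneg (f x))
      calc Real.exp y * ((1 - y) * f x ^ 2 + p * m * f x ^ 4)
          = f x ^ 2 * (Real.exp y * (1 - y + z)) := by rw [hz]; ring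
        _ ≤ _ := this
        _ = _ := by rw [hz]; ring
    have hint := integral_mono ((((h2.const_mul (1 - y)).add (h4.const_mul (p * m)))).const_mul
      (Real.exp y)) (h2.add (he.const_mul (p * m))) hpt
    simp only [Pi.add_apply] at hint
    rw [integral_const_mul, integral_add (h2.const_mul _) (h4.const_mul _),
      integral_add h2 (he.const_mul _), integral_const_mul, integral_const_mul,
      integral_const_mul, ← hm] at hint
    have e1 : (1 - y) * m + p * m * ∫ x, f x ^ 4 = m := by rw [hy]; ring
    rw [e1] at hint
    refine le_of_mul_le_mul_right ?_ hmpos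
    calc Real.exp y * m ≤ _ := hint
      _ = _ := by ring

/-- Hölder's inequality with respect to the finite measure `φ² dx`. -/
theorem lintegral_pow_le_of_majorant {f φ : ℝ → ℝ} (hf : Measurable f) (hφ : Measurable φ)
    (hφ0 : ∀ x, 0 < φ x) (hφi : Integrable fun x => φ x ^ 2) {m : ℕ} (hm : 1 ≤ m) :
    (∫⁻ x, ENNReal.ofReal (f x ^ 4)) ^ m ≤ ENNReal.ofReal (∫ x, φ x ^ 2) ^ (m - 1) *
      ∫⁻ x, ENNReal.ofReal (f x ^ (4 * m) * (φ x ^ (2 * (m - 1)))⁻¹) := by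
  have hm0 : m ≠ 0 := by omega
  set ν : Measure ℝ := volume.withDensity fun x => ENNReal.ofReal (φ x ^ 2) with hν
  have hd : Measurable fun x => ENNReal.ofReal (φ x ^ 2) := by fun_prop
  have hg : Measurable fun x => f x ^ 4 / φ x ^ 2 := by fun_prop
  have huniv : ν Set.univ = ENNReal.ofReal (∫ x, φ x ^ 2) := by
    rw [hν, withDensity_apply _ MeasurableSet.univ, Measure.restrict_univ,
      ofReal_integral_eq_lintegral_ofReal hφi (ae_of_all _ fun x => sq_nonneg _)]
  have h1 : eLpNorm (fun x => f x ^ 4 / φ x ^ 2) 1 ν = ∫⁻ x, ENNReal.ofReal (f x ^ 4) := by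
    rw [eLpNorm_one_eq_lintegral_enorm, hν,
      lintegral_withDensity_eq_lintegral_mul _ hd (by fun_prop)]
    refine lintegral_congr fun x => ?_
    have := hφ0 x
    rw [Pi.mul_apply, ← ofReal_norm, ← ENNReal.ofReal_mul (by positivity),
      Real.norm_of_nonneg (by positivity)]
    congr 1
    field_simp
  have h2 : eLpNorm (fun x => f x ^ 4 / φ x ^ 2) (m : ℝ≥0∞) ν ^ m =
      ∫⁻ x, ENNReal.ofReal (f x ^ (4 * m) * (φ x ^ (2 * (m - 1)))⁻¹) := by
    rw [eLpNorm_natCast_pow hm0, hν, lintegral_withDensity_eq_lintegral_mul _ hd (by fun_prop)]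
    refine lintegral_congr fun x => ?_
    have := hφ0 x
    rw [Pi.mul_apply, enorm_pow_eq_ofReal, ← ENNReal.ofReal_mul (by positivity),
      Real.norm_of_nonneg (by positivity)]
    congr 1
    obtain ⟨j, rfl⟩ := Nat.exists_eq_add_of_le' hm
    rw [Nat.add_sub_cancel, div_pow, ← pow_mul, ← pow_mul]
    field_simp
    ring
  have h3 := eLpNorm_le_eLpNorm_mul_rpow_measure_univ (μ := ν) (p := 1) (q := (m : ℝ≥0∞))
    (by exact_mod_cast hm) hg.aestronglyMeasurable
  rw [h1, huniv] at h3
  refine (pow_le_pow_left' h3 m).trans (le_of_eq ?_)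
  rw [mul_pow, h2, mul_comm]
  congr 1
  rw [← ENNReal.rpow_natCast, ← ENNReal.rpow_mul, ← ENNReal.rpow_natCast]
  congr 1
  have : (m : ℝ) ≠ 0 := Nat.cast_ne_zero.2 hm0
  rw [Nat.cast_sub hm]
  simp
  field_simp

theorem exists_norm_multSum_sq_le (w : ℕ → ℝ) (s : Finset ℕ) (u : HSob (-σ)) :
    ∃ B, ∀ x, ‖multSum w s u x‖ ^ 2 ≤ B :=
  ⟨_, fun x => norm_multSum_sq_le (W := ∑ n ∈ s, |w n|)
    (fun _ hn => Finset.single_le_sum (f := fun n => |w n|) (fun _ _ => abs_nonneg _) hn)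
    (Finset.subset_range_sup_succ s) u x⟩

theorem integrable_norm_multSum_pow_four_mul_exp (w : ℕ → ℝ) (s : Finset ℕ) (u : HSob (-σ))
    {t : ℝ} (ht : 0 ≤ t) :
    Integrable fun x => ‖multSum w s u x‖ ^ 4 * Real.exp (t * ‖multSum w s u x‖ ^ 2) := by
  obtain ⟨B, hB⟩ := exists_norm_multSum_sq_le w s u
  have hc := continuous_multSum w s u
  refine (integrable_norm_multSum_pow w s u (by norm_num)).mul_bdd (c := Real.exp (t * B))
    (by fun_prop) (ae_of_all _ fun x => ?_)
  rw [Real.norm_of_nonneg (Real.exp_pos _).le, Real.exp_le_exp]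
  exact mul_le_mul_of_nonneg_left (hB x) ht

variable {μ : Measure (HSob (-σ))} [IsProbabilityMeasure μ]

/-- Large deviations of the energy of a random sum of small pointwise variance, on the event that
its mass is at most `A`. -/
theorem measure_mass_le_inter_energy_ge_le
    (hγ : ∀ n, HasLaw (normCoeff σ n) stdComplexGaussian μ) (hind : iIndepFun (normCoeff σ) μ)
    {w : ℕ → ℝ} {s : Finset ℕ} {D : ℝ} (hD : 0 ≤ D)
    (hK : ∀ x, ∑ n ∈ s, (w n * √(coeffVar n) * hermiteFun n x) ^ 2 ≤ D * greenMajorant x)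
    {p A : ℝ} (hp : 0 ≤ p) (hA : 0 ≤ A) (hpA : p * A * D ≤ 1 / 8) (y : ℝ) :
    μ {u | ∫ x, ‖multSum w s u x‖ ^ 2 ≤ A ∧ y ≤ ∫ x, ‖multSum w s u x‖ ^ 4} ≤
      ENNReal.ofReal (Real.exp (-(p * y))) *
        (1 + ENNReal.ofReal (p * (128 * D ^ 2 * ∫ x, greenMajorant x ^ 2)) * gaussConst) := by
  have hpA0 : 0 ≤ p * A := mul_nonneg hp hA
  have hjm : Measurable fun q : HSob (-σ) × ℝ => ENNReal.ofReal (‖multSum w s q.1 q.2‖ ^ 4 *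
      Real.exp (p * A * ‖multSum w s q.1 q.2‖ ^ 2)) := by
    have := measurable_multSum_uncurry (σ := σ) w s
    fun_prop
  set Z : HSob (-σ) → ℝ≥0∞ := fun u => 1 + ENNReal.ofReal p * ∫⁻ x, ENNReal.ofReal
    (‖multSum w s u x‖ ^ 4 * Real.exp (p * A * ‖multSum w s u x‖ ^ 2)) with hZ
  have hmi : Measurable fun u : HSob (-σ) => ∫⁻ x, ENNReal.ofReal
      (‖multSum w s u x‖ ^ 4 * Real.exp (p * A * ‖multSum w s u x‖ ^ 2)) :=
    hjm.lintegral_prod_right'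
  have hZm : Measurable Z := (hmi.const_mul _).const_add 1
  have hsub : {u : HSob (-σ) | ∫ x, ‖multSum w s u x‖ ^ 2 ≤ A ∧ y ≤ ∫ x, ‖multSum w s u x‖ ^ 4} ⊆
      {u | ENNReal.ofReal (Real.exp (p * y)) ≤ Z u} := fun u hu => by
    have hi := integrable_norm_multSum_pow_four_mul_exp w s u hpA0
    have h1 := exp_integral_pow_four_le (f := fun x => ‖multSum w s u x‖) hp
      (integrable_norm_multSum_pow w s u (by norm_num))
      (integrable_norm_multSum_pow w s u (by norm_num)) hi hu.1
    have h2 : Real.exp (p * y) ≤ Real.exp (p * ∫ x, ‖multSum w s u x‖ ^ 4) := by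
      rw [Real.exp_le_exp]
      exact mul_le_mul_of_nonneg_left hu.2 hp
    have hn : 0 ≤ ∫ x, ‖multSum w s u x‖ ^ 4 * Real.exp (p * A * ‖multSum w s u x‖ ^ 2) :=
      integral_nonneg fun x => by positivity
    change ENNReal.ofReal (Real.exp (p * y)) ≤ 1 + ENNReal.ofReal p * _
    rw [← ofReal_integral_eq_lintegral_ofReal hi (ae_of_all _ fun x => by positivity),
      ← ENNReal.ofReal_mul hp, ← ENNReal.ofReal_one, ← ENNReal.ofReal_add zero_le_one
        (mul_nonneg hp hn)]
    exact ENNReal.ofReal_le_ofReal (h2.trans h1)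
  have hE : ∫⁻ u, Z u ∂μ ≤
      1 + ENNReal.ofReal (p * (128 * D ^ 2 * ∫ x, greenMajorant x ^ 2)) * gaussConst := by
    rw [hZ, lintegral_add_left measurable_const, lintegral_const, measure_univ, mul_one,
      lintegral_const_mul _ hmi, ENNReal.ofReal_mul hp, mul_assoc]
    refine add_le_add le_rfl (mul_le_mul' le_rfl ?_)
    rw [lintegral_lintegral_swap hjm.aemeasurable]
    have hpt : ∀ x, ∫⁻ u, ENNReal.ofReal (‖multSum w s u x‖ ^ 4 *
        Real.exp (p * A * ‖multSum w s u x‖ ^ 2)) ∂μ ≤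
        ENNReal.ofReal (128 * D ^ 2 * greenMajorant x ^ 2) * gaussConst := fun x => by
      simp only [multSum_eq]
      have hφ := greenMajorant_pos x
      have hK0 : 0 ≤ ∑ n ∈ s, (w n * √(coeffVar n) * hermiteFun n x) ^ 2 :=
        Finset.sum_nonneg fun _ _ => sq_nonneg _
      refine (lintegral_norm_sum_pow_four_mul_exp_le hγ hind _ s hpA0 ?_).trans ?_
      · calc p * A * ∑ n ∈ s, (w n * √(coeffVar n) * hermiteFun n x) ^ 2
            ≤ p * A * (D * 1) := by
              gcongr
              exact (hK x).trans (by gcongr; exact greenMajorant_le_one x)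
          _ ≤ 1 / 8 := by rwa [mul_one]
      · refine mul_le_mul' (ENNReal.ofReal_le_ofReal ?_) le_rfl
        calc 128 * (∑ n ∈ s, (w n * √(coeffVar n) * hermiteFun n x) ^ 2) ^ 2
            ≤ 128 * (D * greenMajorant x) ^ 2 := by
              gcongr
              exact hK x
          _ = _ := by ring
    refine (lintegral_mono hpt).trans (le_of_eq ?_)
    rw [lintegral_mul_const' _ _ gaussConst_ne_top,
      ← ofReal_integral_eq_lintegral_ofReal (integrable_greenMajorant_sq.const_mul _)
      (ae_of_all _ fun x => by positivity), integral_const_mul]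
  have hmarkov := mul_meas_ge_le_lintegral₀ hZm.aemeasurable (μ := μ)
    (ENNReal.ofReal (Real.exp (p * y)))
  have h1 : ENNReal.ofReal (Real.exp (-(p * y))) * ENNReal.ofReal (Real.exp (p * y)) = 1 := by
    rw [← ENNReal.ofReal_mul (Real.exp_pos _).le, ← Real.exp_add, neg_add_cancel, Real.exp_zero,
      ENNReal.ofReal_one]
  calc μ {u | ∫ x, ‖multSum w s u x‖ ^ 2 ≤ A ∧ y ≤ ∫ x, ‖multSum w s u x‖ ^ 4}
      ≤ μ {u | ENNReal.ofReal (Real.exp (p * y)) ≤ Z u} := measure_mono hsub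
    _ = ENNReal.ofReal (Real.exp (-(p * y))) * (ENNReal.ofReal (Real.exp (p * y)) *
        μ {u | ENNReal.ofReal (Real.exp (p * y)) ≤ Z u}) := by rw [← mul_assoc, h1, one_mul]
    _ ≤ _ := mul_le_mul' le_rfl (hmarkov.trans hE)

theorem integral_greenMajorant_sq_pos : 0 < ∫ x, greenMajorant x ^ 2 := by
  rw [integral_pos_iff_support_of_nonneg (fun x => sq_nonneg _) integrable_greenMajorant_sq]
  have : (Function.support fun x => greenMajorant x ^ 2) = Set.univ :=
    Set.eq_univ_of_forall fun x => (pow_pos (greenMajorant_pos x) 2).ne'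
  rw [this]
  simp

/-- Tails of the energy of a random sum, from its moment of order `m`. -/
theorem measure_energy_ge_le
    (hγ : ∀ n, HasLaw (normCoeff σ n) stdComplexGaussian μ) (hind : iIndepFun (normCoeff σ) μ)
    {w : ℕ → ℝ} {s : Finset ℕ} {D : ℝ} (hD : 0 ≤ D)
    (hK : ∀ x, ∑ n ∈ s, (w n * √(coeffVar n) * hermiteFun n x) ^ 2 ≤ D * greenMajorant x)
    {m : ℕ} (hm : 1 ≤ m) {y : ℝ} (hy : 0 < y) :
    μ {u | y ≤ ∫ x, ‖multSum w s u x‖ ^ 4} ≤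
      ENNReal.ofReal ((64 * m ^ 2 * D ^ 2 * (∫ x, greenMajorant x ^ 2) / y) ^ m) *
        gaussConst := by
  set I := ∫ x, greenMajorant x ^ 2 with hI
  have hI0 : 0 ≤ I := integral_greenMajorant_sq_pos.le
  have hms := measurable_multSum_uncurry (σ := σ) w s
  have hYm : Measurable fun u : HSob (-σ) => ∫⁻ x, ENNReal.ofReal (‖multSum w s u x‖ ^ 4) :=
    (hms.norm.pow_const 4).ennreal_ofReal.lintegral_prod_right'
  have hφm := continuous_greenMajorant.measurable
  have hjm : Measurable fun q : HSob (-σ) × ℝ => ENNReal.ofReal (‖multSum w s q.1 q.2‖ ^ (4 * m) *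
      (greenMajorant q.2 ^ (2 * (m - 1)))⁻¹) := by
    fun_prop
  have hsub : {u : HSob (-σ) | y ≤ ∫ x, ‖multSum w s u x‖ ^ 4} ⊆
      {u | ENNReal.ofReal (y ^ m) ≤ (∫⁻ x, ENNReal.ofReal (‖multSum w s u x‖ ^ 4)) ^ m} :=
    fun u hu => by
      rw [Set.mem_ofPred_eq, ENNReal.ofReal_pow hy.le,
        ← ofReal_integral_eq_lintegral_ofReal (integrable_norm_multSum_pow w s u (by norm_num))
          (ae_of_all _ fun x => by positivity)]
      exact pow_le_pow_left' (ENNReal.ofReal_le_ofReal hu) m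
  have hpt : ∀ x, ∫⁻ u, ENNReal.ofReal (‖multSum w s u x‖ ^ (4 * m) *
      (greenMajorant x ^ (2 * (m - 1)))⁻¹) ∂μ ≤
      ENNReal.ofReal ((8 * m * D) ^ (2 * m) * greenMajorant x ^ 2) * gaussConst := fun x => by
    have hφ := greenMajorant_pos x
    have hφi : 0 ≤ (greenMajorant x ^ (2 * (m - 1)))⁻¹ := by positivity
    have hK0 : 0 ≤ ∑ n ∈ s, (w n * √(coeffVar n) * hermiteFun n x) ^ 2 :=
      Finset.sum_nonneg fun _ _ => sq_nonneg _
    simp only [ENNReal.ofReal_mul' hφi, multSum_eq]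
    rw [lintegral_mul_const' _ _ ENNReal.ofReal_ne_top, show 4 * m = 2 * (2 * m) by ring]
    refine (mul_le_mul' (lintegral_norm_sum_pow_two_mul_le hγ hind _ s (2 * m)) le_rfl).trans ?_
    rw [mul_right_comm, ← ENNReal.ofReal_mul' hφi]
    refine mul_le_mul' (ENNReal.ofReal_le_ofReal ?_) le_rfl
    calc (4 * ((2 * m : ℕ) : ℝ) * ∑ n ∈ s, (w n * √(coeffVar n) * hermiteFun n x) ^ 2) ^ (2 * m) *
          (greenMajorant x ^ (2 * (m - 1)))⁻¹
        ≤ (4 * ((2 * m : ℕ) : ℝ) * (D * greenMajorant x)) ^ (2 * m) *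
          (greenMajorant x ^ (2 * (m - 1)))⁻¹ := by
          gcongr
          exact hK x
      _ = (8 * m * D) ^ (2 * m) * greenMajorant x ^ 2 := by
          obtain ⟨j, rfl⟩ := Nat.exists_eq_add_of_le' hm
          rw [Nat.add_sub_cancel, show 4 * ((2 * (j + 1) : ℕ) : ℝ) * (D * greenMajorant x) =
            (8 * ((j + 1 : ℕ) : ℝ) * D) * greenMajorant x by push_cast; ring, mul_pow,
            show 2 * (j + 1) = 2 * j + 2 by ring, pow_add (greenMajorant x)]
          field_simp
  have hE : ∫⁻ u, (∫⁻ x, ENNReal.ofReal (‖multSum w s u x‖ ^ 4)) ^ m ∂μ ≤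
      ENNReal.ofReal ((64 * m ^ 2 * D ^ 2 * I) ^ m) * gaussConst := by
    calc ∫⁻ u, (∫⁻ x, ENNReal.ofReal (‖multSum w s u x‖ ^ 4)) ^ m ∂μ
        ≤ ∫⁻ u, ENNReal.ofReal I ^ (m - 1) * (∫⁻ x, ENNReal.ofReal (‖multSum w s u x‖ ^ (4 * m) *
            (greenMajorant x ^ (2 * (m - 1)))⁻¹)) ∂μ :=
          lintegral_mono fun u => lintegral_pow_le_of_majorant
            (continuous_multSum w s u).norm.measurable hφm greenMajorant_pos
            integrable_greenMajorant_sq hm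
      _ = ENNReal.ofReal I ^ (m - 1) * ∫⁻ u, (∫⁻ x, ENNReal.ofReal (‖multSum w s u x‖ ^ (4 * m) *
            (greenMajorant x ^ (2 * (m - 1)))⁻¹)) ∂μ :=
          lintegral_const_mul _ hjm.lintegral_prod_right'
      _ ≤ ENNReal.ofReal I ^ (m - 1) *
            ∫⁻ x, ENNReal.ofReal ((8 * m * D) ^ (2 * m) * greenMajorant x ^ 2) * gaussConst := by
          rw [lintegral_lintegral_swap hjm.aemeasurable]
          exact mul_le_mul' le_rfl (lintegral_mono hpt)
      _ = ENNReal.ofReal ((64 * m ^ 2 * D ^ 2 * I) ^ m) * gaussConst := by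
          rw [lintegral_mul_const' _ _ gaussConst_ne_top, ← ofReal_integral_eq_lintegral_ofReal
            (integrable_greenMajorant_sq.const_mul _) (ae_of_all _ fun x => by positivity),
            integral_const_mul, ← hI, ← mul_assoc, ← ENNReal.ofReal_pow hI0,
            ← ENNReal.ofReal_mul (by positivity)]
          congr 2
          obtain ⟨j, rfl⟩ := Nat.exists_eq_add_of_le' hm
          rw [Nat.add_sub_cancel, pow_mul, mul_pow _ I, pow_succ I,
            show (8 * ((j + 1 : ℕ) : ℝ) * D) ^ 2 = 64 * ((j + 1 : ℕ) : ℝ) ^ 2 * D ^ 2 by ring]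
          ring
  have hmarkov := mul_meas_ge_le_lintegral₀ (hYm.pow_const m).aemeasurable (μ := μ)
    (ENNReal.ofReal (y ^ m))
  have h1 : ENNReal.ofReal ((y ^ m)⁻¹) * ENNReal.ofReal (y ^ m) = 1 := by
    rw [← ENNReal.ofReal_mul (by positivity), inv_mul_cancel₀ (by positivity), ENNReal.ofReal_one]
  calc μ {u | y ≤ ∫ x, ‖multSum w s u x‖ ^ 4}
      ≤ μ {u | ENNReal.ofReal (y ^ m) ≤ (∫⁻ x, ENNReal.ofReal (‖multSum w s u x‖ ^ 4)) ^ m} :=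
        measure_mono hsub
    _ = ENNReal.ofReal ((y ^ m)⁻¹) * (ENNReal.ofReal (y ^ m) *
        μ {u | ENNReal.ofReal (y ^ m) ≤ (∫⁻ x, ENNReal.ofReal (‖multSum w s u x‖ ^ 4)) ^ m}) := by
        rw [← mul_assoc, h1, one_mul]
    _ ≤ ENNReal.ofReal ((y ^ m)⁻¹) *
        (ENNReal.ofReal ((64 * m ^ 2 * D ^ 2 * I) ^ m) * gaussConst) :=
        mul_le_mul' le_rfl (hmarkov.trans hE)
    _ = _ := by
        rw [← mul_assoc, ← ENNReal.ofReal_mul (by positivity), div_pow, div_eq_inv_mul]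

/-- A telescoping bound for the tails of `∑ (2/λ_n²)²`. -/
theorem sum_coeffVar_sq_le {M : ℕ} (hM : 1 ≤ M) (N : ℕ) :
    ∑ n ∈ Finset.Ico M N, coeffVar n ^ 2 ≤ 4 / M := by
  have hM0 : (0 : ℝ) < M := by exact_mod_cast hM
  have key : ∀ d : ℕ, ∑ i ∈ Finset.range d, coeffVar (M + i) ^ 2 ≤ 4 / M - 4 / (M + d) := by
    intro d
    induction d with
    | zero => simp
    | succ d ih =>
      rw [Finset.sum_range_succ]
      have h1 := coeffVar_le (M + d)
      have h2 : coeffVar (M + d) ^ 2 ≤ (2 / (((M + d : ℕ) : ℝ) + 1)) ^ 2 := by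
        gcongr
        exact (coeffVar_pos _).le
      have h3 : (2 / (((M + d : ℕ) : ℝ) + 1)) ^ 2 ≤ 4 / (M + d) - 4 / (M + (d + 1 : ℕ)) := by
        push_cast
        have hp : (0 : ℝ) < M + d := by positivity
        rw [div_pow, div_sub_div _ _ (by positivity) (by positivity),
          div_le_div_iff₀ (by positivity) (by positivity)]
        nlinarith
      linarith
  rw [Finset.sum_Ico_eq_sum_range]
  refine (key _).trans ?_
  rw [sub_le_self_iff]
  positivity

/-- When the renormalized mass of the frequencies `n ≤ N` is at most `R`, the mass of the
frequencies below `M` is not much larger than its expectation, since the other frequencies are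
unlikely to have much less mass than expected. -/
theorem measure_mass_filter_gt_le
    (hγ : ∀ n, HasLaw (normCoeff σ n) stdComplexGaussian μ) (hind : iIndepFun (normCoeff σ) μ)
    (R : ℝ) {M : ℕ} (hM : 1 ≤ M) (N : ℕ) :
    μ {u | |mass (Finset.range (N + 1)) u - alphaN N| ≤ R ∧
      R + ∑ n ∈ Finset.range M, coeffVar n + 1 <
        mass ((Finset.range (N + 1)).filter (· < M)) u} ≤ ENNReal.ofReal (Real.exp (-(M / 8))) := by
  set S := Finset.range (N + 1) with hS
  have hM0 : (0 : ℝ) < M := by exact_mod_cast hM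
  have hsub : {u : HSob (-σ) | |mass S u - alphaN N| ≤ R ∧
      R + ∑ n ∈ Finset.range M, coeffVar n + 1 < mass (S.filter (· < M)) u} ⊆
      {u | 1 ≤ ∑ n ∈ S.filter (fun n => ¬ n < M), coeffVar n * (1 - ‖normCoeff σ n u‖ ^ 2)} := by
    rintro u ⟨h1, h2⟩
    have e1 : mass S u = mass (S.filter (· < M)) u + mass (S.filter (fun n => ¬ n < M)) u :=
      (Finset.sum_filter_add_sum_filter_not S (· < M) _).symm
    have e2 : alphaN N = ∑ n ∈ S.filter (· < M), coeffVar n +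
        ∑ n ∈ S.filter (fun n => ¬ n < M), coeffVar n :=
      (Finset.sum_filter_add_sum_filter_not S (· < M) _).symm
    have e3 : ∑ n ∈ S.filter (· < M), coeffVar n ≤ ∑ n ∈ Finset.range M, coeffVar n :=
      Finset.sum_le_sum_of_subset_of_nonneg
        (fun n hn => Finset.mem_range.2 (Finset.mem_filter.1 hn).2)
        fun n _ _ => (coeffVar_pos n).le
    have e4 : mass (S.filter (fun n => ¬ n < M)) u =
        ∑ n ∈ S.filter (fun n => ¬ n < M), coeffVar n * ‖normCoeff σ n u‖ ^ 2 := by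
      refine Finset.sum_congr rfl fun n _ => ?_
      rw [coeff_eq_mul_normCoeff, norm_mul, mul_pow, Complex.norm_real, Real.norm_eq_abs, sq_abs,
        Real.sq_sqrt (coeffVar_pos n).le]
    rw [Set.mem_ofPred_eq]
    simp only [mul_sub, mul_one, Finset.sum_sub_distrib]
    have h3 := (abs_le.1 h1).2
    linarith
  have h1 := measureReal_one_le_sum_one_sub_le hγ hind (a := coeffVar)
    (fun n => (coeffVar_pos n).le) (S.filter fun n => ¬ n < M) (t := M / 4) (by positivity)
  have h2 : ∑ n ∈ S.filter (fun n => ¬ n < M), coeffVar n ^ 2 ≤ 4 / M := by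
    refine le_trans (Finset.sum_le_sum_of_subset_of_nonneg (fun n hn => ?_)
      fun _ _ _ => sq_nonneg _) (sum_coeffVar_sq_le hM (N + 1))
    rw [Finset.mem_filter, hS, Finset.mem_range] at hn
    exact Finset.mem_Ico.2 ⟨by omega, hn.1⟩
  refine (measure_mono hsub).trans ?_
  rw [← ofReal_measureReal]
  refine ENNReal.ofReal_le_ofReal (h1.trans ?_)
  rw [Real.exp_le_exp]
  calc -((M : ℝ) / 4) + ((M : ℝ) / 4) ^ 2 / 2 *
        ∑ n ∈ S.filter (fun n => ¬ n < M), coeffVar n ^ 2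
      ≤ -((M : ℝ) / 4) + ((M : ℝ) / 4) ^ 2 / 2 * (4 / M) := by gcongr
    _ = -((M : ℝ) / 8) := by
        field_simp
        ring

end Quartic

/-! ### Exponential integrability of the truncated quartic energy -/

/-- The expected mass of the frequencies below `M` grows logarithmically; a small power of `M` is
convenient and sufficient. -/
theorem sum_range_coeffVar_le (M : ℕ) :
    ∑ n ∈ Finset.range M, coeffVar n ≤ 258 * ((M : ℝ) + 1) ^ (1 / 128 : ℝ) := by
  have h1 : ∑ n ∈ Finset.range M, coeffVar n ≤ 2 * (harmonic M : ℝ) := by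
    rw [harmonic]
    push_cast
    rw [Finset.mul_sum]
    exact Finset.sum_le_sum fun n _ => (coeffVar_le n).trans (le_of_eq (div_eq_mul_inv _ _))
  have h2 := harmonic_le_one_add_log M
  have h3 : Real.log M ≤ Real.log (M + 1) := by
    rcases Nat.eq_zero_or_pos M with rfl | h
    · simp
    · exact Real.log_le_log (by exact_mod_cast h) (by linarith)
  have h4 := Real.log_le_rpow_div (x := (M : ℝ) + 1) (by positivity)
    (show (0 : ℝ) < 1 / 128 by norm_num)
  have h5 : (1 : ℝ) ≤ ((M : ℝ) + 1) ^ (1 / 128 : ℝ) :=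
    Real.one_le_rpow (by have : (0 : ℝ) ≤ M := M.cast_nonneg
                         linarith) (by norm_num)
  have h6 : ((M : ℝ) + 1) ^ (1 / 128 : ℝ) / (1 / 128) = 128 * ((M : ℝ) + 1) ^ (1 / 128 : ℝ) := by
    ring
  linarith

theorem rpow_neg_le_inv_pow {b z : ℝ} (hz : 0 < z) {j : ℕ} (h : z ^ (8 * j) ≤ b) :
    b ^ (-(1 / 8) : ℝ) ≤ (z ^ j)⁻¹ := by
  have h1 : b ^ (-(1 / 8) : ℝ) ≤ (z ^ (8 * j)) ^ (-(1 / 8) : ℝ) :=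
    Real.rpow_le_rpow_of_nonpos (by positivity) h (by norm_num)
  refine h1.trans (le_of_eq ?_)
  rw [mul_comm 8 j, pow_mul, Real.rpow_neg (by positivity), one_div]
  congr 1
  exact Real.pow_rpow_inv_natCast (n := 8) (by positivity) (by norm_num)

theorem rpow_le_of_le_pow {b y : ℝ} (hb : 0 ≤ b) (hy : 0 ≤ y) (h : b ≤ y ^ 128) :
    b ^ (1 / 128 : ℝ) ≤ y := by
  have h1 : b ^ (1 / 128 : ℝ) ≤ (y ^ 128) ^ (1 / 128 : ℝ) := Real.rpow_le_rpow hb h (by norm_num)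
  refine h1.trans (le_of_eq ?_)
  rw [one_div]
  exact Real.pow_rpow_inv_natCast (n := 128) hy (by norm_num)

/-- The choice of the frequencies that separate the three regimes at level `i²`: below `L i²` the
mass is controlled, between `L i²` and `L i¹⁶` both the mass and the variance are, and beyond
`L i¹⁶` the variance is tiny. The computations are in terms of `z = i^{1/8}`. -/
theorem eventually_level_bounds {R K W C I : ℝ} (hR : 0 ≤ R) (hK : 0 ≤ K)
    (hC : 0 < C) (hI : 0 ≤ I) {L : ℕ} (hL : 1 ≤ L) : ∀ᶠ i : ℕ in atTop, 1 ≤ i ∧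
      4 * √((L * i ^ 2 : ℕ) + 1) *
        (W ^ 2 * (R + ∑ n ∈ Finset.range (L * i ^ 2), coeffVar n + 1)) ^ 2 < (i : ℝ) ^ 2 / 81 ∧
      81 * K * (W ^ 2 * (R + ∑ n ∈ Finset.range (L * i ^ 16), coeffVar n + 1)) *
        (W ^ 2 * (C * (((L * i ^ 2 : ℕ) : ℝ) + 1) ^ (-(1 / 8) : ℝ))) ≤ 1 / 8 ∧
      64 * ((i ^ 2 : ℕ) : ℝ) ^ 2 *
        (W ^ 2 * (C * (((L * i ^ 16 : ℕ) : ℝ) + 1) ^ (-(1 / 8) : ℝ))) ^ 2 * I /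
        ((i : ℝ) ^ 2 / 81) ≤ Real.exp (-K) := by
  set c : ℝ := R + 1 + 516 * L with hc
  have hc0 : 0 < c := by positivity
  set T : ℝ := 1 + 648 * L * W ^ 4 * c ^ 2 + 648 * K * W ^ 4 * c * C +
    5184 * W ^ 4 * C ^ 2 * I * Real.exp K with hT
  have hz : Tendsto (fun i : ℕ => (i : ℝ) ^ (1 / 8 : ℝ)) atTop atTop :=
    (tendsto_rpow_atTop (by norm_num)).comp tendsto_natCast_atTop_atTop
  filter_upwards [hz.eventually_gt_atTop T, eventually_ge_atTop 1] with i hi hi1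
  set z : ℝ := (i : ℝ) ^ (1 / 8 : ℝ) with hzdef
  have n1 : 0 ≤ 648 * L * W ^ 4 * c ^ 2 := by positivity
  have n2 : 0 ≤ 648 * K * W ^ 4 * c * C := by positivity
  have n3 : 0 ≤ 5184 * W ^ 4 * C ^ 2 * I * Real.exp K := by positivity
  have hz1 : 1 ≤ z := by linarith
  have hz0 : 0 < z := by linarith
  have hiz : (i : ℝ) = z ^ 8 := by
    rw [hzdef, ← Real.rpow_natCast, ← Real.rpow_mul (by positivity)]
    norm_num
  have hL1 : (1 : ℝ) ≤ L := by exact_mod_cast hL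
  have hM1 : (((L * i ^ 2 : ℕ) : ℝ)) = L * z ^ 16 := by
    push_cast
    rw [hiz]
    ring
  have hM2 : (((L * i ^ 16 : ℕ) : ℝ)) = L * z ^ 128 := by
    push_cast
    rw [hiz]
    ring
  have p16 : 1 ≤ z ^ 16 := one_le_pow₀ hz1
  have p128 : 1 ≤ z ^ 128 := one_le_pow₀ hz1
  have hle128 : (L : ℝ) * z ^ 128 + 1 ≤ (2 * L * z) ^ 128 := by
    have h1 : (2 * L : ℝ) ≤ (2 * L) ^ 128 := le_self_pow₀ (by linarith) (by norm_num)
    calc (L : ℝ) * z ^ 128 + 1 ≤ 2 * L * z ^ 128 := by nlinarith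
      _ ≤ (2 * L) ^ 128 * z ^ 128 := by gcongr
      _ = _ := (mul_pow _ _ _).symm
  have hα : ∀ M : ℕ, (M : ℝ) ≤ L * z ^ 128 →
      R + ∑ n ∈ Finset.range M, coeffVar n + 1 ≤ c * z := fun M hM => by
    have h1 := sum_range_coeffVar_le M
    have h2 : ((M : ℝ) + 1) ^ (1 / 128 : ℝ) ≤ 2 * L * z :=
      rpow_le_of_le_pow (by positivity) (by positivity) ((by linarith : (M : ℝ) + 1 ≤ _).trans
        hle128)
    have h3 : R + 1 ≤ (R + 1) * z := le_mul_of_one_le_right (by linarith) hz1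
    calc R + ∑ n ∈ Finset.range M, coeffVar n + 1 ≤ (R + 1) * z + 258 * (2 * L * z) := by linarith
      _ = c * z := by rw [hc]; ring
  have hα0 : ∀ M : ℕ, 0 ≤ R + ∑ n ∈ Finset.range M, coeffVar n + 1 := fun M => by
    have : 0 ≤ ∑ n ∈ Finset.range M, coeffVar n :=
      Finset.sum_nonneg fun n _ => (coeffVar_pos n).le
    positivity
  have hα1 := hα (L * i ^ 2) (by
    rw [hM1]
    gcongr
    norm_num)
  have hα2 := hα (L * i ^ 16) hM2.le
  refine ⟨hi1, ?_, ?_, ?_⟩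
  · have hs : √(((L * i ^ 2 : ℕ) : ℝ) + 1) ≤ 2 * L * z ^ 8 := by
      rw [Real.sqrt_le_left (by positivity), hM1]
      have : (L : ℝ) ≤ L ^ 2 := le_self_pow₀ hL1 (by norm_num)
      nlinarith
    have h1 : 648 * L * W ^ 4 * c ^ 2 < z ^ 6 :=
      (by linarith : 648 * L * W ^ 4 * c ^ 2 < z).trans_le (le_self_pow₀ hz1 (by norm_num))
    calc 4 * √(((L * i ^ 2 : ℕ) : ℝ) + 1) *
          (W ^ 2 * (R + ∑ n ∈ Finset.range (L * i ^ 2), coeffVar n + 1)) ^ 2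
        ≤ 4 * (2 * L * z ^ 8) * (W ^ 2 * (c * z)) ^ 2 := by
          gcongr
          exact mul_nonneg (sq_nonneg _) (hα0 _)
      _ = 648 * L * W ^ 4 * c ^ 2 * (z ^ 10 / 81) := by ring
      _ < z ^ 6 * (z ^ 10 / 81) := by gcongr
      _ = (i : ℝ) ^ 2 / 81 := by
        rw [hiz]
        ring
  · have hr : (((L * i ^ 2 : ℕ) : ℝ) + 1) ^ (-(1 / 8) : ℝ) ≤ (z ^ 2)⁻¹ :=
      rpow_neg_le_inv_pow hz0 (j := 2) (by
        rw [hM1]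
        have h16 : z ^ (8 * 2) = z ^ 16 := by norm_num
        rw [h16]
        nlinarith)
    calc 81 * K * (W ^ 2 * (R + ∑ n ∈ Finset.range (L * i ^ 16), coeffVar n + 1)) *
          (W ^ 2 * (C * (((L * i ^ 2 : ℕ) : ℝ) + 1) ^ (-(1 / 8) : ℝ)))
        ≤ 81 * K * (W ^ 2 * (c * z)) * (W ^ 2 * (C * (z ^ 2)⁻¹)) := by gcongr
      _ = 648 * K * W ^ 4 * c * C * (z⁻¹ / 8) := by
        field_simp
        ring
      _ ≤ z * (z⁻¹ / 8) := by
        gcongr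
        linarith
      _ = 1 / 8 := by
        field_simp
  · have hr : (((L * i ^ 16 : ℕ) : ℝ) + 1) ^ (-(1 / 8) : ℝ) ≤ (z ^ 16)⁻¹ :=
      rpow_neg_le_inv_pow hz0 (j := 16) (by
        rw [hM2]
        have h128 : z ^ (8 * 16) = z ^ 128 := by norm_num
        rw [h128]
        nlinarith)
    have h1 : 5184 * W ^ 4 * C ^ 2 * I * Real.exp K ≤ z ^ 16 :=
      (by linarith : 5184 * W ^ 4 * C ^ 2 * I * Real.exp K ≤ z).trans
        (le_self_pow₀ hz1 (by norm_num))
    rw [div_le_iff₀ (by positivity), Real.exp_neg]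
    calc 64 * ((i ^ 2 : ℕ) : ℝ) ^ 2 *
          (W ^ 2 * (C * (((L * i ^ 16 : ℕ) : ℝ) + 1) ^ (-(1 / 8) : ℝ))) ^ 2 * I
        ≤ 64 * ((i ^ 2 : ℕ) : ℝ) ^ 2 * (W ^ 2 * (C * (z ^ 16)⁻¹)) ^ 2 * I := by gcongr
      _ = (5184 * W ^ 4 * C ^ 2 * I * Real.exp K) * ((Real.exp K)⁻¹ / 81) := by
        push_cast
        rw [hiz]
        have := Real.exp_pos K
        field_simp
        ring
      _ ≤ z ^ 16 * ((Real.exp K)⁻¹ / 81) := by gcongr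
      _ = (Real.exp K)⁻¹ * ((i : ℝ) ^ 2 / 81) := by
        rw [hiz]
        ring

theorem add_add_pow_four_le (a b c : ℝ) :
    (a + b + c) ^ 4 ≤ 27 * (a ^ 4 + b ^ 4 + c ^ 4) := by
  have h1 : (a + b + c) ^ 2 ≤ 3 * (a ^ 2 + b ^ 2 + c ^ 2) := by
    nlinarith [sq_nonneg (a - b), sq_nonneg (b - c), sq_nonneg (a - c)]
  have h2 : (a ^ 2 + b ^ 2 + c ^ 2) ^ 2 ≤ 3 * (a ^ 4 + b ^ 4 + c ^ 4) := by
    nlinarith [sq_nonneg (a ^ 2 - b ^ 2), sq_nonneg (b ^ 2 - c ^ 2), sq_nonneg (a ^ 2 - c ^ 2)]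
  calc (a + b + c) ^ 4 = ((a + b + c) ^ 2) ^ 2 := by ring
    _ ≤ (3 * (a ^ 2 + b ^ 2 + c ^ 2)) ^ 2 := by gcongr
    _ ≤ _ := by nlinarith

section Tail

variable {σ : ℝ}

/-- The quartic energy is split at the frequencies `M₁` and `M₂`; the constant `27 = 3³` is that of
`|a + b + c|⁴ ≤ 27 (|a|⁴ + |b|⁴ + |c|⁴)`. -/
theorem integral_norm_multSum_pow_four_split_le (w : ℕ → ℝ) (S : Finset ℕ) (M₁ M₂ : ℕ)
    (u : HSob (-σ)) :
    ∫ x, ‖multSum w S u x‖ ^ 4 ≤ 27 * ((∫ x, ‖multSum w (S.filter (· < M₁)) u x‖ ^ 4) +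
      (∫ x, ‖multSum w ((S.filter fun n => ¬ n < M₁).filter (· < M₂)) u x‖ ^ 4) +
      ∫ x, ‖multSum w ((S.filter fun n => ¬ n < M₁).filter fun n => ¬ n < M₂) u x‖ ^ 4) := by
  have hi : ∀ s : Finset ℕ, Integrable fun x => ‖multSum w s u x‖ ^ 4 := fun s =>
    integrable_norm_multSum_pow w s u (by norm_num)
  rw [← integral_add (hi _) (hi _), ← integral_add (f := fun x =>
      ‖multSum w (S.filter (· < M₁)) u x‖ ^ 4 +
        ‖multSum w ((S.filter fun n => ¬ n < M₁).filter (· < M₂)) u x‖ ^ 4)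
      ((hi _).add (hi _)) (hi _), ← integral_const_mul]
  refine integral_mono (hi _) ((((hi _).add (hi _)).add (hi _)).const_mul _) fun x => ?_
  have h1 : multSum w S u x = multSum w (S.filter (· < M₁)) u x +
      multSum w ((S.filter fun n => ¬ n < M₁).filter (· < M₂)) u x +
      multSum w ((S.filter fun n => ¬ n < M₁).filter fun n => ¬ n < M₂) u x := by
    rw [add_assoc]
    simp only [multSum]
    rw [Finset.sum_filter_add_sum_filter_not, Finset.sum_filter_add_sum_filter_not]
  have h2 : ‖multSum w S u x‖ ≤ ‖multSum w (S.filter (· < M₁)) u x‖ +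
      ‖multSum w ((S.filter fun n => ¬ n < M₁).filter (· < M₂)) u x‖ +
      ‖multSum w ((S.filter fun n => ¬ n < M₁).filter fun n => ¬ n < M₂) u x‖ := by
    rw [h1]
    exact norm_add₃_le
  exact (pow_le_pow_left₀ (norm_nonneg _) h2 4).trans
    (add_add_pow_four_le _ _ _)

variable {μ : Measure (HSob (-σ))} [IsProbabilityMeasure μ]

/-- On the event that the renormalized mass is at most `R`, the tail of the quartic energy is
smaller than any exponential, uniformly in `N`. -/
theorem exists_measure_energy_tail_le
    (hγ : ∀ n, HasLaw (normCoeff σ n) stdComplexGaussian μ) (hind : iIndepFun (normCoeff σ) μ)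
    {R K W : ℝ} (hR : 0 ≤ R) (hK : 0 ≤ K) :
    ∃ (B : ℝ≥0∞) (i₀ : ℕ), B ≠ ∞ ∧ 1 ≤ i₀ ∧ ∀ i, i₀ ≤ i → ∀ (N : ℕ) (w : ℕ → ℝ),
      (∀ n, |w n| ≤ W) →
      μ {u | |mass (Finset.range (N + 1)) u - alphaN N| ≤ R ∧
        (i : ℝ) ^ 2 ≤ ∫ x, ‖multSum w (Finset.range (N + 1)) u x‖ ^ 4} ≤
        B * ENNReal.ofReal (Real.exp (-(K * (i : ℝ) ^ 2))) := by
  obtain ⟨C, hC, hvar⟩ := exists_sum_sq_le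
  obtain ⟨L, hL⟩ := exists_nat_ge (8 * K + 1)
  have hL1 : 1 ≤ L := by
    have : (1 : ℝ) ≤ L := by linarith
    exact_mod_cast this
  set I := ∫ x, greenMajorant x ^ 2 with hI
  have hI0 : 0 ≤ I := integral_greenMajorant_sq_pos.le
  obtain ⟨i₀, hi₀⟩ := eventually_atTop.1
    (eventually_level_bounds (R := R) (K := K) (W := W) (C := C) (I := I) hR hK hC hI0 hL1)
  set B₁ : ℝ≥0∞ := 1 + ENNReal.ofReal (81 * K * (128 * (W ^ 2 * C) ^ 2 * I)) * gaussConst with hB₁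
  refine ⟨1 + 1 + B₁ + gaussConst, max i₀ 1, ?_, le_max_right _ _, fun i hi N w hw => ?_⟩
  · exact ENNReal.add_ne_top.2 ⟨ENNReal.add_ne_top.2 ⟨by norm_num, ENNReal.add_ne_top.2
      ⟨by norm_num, ENNReal.mul_ne_top ENNReal.ofReal_ne_top gaussConst_ne_top⟩⟩,
      gaussConst_ne_top⟩
  obtain ⟨hi1, hlow, hmid, hhigh⟩ := hi₀ i ((le_max_left _ _).trans hi)
  have hi0 : (0 : ℝ) < i := by exact_mod_cast hi1
  have hLr : 8 * K ≤ L := by linarith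
  set S := Finset.range (N + 1) with hS
  set M₁ := L * i ^ 2 with hM₁
  set M₂ := L * i ^ 16 with hM₂
  have hM₁1 : 1 ≤ M₁ := Nat.mul_pos hL1 (Nat.pow_pos hi1)
  have hM₂1 : 1 ≤ M₂ := Nat.mul_pos hL1 (Nat.pow_pos hi1)
  set mid := (S.filter fun n => ¬ n < M₁).filter (· < M₂) with hmidS
  set high := (S.filter fun n => ¬ n < M₁).filter fun n => ¬ n < M₂ with hhighS
  -- the level `i²` is reached only if there is too much mass below `M₁` (`E₁`) or below `M₂` (`E₂`),
  -- or if the middle (`E₃`) or the high (`E₄`) frequencies have energy at least `y = i² / (3 * 27)`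
  set E₁ := {u : HSob (-σ) | |mass S u - alphaN N| ≤ R ∧
    R + ∑ n ∈ Finset.range M₁, coeffVar n + 1 < mass (S.filter (· < M₁)) u} with hE₁
  set E₂ := {u : HSob (-σ) | |mass S u - alphaN N| ≤ R ∧
    R + ∑ n ∈ Finset.range M₂, coeffVar n + 1 < mass (S.filter (· < M₂)) u} with hE₂
  set A := W ^ 2 * (R + ∑ n ∈ Finset.range M₂, coeffVar n + 1) with hA
  set y := (i : ℝ) ^ 2 / 81 with hy
  set E₃ := {u : HSob (-σ) | ∫ x, ‖multSum w mid u x‖ ^ 2 ≤ A ∧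
    y ≤ ∫ x, ‖multSum w mid u x‖ ^ 4} with hE₃
  set E₄ := {u : HSob (-σ) | y ≤ ∫ x, ‖multSum w high u x‖ ^ 4} with hE₄
  have hsub : {u : HSob (-σ) | |mass S u - alphaN N| ≤ R ∧
      (i : ℝ) ^ 2 ≤ ∫ x, ‖multSum w S u x‖ ^ 4} ⊆ E₁ ∪ E₂ ∪ E₃ ∪ E₄ := by
    rintro u ⟨hu1, hu2⟩
    by_contra hcon
    simp only [Set.mem_union, not_or] at hcon
    obtain ⟨⟨⟨h1, h2⟩, h3⟩, h4⟩ := hcon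
    have g1 : mass (S.filter (· < M₁)) u ≤ R + ∑ n ∈ Finset.range M₁, coeffVar n + 1 :=
      not_lt.1 fun h => h1 ⟨hu1, h⟩
    have g2 : mass (S.filter (· < M₂)) u ≤ R + ∑ n ∈ Finset.range M₂, coeffVar n + 1 :=
      not_lt.1 fun h => h2 ⟨hu1, h⟩
    have g3 : ∫ x, ‖multSum w (S.filter (· < M₁)) u x‖ ^ 4 < y := by
      have hsl : S.filter (· < M₁) ⊆ Finset.range (M₁ + 1) := fun n hn =>
        Finset.mem_range.2 ((Finset.mem_filter.1 hn).2.trans (Nat.lt_succ_self _))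
      refine (integral_norm_multSum_pow_four_le (fun n _ => hw n) hsl u).trans_lt
        (lt_of_le_of_lt ?_ hlow)
      have := mass_nonneg (S.filter (· < M₁)) u
      gcongr
    have g4 : ∫ x, ‖multSum w mid u x‖ ^ 4 < y := by
      refine not_le.1 fun h => h3 ⟨?_, h⟩
      refine (integral_norm_multSum_sq_le (fun n _ => hw n) u).trans ?_
      have hmm : mass mid u ≤ mass (S.filter (· < M₂)) u :=
        mass_mono (Finset.filter_subset_filter _ (Finset.filter_subset _ _)) u
      exact mul_le_mul_of_nonneg_left (hmm.trans g2) (sq_nonneg _)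
    have g5 : ∫ x, ‖multSum w high u x‖ ^ 4 < y := not_le.1 h4
    have g6 := integral_norm_multSum_pow_four_split_le w S M₁ M₂ u
    have : 81 * y = (i : ℝ) ^ 2 := by rw [hy]; ring
    linarith
  have hexp : ∀ M : ℕ, (L * i ^ 2 : ℕ) ≤ M →
      ENNReal.ofReal (Real.exp (-((M : ℝ) / 8))) ≤
        ENNReal.ofReal (Real.exp (-(K * (i : ℝ) ^ 2))) := fun M hM => by
    refine ENNReal.ofReal_le_ofReal (Real.exp_le_exp.2 ?_)
    have h1 : ((L * i ^ 2 : ℕ) : ℝ) ≤ M := by exact_mod_cast hM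
    push_cast at h1
    nlinarith [sq_nonneg (i : ℝ)]
  have b1 : μ E₁ ≤ ENNReal.ofReal (Real.exp (-(K * (i : ℝ) ^ 2))) :=
    (measure_mass_filter_gt_le hγ hind R hM₁1 N).trans (hexp M₁ le_rfl)
  have b2 : μ E₂ ≤ ENNReal.ofReal (Real.exp (-(K * (i : ℝ) ^ 2))) :=
    (measure_mass_filter_gt_le hγ hind R hM₂1 N).trans (hexp M₂
      (Nat.mul_le_mul le_rfl (Nat.pow_le_pow_right hi1 (by norm_num))))
  have hge : ∀ (M : ℕ) (s : Finset ℕ), (∀ n ∈ s, M ≤ n) → ∀ x,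
      ∑ n ∈ s, (w n * √(coeffVar n) * hermiteFun n x) ^ 2 ≤
        W ^ 2 * (C * ((M : ℝ) + 1) ^ (-(1 / 8) : ℝ)) * greenMajorant x := fun M s hs x => by
    rw [mul_assoc]
    exact hvar M s w W hs (fun n _ => hw n) x
  have b3 : μ E₃ ≤ ENNReal.ofReal (Real.exp (-(K * (i : ℝ) ^ 2))) * B₁ := by
    have hD0 : 0 ≤ W ^ 2 * (C * ((M₁ : ℝ) + 1) ^ (-(1 / 8) : ℝ)) := by positivity
    have hA0 : 0 ≤ A := by
      have : 0 ≤ ∑ n ∈ Finset.range M₂, coeffVar n :=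
        Finset.sum_nonneg fun n _ => (coeffVar_pos n).le
      positivity
    have h := measure_mass_le_inter_energy_ge_le hγ hind (w := w) (s := mid) hD0
      (hge M₁ mid fun n hn => not_lt.1
        (Finset.mem_filter.1 (Finset.mem_filter.1 hn).1).2) (p := 81 * K) (by positivity) hA0
      hmid y
    refine h.trans (mul_le_mul' (le_of_eq ?_) (add_le_add le_rfl (mul_le_mul'
      (ENNReal.ofReal_le_ofReal ?_) le_rfl)))
    · -- the exponent `p = 81 K` makes up for the loss in `y`
      congr 3
      rw [hy]
      ring
    · have h1 : ((M₁ : ℝ) + 1) ^ (-(1 / 8) : ℝ) ≤ 1 :=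
        Real.rpow_le_one_of_one_le_of_nonpos (by
          have : (0 : ℝ) ≤ M₁ := Nat.cast_nonneg _
          linarith) (by norm_num)
      have h2 : W ^ 2 * (C * ((M₁ : ℝ) + 1) ^ (-(1 / 8) : ℝ)) ≤ W ^ 2 * C := by
        gcongr
        exact mul_le_of_le_one_right hC.le h1
      gcongr
  have b4 : μ E₄ ≤ ENNReal.ofReal (Real.exp (-(K * (i : ℝ) ^ 2))) * gaussConst := by
    have hD0 : 0 ≤ W ^ 2 * (C * ((M₂ : ℝ) + 1) ^ (-(1 / 8) : ℝ)) := by positivity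
    have h := measure_energy_ge_le hγ hind (w := w) (s := high) hD0
      (hge M₂ high fun n hn => not_lt.1 (Finset.mem_filter.1 hn).2) (m := i ^ 2)
      (Nat.pow_pos hi1) (y := y) (by positivity)
    refine h.trans (mul_le_mul' (ENNReal.ofReal_le_ofReal ?_) le_rfl)
    refine (pow_le_pow_left₀ (by positivity) hhigh _).trans (le_of_eq ?_)
    rw [← Real.exp_nat_mul]
    congr 1
    push_cast
    ring
  calc μ {u | |mass S u - alphaN N| ≤ R ∧ (i : ℝ) ^ 2 ≤ ∫ x, ‖multSum w S u x‖ ^ 4}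
      ≤ μ (E₁ ∪ E₂ ∪ E₃ ∪ E₄) := measure_mono hsub
    _ ≤ μ E₁ + μ E₂ + μ E₃ + μ E₄ :=
        (measure_union_le _ _).trans (add_le_add ((measure_union_le _ _).trans
          (add_le_add (measure_union_le _ _) le_rfl)) le_rfl)
    _ ≤ _ := add_le_add (add_le_add (add_le_add b1 b2) b3) b4
    _ = _ := by ring

end Tail

/-! ### The focusing measure -/

section Focusing

variable {σ : ℝ} {μ : Measure (HSob (-σ))} [IsProbabilityMeasure μ]

theorem sum_exp_neg_sq_ne_top (B : ℝ≥0∞) (hB : B ≠ ∞) (i₀ : ℕ) :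
    ∑' j : ℕ, B * ENNReal.ofReal (Real.exp (-((i₀ + j : ℕ) : ℝ) ^ 2)) ≠ ∞ := by
  rw [ENNReal.tsum_mul_left]
  refine ENNReal.mul_ne_top hB ?_
  have hsum : Summable fun j : ℕ => Real.exp (-(j : ℝ)) := Real.summable_exp_neg_nat
  refine ne_top_of_le_ne_top hsum.tsum_ofReal_ne_top (ENNReal.tsum_le_tsum fun j => ?_)
  refine ENNReal.ofReal_le_ofReal (Real.exp_le_exp.2 ?_)
  have h : j ≤ (i₀ + j) ^ 2 := (Nat.le_add_left j i₀).trans (Nat.le_self_pow two_ne_zero _)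
  have h2 : (j : ℝ) ≤ ((i₀ + j : ℕ) : ℝ) ^ 2 := by exact_mod_cast h
  linarith

/-- All exponential moments of the truncated quartic energy on the event that the renormalized mass
is bounded are finite, uniformly in `N`: the tail estimate beats the exponential. -/
theorem exists_lintegral_exp_energy_le
    (hγ : ∀ n, HasLaw (normCoeff σ n) stdComplexGaussian μ) (hind : iIndepFun (normCoeff σ) μ)
    {R W t : ℝ} (hR : 0 ≤ R) (ht : 0 ≤ t) :
    ∃ C : ℝ≥0∞, C ≠ ∞ ∧ ∀ (N : ℕ) (w : ℕ → ℝ), (∀ n, |w n| ≤ W) →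
      Measurable (fun u : HSob (-σ) => ∫ x, ‖multSum w (Finset.range (N + 1)) u x‖ ^ 4) →
      ∫⁻ u, {u : HSob (-σ) | |mass (Finset.range (N + 1)) u - alphaN N| ≤ R}.indicator
        (fun u => ENNReal.ofReal
          (Real.exp (t * ∫ x, ‖multSum w (Finset.range (N + 1)) u x‖ ^ 4))) u ∂μ ≤ C := by
  obtain ⟨B, i₀, hB, -, htail⟩ := exists_measure_energy_tail_le hγ hind (R := R)
    (K := 4 * t + 1) (W := W) hR (by positivity)
  -- layer cake decomposition over the levels `i²` of the energy; the levels up to `(i₀ + 1)²` are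
  -- bounded trivially
  refine ⟨ENNReal.ofReal (Real.exp (t * ((i₀ : ℝ) + 1) ^ 2)) +
    ∑' j : ℕ, B * ENNReal.ofReal (Real.exp (-((i₀ + 1 + j : ℕ) : ℝ) ^ 2)),
    ENNReal.add_ne_top.2 ⟨ENNReal.ofReal_ne_top, sum_exp_neg_sq_ne_top B hB (i₀ + 1)⟩,
    fun N w hw hm => ?_⟩
  set Y : HSob (-σ) → ℝ := fun u => ∫ x, ‖multSum w (Finset.range (N + 1)) u x‖ ^ 4 with hY
  set D := {u : HSob (-σ) | |mass (Finset.range (N + 1)) u - alphaN N| ≤ R} with hD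
  set E : ℕ → Set (HSob (-σ)) := fun i =>
    {u | |mass (Finset.range (N + 1)) u - alphaN N| ≤ R ∧ (i : ℝ) ^ 2 ≤ Y u} with hE
  have hDm : MeasurableSet D := measurableSet_le
    (((measurable_mass _).sub measurable_const).abs) measurable_const
  have hEm : ∀ i, MeasurableSet (E i) := fun i =>
    hDm.inter (measurableSet_le measurable_const hm)
  have hpt : ∀ u, D.indicator (fun u => ENNReal.ofReal (Real.exp (t * Y u))) u ≤
      ENNReal.ofReal (Real.exp (t * ((i₀ : ℝ) + 1) ^ 2)) +
      ∑' j : ℕ, (E (i₀ + 1 + j)).indicator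
        (fun _ => ENNReal.ofReal (Real.exp (t * ((i₀ + 1 + j : ℕ) + 1 : ℝ) ^ 2))) u := fun u => by
    by_cases hu : u ∈ D
    swap
    · rw [Set.indicator_of_notMem hu]
      exact zero_le
    rw [Set.indicator_of_mem hu]
    have hY0 : 0 ≤ Y u := integral_nonneg fun x => by positivity
    by_cases hsmall : Y u ≤ ((i₀ : ℝ) + 1) ^ 2
    · refine le_add_right (ENNReal.ofReal_le_ofReal (Real.exp_le_exp.2 ?_))
      gcongr
    refine le_add_left ?_
    have hY1 : (i₀ : ℝ) + 1 ≤ √(Y u) := Real.le_sqrt_of_sq_le (not_le.1 hsmall).le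
    obtain ⟨j, hj⟩ := Nat.exists_eq_add_of_le
      (Nat.le_floor (n := i₀ + 1) (by exact_mod_cast hY1) : i₀ + 1 ≤ ⌊√(Y u)⌋₊)
    refine le_trans ?_ (ENNReal.le_tsum j)
    have hlow : ((i₀ + 1 + j : ℕ) : ℝ) ≤ √(Y u) := by
      rw [← hj]
      exact Nat.floor_le (Real.sqrt_nonneg _)
    have hup : √(Y u) ≤ ((i₀ + 1 + j : ℕ) : ℝ) + 1 := by
      rw [← hj]
      exact (Nat.lt_floor_add_one _).le
    have hmem : u ∈ E (i₀ + 1 + j) := ⟨hu, by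
      rw [← Real.sq_sqrt hY0]
      gcongr⟩
    rw [Set.indicator_of_mem hmem]
    refine ENNReal.ofReal_le_ofReal (Real.exp_le_exp.2 ?_)
    refine mul_le_mul_of_nonneg_left ?_ ht
    rw [← Real.sq_sqrt hY0]
    gcongr
  refine (lintegral_mono hpt).trans ?_
  rw [lintegral_add_left measurable_const, lintegral_const, measure_univ, mul_one,
    lintegral_tsum fun j => (measurable_const.indicator (hEm _)).aemeasurable]
  gcongr with j
  rw [lintegral_indicator_const (hEm _)]
  refine (mul_le_mul' le_rfl (htail (i₀ + 1 + j) (by omega) N w hw)).trans ?_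
  rw [mul_left_comm, ← ENNReal.ofReal_mul (Real.exp_pos _).le, ← Real.exp_add]
  gcongr
  have h1 : (1 : ℝ) ≤ (i₀ + 1 + j : ℕ) := by
    have : 1 ≤ i₀ + 1 + j := by omega
    exact_mod_cast this
  -- `(i + 1)² ≤ 4 i²` for `i ≥ 1`
  nlinarith [mul_nonneg ht (mul_nonneg (sub_nonneg.2 h1) (by linarith :
    (0 : ℝ) ≤ 3 * ((i₀ + 1 + j : ℕ) : ℝ) + 1))]

variable {χ ζ : ℝ → ℝ}

/-- The weights `G_N` are bounded in every `L^p`, uniformly in `N`. -/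
theorem exists_eLpNorm_GN_le
    (hγ : ∀ n, HasLaw (normCoeff σ n) stdComplexGaussian μ) (hind : iIndepFun (normCoeff σ) μ)
    {W : ℝ} (hW : ∀ x, |χ x| ≤ W) (hχs : tsupport χ ⊆ Set.Ioo (-1) 1)
    (hζ : Continuous ζ) (hζs : HasCompactSupport ζ) {p : ℝ} (hp : 1 ≤ p) :
    ∃ C : ℝ≥0∞, C ≠ ∞ ∧ ∀ N, eLpNorm (GN σ χ ζ N) (ENNReal.ofReal p) μ ≤ C := by
  obtain ⟨Z, hZ⟩ := hζs.exists_bound_of_continuous hζ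
  obtain ⟨R, hR0, hR⟩ := hζs.isCompact.isBounded.exists_pos_norm_le
  have hp0 : 0 < p := by linarith
  obtain ⟨C, hC, hint⟩ := exists_lintegral_exp_energy_le hγ hind (R := R) (W := W) (t := p / 4)
    hR0.le (by positivity)
  have hZ0 : 0 ≤ Z := (norm_nonneg _).trans (hZ 0)
  refine ⟨(ENNReal.ofReal (Z ^ p) * C) ^ (1 / p), ENNReal.rpow_ne_top_of_nonneg (by positivity)
    (ENNReal.mul_ne_top ENNReal.ofReal_ne_top hC), fun N => ?_⟩
  rw [eLpNorm_eq_lintegral_rpow_enorm_toReal (by simpa using hp0) ENNReal.ofReal_ne_top,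
    ENNReal.toReal_ofReal hp0.le]
  refine ENNReal.rpow_le_rpow ?_ (by positivity)
  have hm := measurable_integral_SN_pow (s := -σ) hχs N 4
  simp only [SN_eq_multSum hχs] at hm
  refine le_trans ?_ (mul_le_mul' le_rfl (hint N (cutoff χ N) (fun n => hW _) hm))
  rw [← lintegral_const_mul' _ _ ENNReal.ofReal_ne_top]
  refine lintegral_mono fun u => ?_
  have hGN : GN σ χ ζ N u = ζ (mass (Finset.range (N + 1)) u - alphaN N) *
      Real.exp (1 / 4 * ∫ x, ‖multSum (cutoff χ N) (Finset.range (N + 1)) u x‖ ^ 4) := by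
    rw [GN, integral_normSq_PiN]
    simp only [SN_eq_multSum hχs]
    rfl
  rw [hGN]
  set m := mass (Finset.range (N + 1)) u - alphaN N with hmdef
  set Y := ∫ x, ‖multSum (cutoff χ N) (Finset.range (N + 1)) u x‖ ^ 4
  by_cases hu : |m| ≤ R
  · rw [Set.indicator_of_mem (show u ∈ {u : HSob (-σ) |
        |mass (Finset.range (N + 1)) u - alphaN N| ≤ R} from hu),
      ← ofReal_norm, ENNReal.ofReal_rpow_of_nonneg (norm_nonneg _) hp0.le,
      ← ENNReal.ofReal_mul (by positivity)]
    refine ENNReal.ofReal_le_ofReal ?_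
    rw [norm_mul, Real.norm_of_nonneg (Real.exp_pos _).le,
      Real.mul_rpow (norm_nonneg _) (Real.exp_pos _).le, ← Real.exp_mul]
    refine mul_le_mul (Real.rpow_le_rpow (norm_nonneg _) (hZ m) hp0.le) (le_of_eq ?_)
      (Real.exp_pos _).le (by positivity)
    congr 1
    ring
  · have h0 : ζ m = 0 := by
      by_contra h
      exact hu (hR m (subset_tsupport _ h))
    rw [h0, zero_mul, enorm_zero, ENNReal.zero_rpow_of_pos hp0]
    exact zero_le

/-- The renormalized masses converge in `L²`: they are sums of independent centred variables whose
variances are summable. -/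
theorem exists_tendstoInMeasure_renormalized_mass
    (hγ : ∀ n, HasLaw (normCoeff σ n) stdComplexGaussian μ) (hind : iIndepFun (normCoeff σ) μ) :
    ∃ V : HSob (-σ) → ℝ, TendstoInMeasure μ
      (fun N u => mass (Finset.range (N + 1)) u - alphaN N) atTop V := by
  have heq : ∀ N, (fun u : HSob (-σ) => mass (Finset.range (N + 1)) u - alphaN N) =
      fun u => ∑ n ∈ Finset.range (N + 1), coeffVar n * (‖normCoeff σ n u‖ ^ 2 - 1) := fun N => by
    funext u
    rw [show alphaN N = ∑ n ∈ Finset.range (N + 1), coeffVar n from rfl, mass,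
      ← Finset.sum_sub_distrib]
    refine Finset.sum_congr rfl fun n _ => ?_
    rw [coeff_eq_mul_normCoeff, norm_mul, mul_pow, Complex.norm_real, Real.norm_eq_abs, sq_abs,
      Real.sq_sqrt (coeffVar_pos n).le]
    ring
  have hmem : ∀ s : Finset ℕ, MemLp (fun u : HSob (-σ) =>
      ∑ n ∈ s, coeffVar n * (‖normCoeff σ n u‖ ^ 2 - 1)) 2 μ := fun s =>
    memLp_finsetSum s fun n _ => memLp_two_norm_sq_sub_one hγ (coeffVar n) n
  have hle : ∀ N m n : ℕ, N ≤ m → m ≤ n → eLpNorm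
      ((fun u : HSob (-σ) =>
        ∑ k ∈ Finset.range (n + 1), coeffVar k * (‖normCoeff σ k u‖ ^ 2 - 1)) -
      fun u => ∑ k ∈ Finset.range (m + 1), coeffVar k * (‖normCoeff σ k u‖ ^ 2 - 1)) 2 μ ≤
      ENNReal.ofReal (√(4 / (N + 1 : ℕ))) := fun N m n hNm hmn => by
    have h1 : ((fun u : HSob (-σ) =>
        ∑ k ∈ Finset.range (n + 1), coeffVar k * (‖normCoeff σ k u‖ ^ 2 - 1)) -
        fun u => ∑ k ∈ Finset.range (m + 1), coeffVar k * (‖normCoeff σ k u‖ ^ 2 - 1)) =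
        fun u => ∑ k ∈ Finset.Ico (m + 1) (n + 1),
          coeffVar k * (‖normCoeff σ k u‖ ^ 2 - 1) := by
      funext u
      rw [Pi.sub_apply, Finset.sum_Ico_eq_sub _ (Nat.succ_le_succ hmn)]
    rw [h1, (hmem _).eLpNorm_eq_integral_rpow_norm (by norm_num) (by norm_num)]
    refine ENNReal.ofReal_le_ofReal ?_
    have h2 : (∫ u, ‖∑ k ∈ Finset.Ico (m + 1) (n + 1),
        coeffVar k * (‖normCoeff σ k u‖ ^ 2 - 1)‖ ^ (2 : ℝ≥0∞).toReal ∂μ) =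
        ∑ k ∈ Finset.Ico (m + 1) (n + 1), coeffVar k ^ 2 := by
      rw [← integral_sum_norm_sq_sub_one_sq hγ hind]
      refine integral_congr_ae (ae_of_all _ fun u => ?_)
      simp
    rw [h2, ENNReal.toReal_ofNat, ← one_div, ← Real.sqrt_eq_rpow]
    refine Real.sqrt_le_sqrt (le_trans (Finset.sum_le_sum_of_subset_of_nonneg
      (Finset.Ico_subset_Ico_left (Nat.succ_le_succ hNm)) fun _ _ _ => sq_nonneg _)
      (sum_coeffVar_sq_le (Nat.le_add_left 1 N) (n + 1)))
  have hrate : Tendsto (fun N : ℕ => ENNReal.ofReal (√(4 / (N + 1 : ℕ)))) atTop (𝓝 0) := by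
    have h1 : Tendsto (fun N : ℕ => (4 : ℝ) / (N + 1 : ℕ)) atTop (𝓝 0) :=
      (tendsto_const_div_atTop_nhds_zero_nat 4).comp (tendsto_add_atTop_nat 1)
    have h2 := (ENNReal.continuous_ofReal.comp Real.continuous_sqrt).tendsto 0 |>.comp h1
    rw [Function.comp_apply, Real.sqrt_zero, ENNReal.ofReal_zero] at h2
    exact h2
  have hc : CauchySeq fun N => (hmem (Finset.range (N + 1))).toLp := by
    rw [EMetric.cauchySeq_iff_le_tendsto_0]
    refine ⟨_, fun m n N hm hn => ?_, hrate⟩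
    rcases le_total m n with hmn | hmn
    · rw [edist_comm, Lp.edist_toLp_toLp]
      exact hle N m n hm hmn
    · rw [Lp.edist_toLp_toLp]
      exact hle N n m hn hmn
  obtain ⟨V, hV⟩ := cauchySeq_tendsto_of_complete hc
  refine ⟨V, ?_⟩
  refine (tendstoInMeasure_of_tendsto_Lp hV).congr_left fun N => ?_
  rw [heq]
  exact (hmem _).coeFn_toLp

/-- The focusing measure. Its density is the limit `ζ(V) exp(¼ ‖F‖⁴)` in measure, where `V` is the
limit of the renormalized masses and `F` the limit of the series in `L⁴`. -/
theorem focusing_conclusions (hγ : ∀ n, HasLaw (normCoeff σ n) stdComplexGaussian μ)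
    (hind : iIndepFun (normCoeff σ) μ)
    {W : ℝ} (hW : ∀ x, |χ x| ≤ W) (hχs : tsupport χ ⊆ Set.Ioo (-1) 1)
    (hχ1 : ∀ x ∈ Set.Icc (-(1 / 2) : ℝ) (1 / 2), χ x = 1)
    (hζ : Continuous ζ) (hζs : HasCompactSupport ζ) (hζ0 : ∀ x, 0 ≤ ζ x) :
    ∃ G : HSob (-σ) → ℝ,
      TendstoInMeasure μ (fun N => GN σ χ ζ N) atTop G ∧
      (∀ p : ℝ, 1 ≤ p → MemLp G (ENNReal.ofReal p) μ) ∧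
      (∀ f : HSob (-σ) →ᵇ ℝ,
        Tendsto (fun N => ∫ u, f u ∂(μ.withDensity fun u => ENNReal.ofReal (GN σ χ ζ N u))) atTop
          (𝓝 (∫ u, f u ∂(μ.withDensity fun u => ENNReal.ofReal (G u))))) ∧
      (∀ A : Set (HSob (-σ)), MeasurableSet A →
        Tendsto (fun N => (μ.withDensity fun u => ENNReal.ofReal (GN σ χ ζ N u)) A) atTop
          (𝓝 ((μ.withDensity fun u => ENNReal.ofReal (G u)) A))) := by
  have hfact : Fact (1 ≤ ((4 : ℕ) : ℝ≥0∞)) := ⟨by norm_num⟩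
  obtain ⟨F, -, -, hF⟩ := exists_limit_Lq (q := 4) le_rfl hγ hind hW hχs hχ1
  obtain ⟨V, hV⟩ := exists_tendstoInMeasure_renormalized_mass hγ hind
  have hGm : ∀ N, AEStronglyMeasurable (GN σ χ ζ N) μ := fun N =>
    (measurable_GN hχs hζ N).aestronglyMeasurable
  have hlim : TendstoInMeasure μ (fun N => GN σ χ ζ N) atTop
      fun u => ζ (V u) * Real.exp (1 / 4 * ‖F u‖ ^ 4) := by
    have hmm : ∀ N, AEStronglyMeasurable
        (fun u : HSob (-σ) => mass (Finset.range (N + 1)) u - alphaN N) μ := fun N =>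
      ((measurable_mass _).sub measurable_const).aestronglyMeasurable
    have hsm : ∀ N, AEStronglyMeasurable (fun u : HSob (-σ) => ∫ x, ‖SN χ N u x‖ ^ 4) μ := fun N =>
      (measurable_integral_SN_pow hχs N 4).aestronglyMeasurable
    have hexp : Continuous fun y : ℝ => Real.exp (1 / 4 * y) := by fun_prop
    refine (tendstoInMeasure_mul (fun N => hζ.comp_aestronglyMeasurable (hmm N))
      (fun N => hexp.comp_aestronglyMeasurable (hsm N))
      (tendstoInMeasure_continuous_comp hmm hV hζ)
      (tendstoInMeasure_continuous_comp hsm hF hexp)).congr_left fun N => ae_of_all _ fun u => ?_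
    simp only [GN]
    rw [integral_normSq_PiN]
    rfl
  refine ⟨_, hlim, fun p hp => ?_, ?_⟩
  · obtain ⟨C, hC, hbd⟩ := exists_eLpNorm_GN_le hγ hind hW hχs hζ hζs hp
    exact ⟨hlim.aestronglyMeasurable hGm, (eLpNorm_le_of_tendstoInMeasure
      (Eventually.of_forall hbd) hlim hGm).trans_lt hC.lt_top⟩
  · obtain ⟨C, hC, hbd⟩ := exists_eLpNorm_GN_le hγ hind hW hχs hζ hζs one_le_two
    rw [ENNReal.ofReal_ofNat] at hbd
    exact tendsto_withDensity_of_tendstoInMeasure hGm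
      (fun N u => mul_nonneg (hζ0 _) (Real.exp_pos _).le)
      (fun u => mul_nonneg (hζ0 _) (Real.exp_pos _).le) hC hbd hlim

end Focusing

end HarmonicGibbs

end

theorem mainTheorem3 {Ω : Type*} [MeasurableSpace Ω] (P : Measure Ω) [IsProbabilityMeasure P]
    -- independent standard complex Gaussian variables
    (g : ℕ → Ω → ℂ) (hg : ∀ n, HasLaw (g n) stdComplexGaussian P) (hind : iIndepFun g P)
    (σ : ℝ) (hσ : 0 < σ)
    -- the smooth cut-off that defines `S_N`
    (χ : ℝ → ℝ) (hχ : ContDiff ℝ ((⊤ : ℕ∞) : WithTop ℕ∞) χ) (hχs : HasCompactSupport χ)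
    (hχs' : tsupport χ ⊆ Set.Ioo (-1) 1)
    (hχ1 : ∀ x ∈ Set.Icc (-(1 / 2) : ℝ) (1 / 2), χ x = 1) :
    -- defocusing case
    (∀ k : ℕ, 3 ≤ k →
      (AEMeasurable (fun u : HSob (-σ) => distLpNorm (k + 1) u.toDist) (mu P g σ) ∧
        ∀ᵐ u ∂(mu P g σ), distLpNorm (k + 1) u.toDist < ∞) ∧
      (0 < rhoDefoc P g σ k Set.univ ∧ rhoDefoc P g σ k Set.univ < ∞) ∧
      (∀ f : HSob (-σ) →ᵇ ℝ,
        Tendsto (fun N => ∫ u, f u ∂(rhoDefocN P g σ χ k N)) atTop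
          (𝓝 (∫ u, f u ∂(rhoDefoc P g σ k)))) ∧
      (∀ A : Set (HSob (-σ)), MeasurableSet A →
        Tendsto (fun N => rhoDefocN P g σ χ k N A) atTop (𝓝 (rhoDefoc P g σ k A)))) ∧
    -- cubic focusing case
    (∀ ζ : ℝ → ℝ, Continuous ζ → HasCompactSupport ζ → (∀ x, 0 ≤ ζ x) →
      ∃ G : HSob (-σ) → ℝ,
        TendstoInMeasure (mu P g σ) (fun N => GN σ χ ζ N) atTop G ∧
        (∀ p : ℝ, 1 ≤ p → MemLp G (ENNReal.ofReal p) (mu P g σ)) ∧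
        (∀ f : HSob (-σ) →ᵇ ℝ,
          Tendsto (fun N => ∫ u, f u ∂(rhoFocN P g σ χ ζ N)) atTop
            (𝓝 (∫ u, f u ∂((mu P g σ).withDensity fun u => ENNReal.ofReal (G u))))) ∧
        (∀ A : Set (HSob (-σ)), MeasurableSet A →
          Tendsto (fun N => rhoFocN P g σ χ ζ N A) atTop
            (𝓝 (((mu P g σ).withDensity fun u => ENNReal.ofReal (G u)) A)))) := by
  obtain ⟨W, hW⟩ := hχs.exists_bound_of_continuous hχ.continuous
  -- the law of the series only depends on the variables up to null sets: make them measurable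
  set g' : ℕ → Ω → ℂ := fun n => (hg n).aemeasurable.mk (g n) with hg'
  have hae : ∀ n, g n =ᵐ[P] g' n := fun n => (hg n).aemeasurable.ae_eq_mk
  have hgm : ∀ n, Measurable (g' n) := fun n => (hg n).aemeasurable.measurable_mk
  have hgL : ∀ n, HasLaw (g' n) stdComplexGaussian P := fun n => (hg n).congr (hae n).symm
  have hgi : iIndepFun g' P := hind.congr hae
  have hcoef : ∀ᵐ ω ∂P, randCoeff g ω = randCoeff g' ω := by
    filter_upwards [ae_all_iff.2 hae] with ω hω
    funext n
    rw [randCoeff, randCoeff, hω n]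
  have hmu : mu P g σ = mu P g' σ := Measure.map_congr (hcoef.mono fun ω hω => by simp only [hω])
  have hlow : ∀ N, muLow P g σ N = muLow P g' σ N := fun N =>
    Measure.map_congr (hcoef.mono fun ω hω => by simp only [hω])
  have hhigh : ∀ N, muHigh P g σ N = muHigh P g' σ N := fun N =>
    Measure.map_congr (hcoef.mono fun ω hω => by simp only [hω])
  have hprob : IsProbabilityMeasure (mu P g' σ) := isProbabilityMeasure_mu hgm
  have hγ := hasLaw_normCoeff hgm hgL hσ
  have hγi := iIndepFun_normCoeff hgm hgL hgi hσ
  refine ⟨fun k hk => ?_, fun ζ hζ hζs hζ0 => ?_⟩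
  · simp only [rhoDefoc, rhoDefocN, hmu]
    exact defocusing_conclusions hγ hγi hW hχs' hχ1 hk
  · have hrho : ∀ N, rhoFocN P g σ χ ζ N =
        (mu P g' σ).withDensity fun u => ENNReal.ofReal (GN σ χ ζ N u) := fun N => by
      rw [← rhoFocN_eq_withDensity hgm hgL hgi hσ hχs' hζ N]
      simp only [rhoFocN, rhoFocLow, hlow, hhigh]
    simp only [hrho, hmu]
    exact focusing_conclusions hγ hγi hW hχs' hχ1 hζ hζs hζ0
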